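/- Let $\mathbb T=[-\pi,\pi]^2$ be the two-dimensional torus, $L^2_\#(\mathbb T)$ the real Hilbert space of square integrable functions on $\mathbb T$ with zero mean, and $A=-\Delta$ with periodic boundary conditions on $L^2_\#(\mathbb T)$. For $k\in\mathbf Z^2_\star=\mathbf Z^2\setminus\{0\}$ let $e_k(x)=\frac{\sqrt2}{2\pi}\sin(k\cdot x)$ if $k_2>0$ or ($k_2=0$ and $k_1>0$), and $e_k(x)=\frac{\sqrt2}{2\pi}\cos(k\cdot x)$ otherwise; this is an orthonormal basis of $L^2_\#(\mathbb T)$, and $A^\alpha\sum_k x_ke_k=\sum_k|k|^{2\alpha}x_ke_k$. Let $\nu>0$, $\alpha\ge1$ and $\delta\in(1-\alpha,2-\alpha)$. Let $\mathcal C$ be a bounded positive linear operator on $L^2_\#(\mathbb T)$ for which there are real numbers $(\sigma_k)_{k\in\mathbf Z^2_\star}$ and constants $c_1,c_2>0$ such that $$\mathcal C x=\sum_{k\in\mathbf Z^2_\star}\sigma_k^2x_ke_k\quad\text{for } x=\sum_kx_ke_k,\qquad \frac{c_1}{|k|^\delta}\le|\sigma_k|\le\frac{c_2}{|k|^\delta}\quad\text{for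 all }k\in\mathbf Z^2_\star .$$ Let $W$ be a cylindrical Wiener process on $L^2_\#(\mathbb T)$ defined on a probability space $(\Omega,\mathcal F,\mathbb P)$, and let $z$ be a (weak) solution, with values in $L^2_\#(\mathbb T)$, of the linear equation $$dz+\nu A^\alpha z\,dt=\mathcal C^{1/2}\,dW,\qquad z(0)=0 .$$ Then for every $t>0$ the field $z_t$ has almost surely a (unique) continuous version on $\mathbb T$, again denoted by $z_t$. For $y\in\mathbf R$ let $\mathcal L_y(z_t)=\{x\in\mathbb T: z_t(x)=y\}$ be its $y$-level set, and let $\dim_H$ and $\dim_P$ denote the Hausdorff and the packing dimension. For every $t>0$ and every $y\in\mathbf R$, * $\mathbb P\bigl[\dim_P(\mathcal L_y(z_t))\le 3-\alpha-\delta\bigr]=1$; * $\mathbb P\bigl[\dim_P(\mathcal L_y(z_t))=\dim_H(\mathcal L_y(z_t))=3-\alpha-\delta\bigr]>0$. -/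

import Mathlib

open MeasureTheory ProbabilityTheory
open scoped ENNReal NNReal RealInnerProductSpace

/-! ### Packing measure and packing dimension -/

section Packing

variable {X : Type*} [MetricSpace X]

/-- A countable family `B` of pairs (centre, radius) is an `ε`-packing of `E` if the closed balls
it describes are pairwise disjoint, have centres in `E` and radii in `(0, ε]`. -/
structure IsBallPacking (E : Set X) (ε : ℝ) (B : Set (X × ℝ)) : Prop where
  countable : B.Countable
  center_mem : ∀ b ∈ B, b.1 ∈ E
  radius_pos : ∀ b ∈ B, 0 < b.2
  radius_le : ∀ b ∈ B, b.2 ≤ ε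
  disjoint : B.PairwiseDisjoint fun b => Metric.closedBall b.1 b.2

/-- `sup ∑ (2 rᵢ) ^ s` over all `ε`-packings of `E` by balls of radii `rᵢ`. -/
noncomputable def packingContent (s ε : ℝ) (E : Set X) : ℝ≥0∞ :=
  ⨆ (B : Set (X × ℝ)) (_ : IsBallPacking E ε B), ∑' b : B, ENNReal.ofReal (2 * b.1.2) ^ s

/-- The `s`-dimensional packing premeasure: the limit of `packingContent s ε E` as `ε ↓ 0`,
which is an infimum since the content is monotone in `ε`. -/
noncomputable def packingPremeasure (s : ℝ) (E : Set X) : ℝ≥0∞ :=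
  ⨅ (ε : ℝ) (_ : 0 < ε), packingContent s ε E

/-- The `s`-dimensional packing measure:
`inf {∑ᵢ packingPremeasure s (Fᵢ) : E ⊆ ⋃ᵢ Fᵢ}` over countable covers. -/
noncomputable def packingMeasure (s : ℝ) (E : Set X) : ℝ≥0∞ :=
  ⨅ (F : ℕ → Set X) (_ : E ⊆ ⋃ i, F i), ∑' i, packingPremeasure s (F i)

/-- The packing dimension `sup {s ≥ 0 : packingMeasure s E = ∞}` (compare `dimH`). -/
noncomputable def dimP (E : Set X) : ℝ≥0∞ :=
  ⨆ (s : ℝ≥0) (_ : packingMeasure (s : ℝ) E = ∞), (s : ℝ≥0∞)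

end Packing

/-! ### The torus, mean-zero fields, the Fourier basis -/

/-- The Euclidean plane. -/
abbrev Plane : Type := EuclideanSpace ℝ (Fin 2)

/-- The fundamental square `[-π, π]²` of the torus. -/
def torus : Set Plane := {x | ∀ i, x i ∈ Set.Icc (-Real.pi) Real.pi}

lemma torus_isFiniteMeasure : IsFiniteMeasure ((volume : Measure Plane).restrict torus) := by
  refine ⟨?_⟩
  rw [Measure.restrict_apply_univ]
  refine (Bornology.IsBounded.subset (Metric.isBounded_closedBall (x := (0 : Plane))
    (r := 2 * Real.pi)) ?_).measure_lt_top
  intro x hx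
  have h0 := hx 0
  have h1 := hx 1
  rw [mem_closedBall_zero_iff, EuclideanSpace.norm_eq]
  apply Real.sqrt_le_iff.2
  refine ⟨by positivity, ?_⟩
  simp only [Fin.sum_univ_two, Real.norm_eq_abs, sq_abs]
  have a0 : (x 0) ^ 2 ≤ Real.pi ^ 2 := sq_le_sq' h0.1 h0.2
  have a1 : (x 1) ^ 2 ≤ Real.pi ^ 2 := sq_le_sq' h1.1 h1.2
  nlinarith [sq_nonneg Real.pi]

instance : IsFiniteMeasure ((volume : Measure Plane).restrict torus) := torus_isFiniteMeasure

/-- The real Hilbert space `L²_#` of square integrable fields on the torus with zero mean. -/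
noncomputable def L2Mean0 : Submodule ℝ (Lp ℝ 2 ((volume : Measure Plane).restrict torus)) where
  carrier := {u | ∫ x in torus, u x = 0}
  zero_mem' := by
    show ∫ x in torus, (0 : Lp ℝ 2 ((volume : Measure Plane).restrict torus)) x = 0
    rw [integral_congr_ae (Lp.coeFn_zero _ _ _)]
    simp
  add_mem' := by
    intro u v hu hv
    have hu' : ∫ x in torus, u x = 0 := hu
    have hv' : ∫ x in torus, v x = 0 := hv
    show ∫ x in torus, (u + v) x = 0
    rw [integral_congr_ae (Lp.coeFn_add u v)]
    simp only [Pi.add_apply]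
    rw [integral_add ((Lp.memLp u).integrable (by norm_num))
      ((Lp.memLp v).integrable (by norm_num)), hu', hv', add_zero]
  smul_mem' := by
    intro c u hu
    have hu' : ∫ x in torus, u x = 0 := hu
    show ∫ x in torus, (c • u) x = 0
    rw [integral_congr_ae (Lp.coeFn_smul c u)]
    simp only [Pi.smul_apply, smul_eq_mul]
    rw [integral_const_mul, hu', mul_zero]

/-- The Euclidean length `|k|` of a frequency `k ∈ ℤ²`. -/
noncomputable def freqNorm (k : ℤ × ℤ) : ℝ := Real.sqrt ((k.1 : ℝ) ^ 2 + (k.2 : ℝ) ^ 2)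

/-- The real orthonormal basis `e_k`, `k ∈ ℤ² \ {0}`, of `L²_#`: `√2 / (2π) * sin (k · x)` if
`k₂ > 0` or (`k₂ = 0` and `k₁ > 0`), and `√2 / (2π) * cos (k · x)` otherwise. -/
noncomputable def fourierMode (k : ℤ × ℤ) (x : Plane) : ℝ :=
  if 0 < k.2 ∨ (k.2 = 0 ∧ 0 < k.1) then
    Real.sqrt 2 / (2 * Real.pi) * Real.sin (k.1 * x 0 + k.2 * x 1)
  else
    Real.sqrt 2 / (2 * Real.pi) * Real.cos (k.1 * x 0 + k.2 * x 1)

/-- The coefficient `u_k = ⟨u, e_k⟩` in `L²`. -/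
noncomputable def fourierCoeffReal (u : L2Mean0) (k : ℤ × ℤ) : ℝ :=
  ∫ x in torus, (u : Lp ℝ 2 ((volume : Measure Plane).restrict torus)) x * fourierMode k x

/-- The graph of the fractional Laplacian `A ^ α`, `A = -Δ` on `L²_#`: `φ` is in the domain and
`ψ = A ^ α φ = ∑ |k| ^ (2 α) φ_k e_k` (an element of `L²_#` is determined by its coefficients). -/
def IsFracLaplacian (α : ℝ) (φ ψ : L2Mean0) : Prop :=
  ∀ k : ℤ × ℤ, k ≠ 0 → fourierCoeffReal ψ k = freqNorm k ^ (2 * α) * fourierCoeffReal φ k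

/-! ### The noise -/

/-- The assumption on the covariance operator of the noise: it is bounded, positive, diagonal in
the basis `e_k` with eigenvalues `σ_k ^ 2`, and `c₁ |k| ^ (-δ) ≤ |σ_k| ≤ c₂ |k| ^ (-δ)` with
`1 - α < δ < 2 - α`. -/
structure NoiseAssumption (α δ : ℝ) (C : L2Mean0 →L[ℝ] L2Mean0) : Prop where
  positive : C.IsPositive
  lt_delta : 1 - α < δ
  delta_lt : δ < 2 - α
  diagonal : ∃ (σ : ℤ × ℤ → ℝ) (c₁ c₂ : ℝ), 0 < c₁ ∧ 0 < c₂ ∧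
    (∀ (u : L2Mean0) (k : ℤ × ℤ), k ≠ 0 →
      fourierCoeffReal (C u) k = σ k ^ 2 * fourierCoeffReal u k) ∧
    ∀ k : ℤ × ℤ, k ≠ 0 →
      c₁ / freqNorm k ^ δ ≤ |σ k| ∧ |σ k| ≤ c₂ / freqNorm k ^ δ

/-- `S = C ^ (1/2)` is the (unique) positive square root of the bounded operator `C`. -/
structure IsPositiveSqrt (S C : L2Mean0 →L[ℝ] L2Mean0) : Prop where
  positive : S.IsPositive
  sq_eq : S ∘L S = C

/-- A cylindrical Wiener process on a real Hilbert space `H`, given by its action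
`W t φ = ⟨W_t, φ⟩` on vectors: the family is jointly Gaussian and centred, with
`E[⟨W_s, φ⟩ ⟨W_t, ψ⟩] = min s t * ⟨φ, ψ⟩`, and each `t ↦ ⟨W_t, φ⟩` has almost surely continuous
paths. -/
structure IsCylindricalWiener {Ω H : Type*} [MeasurableSpace Ω] [NormedAddCommGroup H]
    [InnerProductSpace ℝ H] (W : ℝ≥0 → H → Ω → ℝ) (P : Measure Ω) : Prop where
  gaussian : IsGaussianProcess (fun p : ℝ≥0 × H => W p.1 p.2) P
  centred : ∀ t φ, ∫ ω, W t φ ω ∂P = 0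
  covariance : ∀ s t φ ψ, cov[W s φ, W t ψ; P] = (min s t : ℝ≥0) * ⟪φ, ψ⟫
  continuous_paths : ∀ φ, ∀ᵐ ω ∂P, Continuous fun t => W t φ ω

/-! ### The linear equation -/

/-- `z` is a weak solution of `dz + ν A^α z dt = S dW`, `z(0) = 0`: for each test vector `φ` in
the domain of `A ^ α`, almost surely for all `t ≥ 0`,
`⟨z_t, φ⟩ + ν ∫₀ᵗ ⟨z_s, A^α φ⟩ ds = ⟨W_t, S φ⟩` (where `S` is self-adjoint). -/
structure IsLinearSolution {Ω : Type*} [MeasurableSpace Ω] (ν α : ℝ)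
    (S : L2Mean0 →L[ℝ] L2Mean0) (W : ℝ≥0 → L2Mean0 → Ω → ℝ) (P : Measure Ω)
    (z : ℝ≥0 → Ω → L2Mean0) : Prop where
  initial : ∀ᵐ ω ∂P, z 0 ω = 0
  weak : ∀ φ ψ : L2Mean0, IsFracLaplacian α φ ψ → ∀ᵐ ω ∂P, ∀ t : ℝ≥0,
    IntervalIntegrable (fun s : ℝ => ⟪z s.toNNReal ω, ψ⟫) volume 0 t ∧
    ⟪z t ω, φ⟫ + ν * ∫ s in (0 : ℝ)..t, ⟪z s.toNNReal ω, ψ⟫ = W t (S φ) ω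

/-- `v` is a continuous version, on the torus, of the class `u ∈ L²_#`: it is continuous,
`2π`-periodic in each variable, and represents `u`. (It is unique.) -/
structure IsContinuousVersion (u : L2Mean0) (v : Plane → ℝ) : Prop where
  continuous : Continuous v
  periodic : ∀ (x : Plane) (i : Fin 2), v (x + EuclideanSpace.single i (2 * Real.pi)) = v x
  ae_eq : v =ᵐ[(volume : Measure Plane).restrict torus]
    (u : Lp ℝ 2 ((volume : Measure Plane).restrict torus))

/-- The `y`-level set of a field on the torus. -/
def levelSet (y : ℝ) (v : Plane → ℝ) : Set Plane := {x | x ∈ torus ∧ v x = y}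

/-!
Write `H = α + δ - 1 ∈ (0, 1)`, so that the dimension in question is `2 - H`.

*Reduction to a Gaussian Fourier series.* Testing the equation against `e_k` gives a scalar
Ornstein–Uhlenbeck equation, whose solution at time `t` is an almost sure limit of weighted sums of
Wiener increments in the direction `S e_k` (variation of constants and summation by parts,
`tendsto_sum_decay_mul_sub`). The vectors `S e_k` are orthogonal, so the coefficients of `z_t` are
independent centred Gaussian variables with variances comparable to `|k| ^ (-(2 + 2 H))`
(`IsLinearSolution.exists_isGaussianFourier`). Nothing else about the equation is used; the
hypothesis `IsGaussianFourier` records this.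

*Regularity.* Gaussian tails on a fine grid, with control of the derivatives, bound the dyadic
frequency shells of the series uniformly by `2 ^ (-j β)` for each `β < H`
(`IsGaussianFourier.ae_exists_hasShellBound`). Hence the series `trigField` is almost surely
`β`-Hölder. Completeness of the basis `e_k` identifies it with the class `z_t`, and continuous
versions are unique.

*Upper bound.* A square of side `2 ^ (-n)` that meets the level set contains a lattice point where
the field is within `2 ^ (-n β)` of `y`. Since the field has bounded densities, the mean number of
such squares is `O(2 ^ (n (2 - β)))`, and a box-counting bound controls the packing dimension
(`dimP_le_of_cover`, `IsGaussianFourier.ae_dimP_levelSet_le`).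

*Lower bound.* The approximate local times `(2 η)⁻¹ 1 {|z_t - y| ≤ η} dx` on a small square have
means bounded below. Pairing the frequencies `k` and `-k` shows that the part of `z_t(x')`
independent of `z_t(x)` has variance at least a multiple of `|x - x'| ^ (2 H)`
(`IsGaussianFourier.exists_le_fieldVar`). So the two-point densities are `O(|x - x'| ^ (-H))`, and
the Riesz `γ`-energies have bounded means for `γ + H < 2`. By the Paley–Zygmund inequality, with
positive probability the masses stay bounded below and all the energies bounded above along a
subsequence. An energy argument that needs no limit measure (`le_dimH_of_rieszEnergy`) then gives
`2 - H ≤ dimH`. As `dimH ≤ dimP` always (`dimH_le_dimP`), both dimensions equal `2 - H` on this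
event.
-/

/-! ### Comparison of packing dimension with box counting and Hausdorff dimension -/

section PackingComparison

variable {X : Type*} [MetricSpace X]

lemma IsBallPacking.radius_lt_dist {E : Set X} {ε : ℝ} {B : Set (X × ℝ)}
    (hB : IsBallPacking E ε B) {b c : X × ℝ} (hb : b ∈ B) (hc : c ∈ B) (hbc : b ≠ c) :
    b.2 < dist c.1 b.1 := by
  have h := hB.disjoint hb hc hbc
  by_contra! hle
  exact Set.disjoint_left.1 h (Metric.mem_closedBall.2 hle)
    (Metric.mem_closedBall_self (hB.radius_pos c hc).le)

lemma packingPremeasure_empty (s : ℝ) : packingPremeasure s (∅ : Set X) = 0 := by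
  refine le_antisymm ?_ zero_le
  refine (iInf₂_le (1 : ℝ) one_pos).trans ?_
  refine iSup₂_le fun B hB => ?_
  have : B = ∅ := by
    ext b
    simp only [Set.mem_empty_iff_false, iff_false]
    exact fun hb => (hB.center_mem b hb).elim
  subst this
  simp

lemma packingMeasure_le_premeasure (s : ℝ) (E : Set X) :
    packingMeasure s E ≤ packingPremeasure s E := by
  refine (iInf₂_le (fun i : ℕ => if i = 0 then E else ∅) ?_).trans ?_
  · intro x hx
    exact Set.mem_iUnion.2 ⟨0, by simpa using hx⟩
  · rw [tsum_eq_single 0]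
    · simp
    · intro i hi
      simp [hi, packingPremeasure_empty]

/-- A set which, for every `n`, is covered by at most `K * 2 ^ (n * s)` sets of diameter at most
`2 ^ (-n)` has finite `u`-dimensional packing measure for `u > s`: a ball of a packing with radius
in `(2 ^ (-n-1), 2 ^ (-n)]` is the only one of its size class with centre in its covering set. -/
lemma packingMeasure_lt_top_of_cover {E : Set X} {s u K : ℝ} (hs : 0 ≤ s) (hu : s < u)
    (hcov : ∀ n : ℕ, ∃ T : Finset (Set X), (T.card : ℝ) ≤ K * 2 ^ (n * s) ∧
      E ⊆ ⋃ t ∈ T, t ∧ ∀ t ∈ T, ∀ x ∈ t, ∀ y ∈ t, dist x y ≤ (1 / 2) ^ n) :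
    packingMeasure u E < ∞ := by
  have hK : 0 ≤ K := by
    obtain ⟨T, hT, -⟩ := hcov 0
    simp at hT
    exact le_trans (by positivity) hT
  refine (packingMeasure_le_premeasure u E).trans_lt ?_
  refine (iInf₂_le (1 : ℝ) one_pos).trans_lt ?_
  have hupos : 0 < u := hs.trans_lt hu
  choose T hTcard hTE hTd using hcov
  -- the contribution of the balls with radius in `(2 ^ (-n-1), 2 ^ (-n)]`
  set c : ℕ → ℝ := fun n => (K * 2 ^ ((n + 1 : ℕ) * s)) * (2 * (1 / 2) ^ n) ^ u with hc
  have hcs : Summable c := by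
    have : c = fun n => (K * 2 ^ s * 2 ^ u) * ((2 : ℝ) ^ (s - u)) ^ n := by
      funext n
      simp only [hc]
      rw [Real.mul_rpow (by norm_num) (by positivity), ← Real.rpow_natCast (1 / 2) n,
        ← Real.rpow_mul (by norm_num), one_div, Real.inv_rpow (by norm_num),
        ← Real.rpow_neg (by norm_num), ← Real.rpow_natCast (2 ^ (s - u)) n,
        ← Real.rpow_mul (by norm_num)]
      have e1 : (2 : ℝ) ^ (((n + 1 : ℕ) : ℝ) * s) = 2 ^ s * 2 ^ ((n : ℝ) * s) := by
        rw [← Real.rpow_add (by norm_num)]; congr 1; push_cast; ring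
      have e2 : (2 : ℝ) ^ ((s - u) * n) = 2 ^ ((n : ℝ) * s) * 2 ^ (-(n * u)) := by
        rw [← Real.rpow_add (by norm_num)]; congr 1; ring
      rw [e1, e2]; ring
    rw [this]
    refine (summable_geometric_of_lt_one (by positivity) ?_).mul_left _
    exact Real.rpow_lt_one_of_one_lt_of_neg (by norm_num) (by linarith)
  have hc0 : ∀ n, 0 ≤ c n := fun n => by simp only [hc]; positivity
  refine lt_of_le_of_lt (b := ∑' n, ENNReal.ofReal (c n)) ?_ ?_
  · refine iSup₂_le fun B hB => ?_
    have hex : ∀ b : B, ∃ n : ℕ, (1 / 2 : ℝ) ^ (n + 1) < b.1.2 ∧ b.1.2 ≤ (1 / 2) ^ n := fun b =>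
      exists_nat_pow_near_of_lt_one (hB.radius_pos b b.2) (hB.radius_le b b.2) (by norm_num)
        (by norm_num)
    choose N hN1 hN2 using hex
    have hmem : ∀ b : B, ∃ t ∈ T (N b + 1), b.1.1 ∈ t := fun b => by
      simpa using hTE (N b + 1) (hB.center_mem b b.2)
    choose f hfT hf using hmem
    -- two balls of the same size class with centres in the same set of diameter at most `2 ^ (-N-1)`
    -- would overlap
    have hinj : Function.Injective
        (fun b : B => (⟨N b, ⟨f b, hfT b⟩⟩ : Σ n : ℕ, {t // t ∈ T (n + 1)})) := by
      intro b b' hbb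
      simp only [Sigma.mk.injEq] at hbb
      obtain ⟨hN, hff⟩ := hbb
      have hff' : f b = f b' := by
        have h2 : ∀ (m : ℕ) (hm : N b = m) (w : {t // t ∈ T (m + 1)}),
            HEq (⟨f b, hfT b⟩ : {t // t ∈ T (N b + 1)}) w → f b = w.1 := by
          rintro m rfl w hw
          exact congrArg Subtype.val (eq_of_heq hw)
        exact h2 (N b') hN ⟨f b', hfT b'⟩ hff
      by_contra hne
      have h1 := hB.radius_lt_dist b.2 b'.2 (fun h => hne (Subtype.ext h))
      have h2 := hTd (N b + 1) (f b) (hfT b) b'.1.1 (by rw [hff']; exact hf b') b.1.1 (hf b)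
      exact absurd (h1.trans_le h2) (not_lt.2 (hN1 b).le)
    calc ∑' b : B, ENNReal.ofReal (2 * b.1.2) ^ u
        ≤ ∑' b : B, (fun p : Σ n : ℕ, {t // t ∈ T (n + 1)} =>
            ENNReal.ofReal ((2 * (1 / 2) ^ p.1) ^ u)) ⟨N b, ⟨f b, hfT b⟩⟩ := by
          refine ENNReal.tsum_le_tsum fun b => ?_
          have := hB.radius_pos b b.2
          rw [ENNReal.ofReal_rpow_of_pos (by linarith)]
          refine ENNReal.ofReal_le_ofReal (Real.rpow_le_rpow (by linarith) ?_ hupos.le)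
          linarith [hN2 b]
      _ ≤ ∑' p : Σ n : ℕ, {t // t ∈ T (n + 1)}, ENNReal.ofReal ((2 * (1 / 2) ^ p.1) ^ u) :=
          ENNReal.tsum_comp_le_tsum_of_injective hinj _
      _ = ∑' n, ∑' _ : {t // t ∈ T (n + 1)}, ENNReal.ofReal ((2 * (1 / 2) ^ n) ^ u) :=
          ENNReal.tsum_sigma' _
      _ ≤ ∑' n, ENNReal.ofReal (c n) := by
          refine ENNReal.tsum_le_tsum fun n => ?_
          rw [tsum_fintype, Finset.sum_const, nsmul_eq_mul, Finset.card_univ, Fintype.card_coe]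
          have : ((T (n + 1)).card : ℝ≥0∞) = ENNReal.ofReal ((T (n + 1)).card : ℝ) := by simp
          rw [this, ← ENNReal.ofReal_mul (by positivity)]
          refine ENNReal.ofReal_le_ofReal ?_
          simp only [hc]
          exact mul_le_mul_of_nonneg_right (hTcard (n + 1)) (by positivity)
  · rw [← ENNReal.ofReal_tsum_of_nonneg hc0 hcs]
    exact ENNReal.ofReal_lt_top

/-- The packing dimension is at most the upper box-counting dimension. -/
lemma dimP_le_of_cover {E : Set X} {s : ℝ} (hs : 0 ≤ s)
    (hcov : ∀ u, s < u → ∃ K : ℝ, ∀ n : ℕ, ∃ T : Finset (Set X),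
      (T.card : ℝ) ≤ K * 2 ^ (n * u) ∧
      E ⊆ ⋃ t ∈ T, t ∧ ∀ t ∈ T, ∀ x ∈ t, ∀ y ∈ t, dist x y ≤ (1 / 2) ^ n) :
    dimP E ≤ ENNReal.ofReal s := by
  refine iSup₂_le fun u hu => ?_
  by_contra! hlt
  have hsu : s < u := by
    rwa [← ENNReal.ofReal_coe_nnreal, ENNReal.ofReal_lt_ofReal_iff_of_nonneg hs] at hlt
  obtain ⟨v, hsv, hvu⟩ := exists_between hsu
  obtain ⟨K, hK⟩ := hcov v hsv
  exact (packingMeasure_lt_top_of_cover (hs.trans hsv.le) hvu hK).ne hu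

open MeasureTheory.Measure in
/-- A maximal packing by balls of radius `δ` becomes a cover when the radii are doubled. -/
lemma hausdorffMeasure_le_packingPremeasure [MeasurableSpace X] [BorelSpace X] {s : ℝ}
    (hs : 0 ≤ s) (F : Set X) : μH[s] F ≤ ENNReal.ofReal (2 ^ s) * packingPremeasure s F := by
  have key : ∀ ε : ℝ, 0 < ε → μH[s] F ≤ ENNReal.ofReal (2 ^ s) * packingContent s ε F := by
    intro ε hε
    -- radii `ρ n → 0`, all at most `ε`
    set ρ : ℕ → ℝ≥0 := fun n => ⟨ε, hε.le⟩ * (1 / 2) ^ n with hρ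
    have hρpos : ∀ n, 0 < ρ n := fun n => by
      simp only [hρ]
      exact mul_pos (by exact_mod_cast hε) (by positivity)
    have hρle : ∀ n, (ρ n : ℝ) ≤ ε := fun n => by
      change ε * ((1 / 2 : ℝ≥0) ^ n : ℝ≥0) ≤ ε
      refine mul_le_of_le_one_right hε.le ?_
      have h : (1 / 2 : ℝ≥0) ^ n ≤ 1 := pow_le_one₀ (by positivity) (half_le_self zero_le)
      exact_mod_cast h
    -- a `2 ρ`-separated set is the set of centres of a packing by balls of radius `ρ`
    have hpack : ∀ n, ∀ S : Set X, S ⊆ F → Metric.IsSeparated (2 * ρ n : ℝ≥0) S →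
        ∀ A : Finset X, (A : Set X) ⊆ S →
          (A.card : ℝ≥0∞) * ENNReal.ofReal (2 * ρ n) ^ s ≤ packingContent s ε F := by
      intro n S hSF hS A hA
      have hinj : Function.Injective (fun x : X => ((x, (ρ n : ℝ)) : X × ℝ)) :=
        fun x y h => (Prod.mk.inj h).1
      refine le_trans ?_ (le_iSup₂_of_le (((fun x : X => (x, (ρ n : ℝ))) '' (A : Set X))) ?_ le_rfl)
      · rw [tsum_image (fun b : X × ℝ => ENNReal.ofReal (2 * b.2) ^ s) hinj.injOn]
        rw [tsum_fintype]
        simp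
      · refine ⟨A.countable_toSet.image _, ?_, ?_, ?_, ?_⟩
        · rintro _ ⟨x, hx, rfl⟩
          exact hSF (hA hx)
        · rintro _ ⟨x, hx, rfl⟩
          exact hρpos n
        · rintro _ ⟨x, hx, rfl⟩
          exact hρle n
        · rintro _ ⟨x, hx, rfl⟩ _ ⟨y, hy, rfl⟩ hne
          have hxy : x ≠ y := fun h => hne (by rw [h])
          have h := hS (hA hx) (hA hy) hxy
          change ((2 * ρ n : ℝ≥0) : ℝ≥0∞) < edist x y at h
          rw [edist_nndist] at h
          have h' : 2 * (ρ n : ℝ) < dist x y := by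
            have := ENNReal.coe_lt_coe.1 h
            exact_mod_cast this
          exact Metric.closedBall_disjoint_closedBall (by simp only; linarith)
    by_cases hinf : packingContent s ε F = ∞
    · rw [hinf, ENNReal.mul_top]
      · exact le_top
      · simp only [ne_eq, ENNReal.ofReal_eq_zero, not_le]; positivity
    have hmax : ∀ n, ∃ A : Finset X, (A : Set X) ⊆ F ∧
        Metric.IsSeparated (2 * ρ n : ℝ≥0) (A : Set X) ∧
        Metric.IsCover (2 * ρ n) F (A : Set X) := by
      intro n
      obtain ⟨S, -, hS⟩ := zorn_subset_nonempty
        {S : Set X | S ⊆ F ∧ Metric.IsSeparated (2 * ρ n : ℝ≥0) S} (by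
          intro c hc hchain _
          refine ⟨⋃₀ c, ⟨Set.sUnion_subset fun S hS => (hc hS).1, ?_⟩,
            fun S hS => Set.subset_sUnion_of_mem hS⟩
          exact (Set.pairwise_sUnion hchain.directedOn).2 fun S hS => (hc hS).2)
        ∅ ⟨Set.empty_subset _, Metric.IsSeparated.empty⟩
      -- an infinite separated set would make the packing content infinite
      have hfin : S.Finite := by
        by_contra hSinf
        have hSinf : S.Infinite := hSinf
        apply hinf
        by_contra hne
        have hc0 : ENNReal.ofReal (2 * ρ n) ^ s ≠ 0 := by
          refine (ENNReal.rpow_pos ?_ ENNReal.ofReal_ne_top).ne'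
          have := hρpos n
          simpa using this
        obtain ⟨m, hm⟩ := ENNReal.exists_nat_mul_gt hc0 hne
        obtain ⟨A, hAS, hAm⟩ := hSinf.exists_subset_card_eq m
        have := hpack n S hS.1.1 hS.1.2 A hAS
        rw [hAm] at this
        exact absurd this (not_le.2 hm)
      refine ⟨hfin.toFinset, by simpa using hS.1.1, by simpa using hS.1.2, ?_⟩
      simpa using Metric.IsCover.of_maximal_isSeparated hS
    choose A hAF hAsep hAcov using hmax
    have hlim : Filter.Tendsto (fun n => ((4 * ρ n : ℝ≥0) : ℝ≥0∞)) Filter.atTop (nhds 0) := by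
      rw [← ENNReal.coe_zero, ENNReal.tendsto_coe]
      have h1 : Filter.Tendsto (fun n : ℕ => ((1 / 2 : ℝ≥0)) ^ n) Filter.atTop (nhds 0) :=
        NNReal.tendsto_pow_atTop_nhds_zero_of_lt_one (NNReal.half_lt_self one_ne_zero)
      have h2 := (h1.const_mul (show ℝ≥0 from ⟨ε, hε.le⟩)).const_mul 4
      rw [mul_zero, mul_zero] at h2
      exact h2
    have hdiam : ∀ n, ∀ x : X, Metric.ediam (Metric.closedEBall x (2 * ρ n : ℝ≥0)) ≤
        (4 * ρ n : ℝ≥0) := by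
      intro n x
      refine Metric.ediam_closedEBall_le.trans (le_of_eq ?_)
      push_cast
      rw [← mul_assoc]; norm_num
    refine (hausdorffMeasure_le_liminf_sum (ι := fun n => A n) s F
      (fun n => ((4 * ρ n : ℝ≥0) : ℝ≥0∞)) hlim
      (fun n x => Metric.closedEBall x.1 (2 * ρ n : ℝ≥0))
      (Filter.Eventually.of_forall fun n x => hdiam n x.1)
      (Filter.Eventually.of_forall fun n => ?_)).trans ?_
    · have := Metric.isCover_iff_subset_iUnion_closedEBall.1 (hAcov n)
      simpa [Set.iUnion_subtype] using this
    · refine (Filter.liminf_le_of_frequently_le' (Filter.Frequently.of_forall fun n => ?_))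
      calc ∑ x : A n, Metric.ediam (Metric.closedEBall x.1 (2 * ρ n : ℝ≥0)) ^ s
          ≤ ∑ x : A n, ((4 * ρ n : ℝ≥0) : ℝ≥0∞) ^ s :=
            Finset.sum_le_sum fun x _ => ENNReal.rpow_le_rpow (hdiam n x.1) hs
        _ = ENNReal.ofReal (2 ^ s) * ((A n).card * ENNReal.ofReal (2 * ρ n) ^ s) := by
            rw [Finset.sum_const, Finset.card_univ, Fintype.card_coe, nsmul_eq_mul,
              ← ENNReal.ofReal_rpow_of_pos (by norm_num), mul_left_comm,
              ← ENNReal.mul_rpow_of_nonneg _ _ hs, ← ENNReal.ofReal_mul (by norm_num),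
              ← ENNReal.ofReal_coe_nnreal]
            congr 3
            push_cast; ring
        _ ≤ _ := by
            gcongr
            exact hpack n _ (hAF n) (hAsep n) (A n) le_rfl
  unfold packingPremeasure
  have h0 : ENNReal.ofReal (2 ^ s) ≠ 0 := by
    simp only [ne_eq, ENNReal.ofReal_eq_zero, not_le]; positivity
  rw [ENNReal.mul_iInf_of_ne h0 ENNReal.ofReal_ne_top]
  refine le_iInf fun ε => ?_
  rw [ENNReal.mul_iInf_of_ne h0 ENNReal.ofReal_ne_top]
  exact le_iInf fun hε => key ε hε

open MeasureTheory.Measure in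
lemma hausdorffMeasure_le_packingMeasure [MeasurableSpace X] [BorelSpace X] {s : ℝ}
    (hs : 0 ≤ s) (E : Set X) : μH[s] E ≤ ENNReal.ofReal (2 ^ s) * packingMeasure s E := by
  have h0 : ENNReal.ofReal (2 ^ s) ≠ 0 := by
    simp only [ne_eq, ENNReal.ofReal_eq_zero, not_le]; positivity
  unfold packingMeasure
  rw [ENNReal.mul_iInf_of_ne h0 ENNReal.ofReal_ne_top]
  refine le_iInf fun F => ?_
  rw [ENNReal.mul_iInf_of_ne h0 ENNReal.ofReal_ne_top]
  refine le_iInf fun hF => ?_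
  rw [← ENNReal.tsum_mul_left]
  exact (measure_mono hF).trans ((measure_iUnion_le _).trans
    (ENNReal.tsum_le_tsum fun i => hausdorffMeasure_le_packingPremeasure hs _))

lemma dimH_le_dimP (E : Set X) : dimH E ≤ dimP E := by
  borelize X
  rw [dimH_def]
  refine iSup₂_le fun s hs => ?_
  refine le_iSup₂_of_le s ?_ le_rfl
  have h := hausdorffMeasure_le_packingMeasure s.2 E
  change Measure.hausdorffMeasure (s : ℝ) E ≤ _ at h
  rw [hs, top_le_iff, ENNReal.mul_eq_top] at h
  exact (by simpa using h : _ ∧ packingMeasure (s : ℝ) E = ∞).2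

end PackingComparison

/-! ### A lower bound for the Hausdorff dimension from measures of finite energy -/

section Energy

variable {X : Type*} [MetricSpace X] [MeasurableSpace X] [BorelSpace X]

/-- The `γ`-energy `∬ d(x, y) ^ (-γ) ν(dx) ν(dy)` of a measure. -/
noncomputable def rieszEnergy (γ : ℝ) (ν : Measure X) : ℝ≥0∞ :=
  ∫⁻ x, ∫⁻ y, edist x y ^ (-γ) ∂ν ∂ν

/-- On the set where the potential of `ν` is at most `M`, the measure `ν` is Frostman. -/
lemma measure_le_of_potential_le {γ : ℝ} (hγ : 0 < γ) {ν : Measure X} {M r : ℝ≥0∞}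
    (hM : M ≠ ∞) {x : X} (hx : ∫⁻ y, edist x y ^ (-γ) ∂ν ≤ M) {s : Set X}
    (hs : ∀ y ∈ s, edist x y ≤ r) (hr : r ≠ ∞) : ν s ≤ r ^ γ * M := by
  have h1 : r ^ (-γ) * ν s ≤ M := by
    refine le_trans ?_ hx
    have hsub : s ⊆ {y | r ^ (-γ) ≤ edist x y ^ (-γ)} := by
      intro y hy
      simp only [Set.mem_ofPred_eq, ENNReal.rpow_neg]
      exact ENNReal.inv_le_inv.2 (ENNReal.rpow_le_rpow (hs y hy) hγ.le)
    refine (mul_le_mul_right (measure_mono hsub) _).trans ?_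
    exact mul_meas_ge_le_lintegral (by fun_prop) _
  rcases eq_or_ne r 0 with rfl | hr0
  · rw [ENNReal.zero_rpow_of_neg (by linarith)] at h1
    have : ν s = 0 := by
      by_contra h
      rw [ENNReal.top_mul h] at h1
      exact hM (top_le_iff.1 h1)
    simp [this]
  · have hrpos : r ^ γ ≠ 0 := (ENNReal.rpow_pos (pos_iff_ne_zero.2 hr0) hr).ne'
    have hrtop : r ^ γ ≠ ∞ := ENNReal.rpow_ne_top_of_nonneg hγ.le hr
    calc ν s = r ^ γ * (r ^ (-γ) * ν s) := by
          rw [ENNReal.rpow_neg, ← mul_assoc, ENNReal.mul_inv_cancel hrpos hrtop, one_mul]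
      _ ≤ _ := by gcongr

/-- Measures of mass at least `c` and of uniformly bounded `γ`-energy which eventually live in every
neighbourhood of a set force the set to have dimension at least `γ`. -/
lemma le_dimH_of_rieszEnergy [SecondCountableTopology X] {L : Set X} {γ : ℝ≥0} (hγ : 0 < γ)
    (ν : ℕ → Measure X) [∀ n, SFinite (ν n)] {c A : ℝ≥0∞} (hc : c ≠ 0) (hc' : c ≠ ∞) (hA : A ≠ ∞)
    (hν : ∀ U : Set X, IsOpen U → L ⊆ U → ∀ᶠ n in Filter.atTop, ν n Uᶜ = 0)
    (hfreq : ∃ᶠ n in Filter.atTop, c ≤ ν n Set.univ ∧ rieszEnergy γ (ν n) ≤ A) :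
    (γ : ℝ≥0∞) ≤ dimH L := by
  have hγ' : (0 : ℝ) < γ := by exact_mod_cast hγ
  -- enlarge `A` so that it is positive
  wlog hA0 : A ≠ 0 generalizing A
  · refine this (A := 1) (by simp) (hfreq.mono fun n hn => ⟨hn.1, hn.2.trans ?_⟩) (by simp)
    push Not at hA0
    simp [hA0]
  set M : ℝ≥0∞ := 2 * A / c with hMdef
  have hM : M ≠ ∞ := ENNReal.div_ne_top (ENNReal.mul_ne_top (by simp) hA) hc
  have hM0 : M ≠ 0 := by
    simp [hMdef, ENNReal.div_eq_zero_iff, hA0, hc']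
  have key : c / 2 / M ≤ Measure.hausdorffMeasure (γ : ℝ) L := by
    rw [Measure.hausdorffMeasure_apply]
    refine le_iSup₂_of_le 1 one_pos ?_
    refine le_iInf₂ fun t ht => le_iInf fun htd => ?_
    refine ENNReal.le_of_forall_pos_le_add fun ε hε _ => ?_
    obtain ⟨ε', hε', hsum⟩ := ENNReal.exists_pos_sum_of_countable
      (ENNReal.coe_ne_zero.2 hε.ne') ℕ
    -- enlarge each covering set to an open ball
    have hex : ∀ n, ∃ U : Set X, IsOpen U ∧ t n ⊆ U ∧ ∃ r : ℝ≥0∞, r ≠ ∞ ∧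
        (∀ x ∈ U, ∀ y ∈ U, edist x y ≤ r) ∧
        r ^ (γ : ℝ) ≤ (⨆ _ : (t n).Nonempty, Metric.ediam (t n) ^ (γ : ℝ)) + ε' n := by
      intro n
      rcases (t n).eq_empty_or_nonempty with he | hne
      · exact ⟨∅, isOpen_empty, by simp [he], 0, by simp, by simp, by simp [hγ]⟩
      · have hd : Metric.ediam (t n) ≠ ∞ := ((htd n).trans_lt ENNReal.one_lt_top).ne
        have hcont : Filter.Tendsto
            (fun δ : ℝ≥0 => (Metric.ediam (t n) + 2 * (δ : ℝ≥0∞)) ^ (γ : ℝ))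
            (nhdsWithin 0 (Set.Ioi 0)) (nhds (Metric.ediam (t n) ^ (γ : ℝ))) := by
          have : Continuous fun δ : ℝ≥0 => (Metric.ediam (t n) + 2 * (δ : ℝ≥0∞)) ^ (γ : ℝ) :=
            ENNReal.continuous_rpow_const.comp (continuous_const.add
              ((ENNReal.continuous_const_mul (by simp)).comp ENNReal.continuous_coe))
          have h := this.tendsto 0
          simp only [ENNReal.coe_zero, mul_zero, add_zero] at h
          exact h.mono_left nhdsWithin_le_nhds
        have hlt : Metric.ediam (t n) ^ (γ : ℝ) < Metric.ediam (t n) ^ (γ : ℝ) + ε' n :=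
          ENNReal.lt_add_right (ENNReal.rpow_ne_top_of_nonneg hγ'.le hd)
            (ENNReal.coe_ne_zero.2 (hε' n).ne')
        obtain ⟨δ, hδ1, hδ2⟩ := ((hcont.eventually_lt_const hlt).and self_mem_nhdsWithin).exists
        have hδ0 : (0 : ℝ) < δ := by exact_mod_cast hδ2
        refine ⟨Metric.thickening δ (t n), Metric.isOpen_thickening,
          Metric.self_subset_thickening hδ0 _, Metric.ediam (t n) + 2 * (δ : ℝ≥0∞), ?_, ?_, ?_⟩
        · exact ENNReal.add_ne_top.2 ⟨hd, ENNReal.mul_ne_top (by simp) (by simp)⟩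
        · intro x hx y hy
          exact (Metric.edist_le_ediam_of_mem hx hy).trans (Metric.ediam_thickening_le δ)
        · simpa [hne] using hδ1.le
    choose U hUo htU r hr hUr hrle using hex
    have hLU : L ⊆ ⋃ n, U n := ht.trans (Set.iUnion_mono htU)
    obtain ⟨n, ⟨hmass, hen⟩, hzero⟩ :=
      (hfreq.and_eventually (hν _ (isOpen_iUnion hUo) hLU)).exists
    -- by Markov's inequality the potential is at most `M` off a set of mass at most `c / 2`
    set G : Set X := {x | ∫⁻ y, edist x y ^ (-(γ : ℝ)) ∂ν n ≤ M} with hG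
    have hmeas : Measurable fun x => ∫⁻ y, edist x y ^ (-(γ : ℝ)) ∂ν n := by
      refine Measurable.lintegral_prod_right' (f := fun p : X × X => edist p.1 p.2 ^ (-(γ : ℝ))) ?_
      fun_prop
    have hGc : ν n Gᶜ ≤ c / 2 := by
      have h1 : M * ν n Gᶜ ≤ A := by
        refine le_trans ?_ hen
        refine (mul_le_mul_right (measure_mono (fun x hx => ?_)) _).trans
          (mul_meas_ge_le_lintegral hmeas M)
        simp only [hG, Set.mem_compl_iff, Set.mem_ofPred_eq, not_le] at hx
        exact hx.le
      have h2 : ν n Gᶜ ≤ A / M := by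
        rw [ENNReal.le_div_iff_mul_le (Or.inl hM0) (Or.inl hM), mul_comm]; exact h1
      refine h2.trans (le_of_eq ?_)
      rw [hMdef, ENNReal.div_eq_inv_mul, ENNReal.inv_div (Or.inl hc') (Or.inl hc),
        ENNReal.div_eq_inv_mul, ENNReal.mul_inv (Or.inl (by simp)) (Or.inl (by simp)),
        ENNReal.div_eq_inv_mul]
      calc 2⁻¹ * A⁻¹ * c * A = 2⁻¹ * c * (A⁻¹ * A) := by ring
        _ = 2⁻¹ * c := by rw [ENNReal.inv_mul_cancel hA0 hA, mul_one]
    have hGm : c / 2 ≤ ν n G := by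
      have h1 : c ≤ ν n G + c / 2 := by
        calc c ≤ ν n Set.univ := hmass
          _ = ν n (G ∪ Gᶜ) := by rw [Set.union_compl_self]
          _ ≤ ν n G + ν n Gᶜ := measure_union_le _ _
          _ ≤ _ := by gcongr
      rw [← ENNReal.sub_half hc']
      exact tsub_le_iff_right.2 h1
    have hball : ∀ m, ν n (G ∩ U m) ≤ r m ^ (γ : ℝ) * M := by
      intro m
      rcases (G ∩ U m).eq_empty_or_nonempty with he | ⟨x, hxG, hxU⟩
      · simp [he]
      · exact measure_le_of_potential_le hγ' hM hxG (fun y hy => hUr m x hxU y hy.2) (hr m)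
    rw [ENNReal.div_le_iff_le_mul (Or.inl hM0) (Or.inl hM)]
    calc c / 2 ≤ ν n G := hGm
      _ ≤ ν n ((⋃ m, U m)ᶜ ∪ ⋃ m, G ∩ U m) := by
          refine measure_mono fun x hx => ?_
          by_cases h : x ∈ ⋃ m, U m
          · obtain ⟨m, hm⟩ := Set.mem_iUnion.1 h
            exact Or.inr (Set.mem_iUnion.2 ⟨m, hx, hm⟩)
          · exact Or.inl h
      _ ≤ ν n (⋃ m, U m)ᶜ + ν n (⋃ m, G ∩ U m) := measure_union_le _ _
      _ ≤ 0 + ∑' m, r m ^ (γ : ℝ) * M := by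
          rw [hzero]
          gcongr
          exact (measure_iUnion_le _).trans (ENNReal.tsum_le_tsum hball)
      _ = (∑' m, r m ^ (γ : ℝ)) * M := by rw [zero_add, ENNReal.tsum_mul_right]
      _ ≤ _ := by
          gcongr
          refine (ENNReal.tsum_le_tsum hrle).trans ?_
          rw [ENNReal.tsum_add]
          gcongr
  refine le_dimH_of_hausdorffMeasure_ne_zero (ne_of_gt (lt_of_lt_of_le ?_ key))
  refine ENNReal.div_pos ?_ hM
  simpa using hc

end Energy

/-! ### The trigonometric system on the torus -/

/-- The phase of `e_k` written as `√2 / (2π) * cos (k · x + phase)`. -/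
noncomputable def modePhase (k : ℤ × ℤ) : ℝ :=
  if 0 < k.2 ∨ (k.2 = 0 ∧ 0 < k.1) then -(Real.pi / 2) else 0

/-- The pairing `k · x`. -/
def freqDot (k : ℤ × ℤ) (x : Plane) : ℝ := k.1 * x 0 + k.2 * x 1

lemma fourierMode_eq_cos (k : ℤ × ℤ) (x : Plane) :
    fourierMode k x = Real.sqrt 2 / (2 * Real.pi) * Real.cos (freqDot k x + modePhase k) := by
  unfold fourierMode modePhase freqDot
  split_ifs
  · rw [← sub_eq_add_neg, Real.cos_sub_pi_div_two]
  · rw [add_zero]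

lemma continuous_freqDot (k : ℤ × ℤ) : Continuous (freqDot k) := by
  unfold freqDot; fun_prop

lemma continuous_fourierMode (k : ℤ × ℤ) : Continuous (fourierMode k) := by
  have : fourierMode k = fun x =>
      Real.sqrt 2 / (2 * Real.pi) * Real.cos (freqDot k x + modePhase k) :=
    funext (fourierMode_eq_cos k)
  rw [this]
  have := continuous_freqDot k
  fun_prop

lemma isCompact_torus : IsCompact torus := by
  have h : torus = (EuclideanSpace.equiv (Fin 2) ℝ).symm ''
      (Set.univ.pi fun _ => Set.Icc (-Real.pi) Real.pi) := by
    ext x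
    constructor
    · intro hx
      exact ⟨x.ofLp, fun i _ => hx i, rfl⟩
    · rintro ⟨y, hy, rfl⟩ i
      exact hy i trivial
  rw [h]
  exact (isCompact_univ_pi fun _ => isCompact_Icc).image (ContinuousLinearEquiv.continuous _)

lemma volume_torus_restrict_map :
    ((volume : Measure Plane).restrict torus).map (fun x => x.ofLp) =
      Measure.pi fun _ : Fin 2 => (volume : Measure ℝ).restrict (Set.Icc (-Real.pi) Real.pi) := by
  rw [← Measure.restrict_pi_pi]
  have h := (PiLp.volume_preserving_ofLp (Fin 2)).restrict_preimage_emb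
    (MeasurableEquiv.toLp 2 (Fin 2 → ℝ)).symm.measurableEmbedding
    (Set.univ.pi fun _ => Set.Icc (-Real.pi) Real.pi)
  have h2 : (fun x : Plane => x.ofLp) ⁻¹' (Set.univ.pi fun _ => Set.Icc (-Real.pi) Real.pi)
      = torus := by
    ext x
    simp only [Set.mem_preimage, Set.mem_univ_pi, torus]
    rfl
  rw [← h2]
  exact h.map_eq

lemma integral_torus_mul (f g : ℝ → ℝ) :
    ∫ x in torus, f (x 0) * g (x 1) =
      (∫ t in (-Real.pi)..Real.pi, f t) * ∫ t in (-Real.pi)..Real.pi, g t := by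
  have hpi : -Real.pi ≤ Real.pi := by linarith [Real.pi_pos]
  have h1 : ∫ x in torus, f (x 0) * g (x 1) =
      ∫ y, f (y 0) * g (y 1) ∂(((volume : Measure Plane).restrict torus).map (fun x => x.ofLp)) := by
    exact ((MeasurableEquiv.toLp 2 (Fin 2 → ℝ)).symm.measurableEmbedding.integral_map
      (fun y => f (y 0) * g (y 1))).symm
  rw [h1, volume_torus_restrict_map]
  have h2 := integral_fintype_prod_eq_prod (𝕜 := ℝ) (ι := Fin 2) (E := fun _ => ℝ)
    (μ := fun _ => (volume : Measure ℝ).restrict (Set.Icc (-Real.pi) Real.pi)) ![f, g]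
  simp only [Fin.prod_univ_two] at h2
  rw [intervalIntegral.integral_of_le hpi, intervalIntegral.integral_of_le hpi,
    ← integral_Icc_eq_integral_Ioc, ← integral_Icc_eq_integral_Ioc]
  exact h2

lemma integral_cos_int (n : ℤ) :
    ∫ t in (-Real.pi)..Real.pi, Real.cos (n * t) = if n = 0 then 2 * Real.pi else 0 := by
  split_ifs with h
  · simp [h]; ring
  · have h' : (n : ℝ) ≠ 0 := by exact_mod_cast h
    rw [intervalIntegral.integral_comp_mul_left (fun t => Real.cos t) h', integral_cos]
    simp [Real.sin_int_mul_pi]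

lemma integral_sin_int (n : ℤ) : ∫ t in (-Real.pi)..Real.pi, Real.sin (n * t) = 0 := by
  rcases eq_or_ne n 0 with h | h
  · simp [h]
  · have h' : (n : ℝ) ≠ 0 := by exact_mod_cast h
    rw [intervalIntegral.integral_comp_mul_left (fun t => Real.sin t) h', integral_sin]
    simp

lemma Continuous.integrable_torus {f : Plane → ℝ} (hf : Continuous f) :
    Integrable f ((volume : Measure Plane).restrict torus) :=
  hf.continuousOn.integrableOn_compact isCompact_torus

lemma integral_torus_cos (m : ℤ × ℤ) (θ : ℝ) :
    ∫ x in torus, Real.cos (freqDot m x + θ) =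
      if m = 0 then 4 * Real.pi ^ 2 * Real.cos θ else 0 := by
  have e : ∀ x : Plane, Real.cos (freqDot m x + θ) =
      Real.cos θ * (Real.cos (m.1 * x 0) * Real.cos (m.2 * x 1))
      - Real.cos θ * (Real.sin (m.1 * x 0) * Real.sin (m.2 * x 1))
      - (Real.sin θ * (Real.sin (m.1 * x 0) * Real.cos (m.2 * x 1))
      + Real.sin θ * (Real.cos (m.1 * x 0) * Real.sin (m.2 * x 1))) := by
    intro x
    unfold freqDot
    rw [Real.cos_add, Real.cos_add, Real.sin_add]; ring
  simp_rw [e]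
  rw [integral_sub, integral_sub, integral_add]
  · simp_rw [integral_const_mul]
    rw [integral_torus_mul (fun t => Real.cos (m.1 * t)) (fun t => Real.cos (m.2 * t)),
      integral_torus_mul (fun t => Real.sin (m.1 * t)) (fun t => Real.sin (m.2 * t)),
      integral_torus_mul (fun t => Real.sin (m.1 * t)) (fun t => Real.cos (m.2 * t)),
      integral_torus_mul (fun t => Real.cos (m.1 * t)) (fun t => Real.sin (m.2 * t))]
    simp only [integral_sin_int, integral_cos_int, mul_zero, zero_mul, sub_zero, add_zero]
    by_cases h1 : m.1 = 0 <;> by_cases h2 : m.2 = 0 <;> simp [h1, h2, Prod.ext_iff]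
    ring
  all_goals exact Continuous.integrable_torus (by fun_prop)

lemma modePhase_add_neg {k : ℤ × ℤ} (hk : k ≠ 0) : modePhase k + modePhase (-k) = -(Real.pi / 2) := by
  have : ¬ (k.1 = 0 ∧ k.2 = 0) := fun h => hk (Prod.ext h.1 h.2)
  unfold modePhase
  simp only [Prod.fst_neg, Prod.snd_neg]
  split_ifs with h1 h2 h2
  · omega
  · ring
  · ring
  · omega

lemma integral_fourierMode_mul {k l : ℤ × ℤ} (hk : k ≠ 0) (hl : l ≠ 0) :
    ∫ x in torus, fourierMode k x * fourierMode l x = if k = l then 1 else 0 := by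
  have e : ∀ x, fourierMode k x * fourierMode l x =
      1 / (4 * Real.pi ^ 2) * Real.cos (freqDot (k - l) x + (modePhase k - modePhase l))
      + 1 / (4 * Real.pi ^ 2) * Real.cos (freqDot (k + l) x + (modePhase k + modePhase l)) := by
    intro x
    rw [fourierMode_eq_cos, fourierMode_eq_cos]
    have h1 : freqDot (k - l) x + (modePhase k - modePhase l) =
        (freqDot k x + modePhase k) - (freqDot l x + modePhase l) := by
      simp only [freqDot, Prod.fst_sub, Prod.snd_sub]; push_cast; ring
    have h2 : freqDot (k + l) x + (modePhase k + modePhase l) =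
        (freqDot k x + modePhase k) + (freqDot l x + modePhase l) := by
      simp only [freqDot, Prod.fst_add, Prod.snd_add]; push_cast; ring
    rw [h1, h2]
    generalize freqDot k x + modePhase k = a
    generalize freqDot l x + modePhase l = b
    rw [Real.cos_sub, Real.cos_add]
    have hs : Real.sqrt 2 * Real.sqrt 2 = 2 := Real.mul_self_sqrt (by norm_num)
    have hpi := Real.pi_ne_zero
    field_simp
    linear_combination Real.cos a * Real.cos b * 4 * hs
  simp_rw [e]
  have hc : ∀ m θ, Continuous fun x : Plane => Real.cos (freqDot m x + θ) := fun m θ => by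
    have := continuous_freqDot m
    fun_prop
  rw [integral_add ((hc _ _).integrable_torus.const_mul _) ((hc _ _).integrable_torus.const_mul _),
    integral_const_mul, integral_const_mul, integral_torus_cos, integral_torus_cos]
  have hpi := Real.pi_ne_zero
  by_cases hkl : k = l
  · subst hkl
    have : k + k ≠ 0 := fun h => hk (by
      have h1 := congrArg Prod.fst h
      have h2 := congrArg Prod.snd h
      simp only [Prod.fst_add, Prod.snd_add, Prod.fst_zero, Prod.snd_zero] at h1 h2
      exact Prod.ext (by simp; omega) (by simp; omega))
    simp [this]
    field_simp
  · rw [if_neg (sub_ne_zero.2 hkl), if_neg hkl]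
    by_cases hadd : k + l = 0
    · have : l = -k := by rw [← sub_eq_zero, sub_neg_eq_add, add_comm]; exact hadd
      subst this
      simp [modePhase_add_neg hk]
    · simp [hadd]

lemma integral_fourierMode {k : ℤ × ℤ} (hk : k ≠ 0) : ∫ x in torus, fourierMode k x = 0 := by
  simp_rw [fourierMode_eq_cos]
  rw [integral_const_mul, integral_torus_cos, if_neg hk, mul_zero]

lemma memLp_fourierMode (k : ℤ × ℤ) :
    MemLp (fourierMode k) 2 ((volume : Measure Plane).restrict torus) := by
  refine MemLp.of_bound (continuous_fourierMode k).aestronglyMeasurable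
    (Real.sqrt 2 / (2 * Real.pi)) (Filter.Eventually.of_forall fun x => ?_)
  rw [fourierMode_eq_cos, norm_mul, Real.norm_of_nonneg (by positivity)]
  exact mul_le_of_le_one_right (by positivity) (Real.abs_cos_le_one _)

/-- The vector `e_k` of `L²_#`; the value at `k = 0` is `0`. -/
noncomputable def modeVec (k : ℤ × ℤ) : L2Mean0 :=
  if h : k ≠ 0 then ⟨(memLp_fourierMode k).toLp, by
    change ∫ x in torus, _ = 0
    rw [integral_congr_ae (memLp_fourierMode k).coeFn_toLp]
    exact integral_fourierMode h⟩ else 0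

lemma modeVec_ae_eq {k : ℤ × ℤ} (hk : k ≠ 0) :
    ((modeVec k : L2Mean0) : Lp ℝ 2 ((volume : Measure Plane).restrict torus))
      =ᵐ[(volume : Measure Plane).restrict torus] fourierMode k := by
  unfold modeVec
  rw [dif_pos hk]
  exact (memLp_fourierMode k).coeFn_toLp

lemma inner_modeVec {k : ℤ × ℤ} (hk : k ≠ 0) (u : L2Mean0) :
    ⟪u, modeVec k⟫ = fourierCoeffReal u k := by
  rw [Submodule.coe_inner, L2.inner_def]
  unfold fourierCoeffReal
  refine integral_congr_ae ?_
  filter_upwards [modeVec_ae_eq hk] with x hx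
  rw [hx]
  simp [mul_comm]

lemma fourierCoeffReal_modeVec {k l : ℤ × ℤ} (hk : k ≠ 0) (hl : l ≠ 0) :
    fourierCoeffReal (modeVec k) l = if k = l then 1 else 0 := by
  rw [← integral_fourierMode_mul hk hl]
  unfold fourierCoeffReal
  refine integral_congr_ae ?_
  filter_upwards [modeVec_ae_eq hk] with x hx
  rw [hx]

/-- The projection of the plane onto the torus `(ℝ / ℤ)²`, with periods scaled to `2π`. -/
noncomputable def toUnitTorus (x : Plane) : UnitAddTorus (Fin 2) :=
  fun i => ((x i / (2 * Real.pi) : ℝ) : UnitAddCircle)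

/-- The section of `toUnitTorus` with values in `(-π, π]²`. -/
noncomputable def ofUnitTorus (θ : UnitAddTorus (Fin 2)) : Plane :=
  WithLp.toLp 2 fun i => 2 * Real.pi * (AddCircle.equivIoc 1 (-(1 / 2) : ℝ) (θ i) : ℝ)

lemma continuous_toUnitTorus : Continuous toUnitTorus := by
  unfold toUnitTorus
  refine continuous_pi fun i => ?_
  exact (AddCircle.continuous_mk' 1).comp (by fun_prop)

lemma measurable_ofUnitTorus : Measurable ofUnitTorus := by
  unfold ofUnitTorus
  refine (MeasurableEquiv.toLp 2 (Fin 2 → ℝ)).measurable.comp (measurable_pi_lambda _ fun i => ?_)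
  have h : Measurable fun t : UnitAddCircle => (AddCircle.equivIoc 1 (-(1 / 2) : ℝ) t : ℝ) :=
    measurable_subtype_coe.comp (AddCircle.measurableEquivIoc 1 (-(1 / 2) : ℝ)).measurable
  exact (h.comp (measurable_pi_apply i)).const_mul _

lemma ofUnitTorus_toUnitTorus {x : Plane} (hx : ∀ i, x i ∈ Set.Ioc (-Real.pi) Real.pi) :
    ofUnitTorus (toUnitTorus x) = x := by
  have hpi := Real.pi_pos
  ext i
  simp only [ofUnitTorus, toUnitTorus]
  have hmem : x i / (2 * Real.pi) ∈ Set.Ioc (-(1 / 2) : ℝ) (-(1 / 2) + 1) := by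
    constructor
    · rw [lt_div_iff₀ (by positivity)]; linarith [(hx i).1]
    · rw [div_le_iff₀ (by positivity)]; linarith [(hx i).2]
  rw [AddCircle.equivIoc_coe_of_mem hmem]
  field_simp

lemma ae_ofUnitTorus_toUnitTorus :
    ∀ᵐ x ∂(volume : Measure Plane).restrict torus, ofUnitTorus (toUnitTorus x) = x := by
  have hIcc : ∀ᵐ y ∂(Measure.pi fun _ : Fin 2 =>
      (volume : Measure ℝ).restrict (Set.Icc (-Real.pi) Real.pi)),
      ∀ i, y i ∈ Set.Ioc (-Real.pi) Real.pi := by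
    rw [ae_all_iff]
    intro i
    have h : ∀ᵐ t ∂(volume : Measure ℝ).restrict (Set.Icc (-Real.pi) Real.pi),
        t ∈ Set.Ioc (-Real.pi) Real.pi := by
      rw [← Measure.restrict_congr_set Ioc_ae_eq_Icc]
      exact ae_restrict_mem measurableSet_Ioc
    exact (Measure.tendsto_eval_ae_ae (i := i)).eventually h
  rw [← volume_torus_restrict_map] at hIcc
  have h := ae_of_ae_map (by fun_prop : Measurable fun x : Plane => x.ofLp).aemeasurable hIcc
  filter_upwards [h] with x hx
  exact ofUnitTorus_toUnitTorus hx

lemma mFourier_toUnitTorus (n : Fin 2 → ℤ) (x : Plane) :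
    UnitAddTorus.mFourier n (toUnitTorus x) =
      (Real.cos (freqDot (n 0, n 1) x) : ℂ) + (Real.sin (freqDot (n 0, n 1) x) : ℂ) * Complex.I := by
  have hpi := Real.pi_ne_zero
  simp only [UnitAddTorus.mFourier, ContinuousMap.coe_mk, Fin.prod_univ_two, toUnitTorus,
    fourier_coe_apply]
  rw [← Complex.exp_add, Complex.ofReal_cos, Complex.ofReal_sin, ← Complex.exp_mul_I]
  congr 1
  simp only [freqDot]
  push_cast
  have : (Real.pi : ℂ) ≠ 0 := by exact_mod_cast hpi
  field_simp

/-- Every trigonometric monomial of frequency `k` is orthogonal to an integrable function which is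
orthogonal to the constants and to all the `e_k`. -/
lemma integral_mul_trig_eq_zero {h : Plane → ℝ}
    (h0 : ∫ x in torus, h x = 0)
    (hk : ∀ k : ℤ × ℤ, k ≠ 0 → ∫ x in torus, h x * fourierMode k x = 0) (k : ℤ × ℤ) :
    ∫ x in torus, h x * Real.cos (freqDot k x) = 0 ∧
      ∫ x in torus, h x * Real.sin (freqDot k x) = 0 := by
  rcases eq_or_ne k 0 with rfl | hk0
  · simp [freqDot, h0]
  have hc : Real.sqrt 2 / (2 * Real.pi) ≠ 0 := by positivity
  have hneg : ∀ k x, freqDot (-k) x = -freqDot k x := fun k x => by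
    simp only [freqDot, Prod.fst_neg, Prod.snd_neg]; push_cast; ring
  have hcomm : ∀ a b : ℝ, a * (Real.sqrt 2 / (2 * Real.pi) * b) =
      Real.sqrt 2 / (2 * Real.pi) * (a * b) := fun a b => mul_left_comm _ _ _
  have hcos : ∀ k : ℤ × ℤ, k ≠ 0 → modePhase k = 0 →
      ∫ x in torus, h x * Real.cos (freqDot k x) = 0 := fun k hk0 hp => by
    have := hk k hk0
    simp_rw [fourierMode_eq_cos, hp, add_zero, hcomm] at this
    rw [integral_const_mul] at this
    exact (mul_eq_zero.1 this).resolve_left hc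
  have hsin : ∀ k : ℤ × ℤ, k ≠ 0 → modePhase k = -(Real.pi / 2) →
      ∫ x in torus, h x * Real.sin (freqDot k x) = 0 := fun k hk0 hp => by
    have := hk k hk0
    simp_rw [fourierMode_eq_cos, hp, ← sub_eq_add_neg, Real.cos_sub_pi_div_two,
      hcomm] at this
    rw [integral_const_mul] at this
    exact (mul_eq_zero.1 this).resolve_left hc
  have hadd := modePhase_add_neg hk0
  have hk0' : -k ≠ 0 := neg_ne_zero.2 hk0
  have hcases : modePhase k = 0 ∨ modePhase k = -(Real.pi / 2) := by
    unfold modePhase; split_ifs <;> simp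
  rcases hcases with hp | hp
  · refine ⟨hcos k hk0 hp, ?_⟩
    have := hsin (-k) hk0' (by linarith)
    simp_rw [hneg, Real.sin_neg, mul_neg] at this
    rwa [integral_neg, neg_eq_zero] at this
  · refine ⟨?_, hsin k hk0 hp⟩
    have := hcos (-k) hk0' (by linarith)
    simp_rw [hneg, Real.cos_neg] at this
    exact this

/-- Completeness of the trigonometric system: the positive and negative parts of `h` define finite
measures on `(ℝ / ℤ)²` with the same integrals against all characters. -/
lemma ae_eq_zero_of_integral_fourierMode {h : Plane → ℝ}
    (hint : Integrable h ((volume : Measure Plane).restrict torus))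
    (h0 : ∫ x in torus, h x = 0)
    (hk : ∀ k : ℤ × ℤ, k ≠ 0 → ∫ x in torus, h x * fourierMode k x = 0) :
    h =ᵐ[(volume : Measure Plane).restrict torus] 0 := by
  set μ := (volume : Measure Plane).restrict torus with hμ
  have hintn : Integrable (fun x => -h x) μ := hint.neg
  have htrig := integral_mul_trig_eq_zero h0 hk
  have hbound : ∀ g : C(UnitAddTorus (Fin 2), ℂ),
      Integrable (fun x => (h x : ℂ) * g (toUnitTorus x)) μ := by
    intro g
    refine Integrable.mul_bdd (c := ‖g‖) hint.ofReal ?_ ?_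
    · exact (g.continuous.comp continuous_toUnitTorus).aestronglyMeasurable
    · exact Filter.Eventually.of_forall fun x => g.norm_coe_le_norm _
  have hker : ∀ g : C(UnitAddTorus (Fin 2), ℂ), ∫ x, (h x : ℂ) * g (toUnitTorus x) ∂μ = 0 := by
    -- integration against `h` is a continuous functional vanishing on the characters, whose span is
    -- dense
    let Λ : C(UnitAddTorus (Fin 2), ℂ) →ₗ[ℂ] ℂ :=
      { toFun g := ∫ x, (h x : ℂ) * g (toUnitTorus x) ∂μ
        map_add' g g' := by
          simp only [ContinuousMap.add_apply, mul_add]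
          exact integral_add (hbound g) (hbound g')
        map_smul' c g := by
          simp only [ContinuousMap.smul_apply, smul_eq_mul, RingHom.id_apply, mul_left_comm]
          exact integral_const_mul _ _ }
    have hΛ : Continuous Λ := by
      refine (LinearMap.mkContinuous Λ (∫ x, ‖(h x : ℂ)‖ ∂μ) fun g => ?_).continuous
      refine (norm_integral_le_integral_norm _).trans ?_
      rw [← integral_mul_const]
      refine integral_mono (hbound g).norm (hint.ofReal.norm.mul_const _) fun x => ?_
      simp only [norm_mul]
      gcongr
      exact g.norm_coe_le_norm _
    have hspan : ∀ g ∈ (Submodule.span ℂ (Set.range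
        (UnitAddTorus.mFourier (d := Fin 2)))).topologicalClosure, Λ g = 0 := by
      intro g hg
      have hcl : IsClosed {g | Λ g = 0} := isClosed_eq hΛ continuous_const
      refine hcl.closure_subset_iff.2 ?_ hg
      intro g hg
      induction hg using Submodule.span_induction with
      | mem g hg =>
        obtain ⟨n, rfl⟩ := hg
        change ∫ x, (h x : ℂ) * UnitAddTorus.mFourier n (toUnitTorus x) ∂μ = 0
        simp_rw [mFourier_toUnitTorus, mul_add, ← mul_assoc, ← Complex.ofReal_mul]
        have hcd := continuous_freqDot (n 0, n 1)
        rw [integral_add, integral_mul_const, integral_complex_ofReal, integral_complex_ofReal,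
          (htrig _).1, (htrig _).2]
        · simp
        · refine (Integrable.mul_bdd (c := 1) hint ?_ ?_).ofReal
          · exact (by fun_prop : Continuous fun x => Real.cos (freqDot (n 0, n 1) x)).aestronglyMeasurable
          · exact Filter.Eventually.of_forall fun x => Real.abs_cos_le_one _
        · refine (Integrable.mul_bdd (c := 1) hint ?_ ?_).ofReal.mul_const _
          · exact (by fun_prop : Continuous fun x => Real.sin (freqDot (n 0, n 1) x)).aestronglyMeasurable
          · exact Filter.Eventually.of_forall fun x => Real.abs_sin_le_one _
      | zero => exact map_zero Λ
      | add g g' _ _ hg hg' =>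
        change Λ (g + g') = 0
        rw [map_add, show Λ g = 0 from hg, show Λ g' = 0 from hg', add_zero]
      | smul c g _ hg =>
        change Λ (c • g) = 0
        rw [map_smul, show Λ g = 0 from hg, smul_zero]
    intro g
    exact hspan g (by rw [UnitAddTorus.span_mFourier_closure_eq_top]; trivial)
  set μp := μ.withDensity (fun x => ENNReal.ofReal (h x)) with hμp
  set μm := μ.withDensity (fun x => ENNReal.ofReal (-h x)) with hμm
  have : IsFiniteMeasure μp := isFiniteMeasure_withDensity_ofReal hint.2
  have : IsFiniteMeasure μm := isFiniteMeasure_withDensity_ofReal hintn.2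
  have hmeas : Measurable toUnitTorus := continuous_toUnitTorus.measurable
  have hmap : μp.map toUnitTorus = μm.map toUnitTorus := by
    refine ext_of_forall_integral_eq_of_IsFiniteMeasure fun f => ?_
    rw [integral_map hmeas.aemeasurable f.continuous.aestronglyMeasurable,
      integral_map hmeas.aemeasurable f.continuous.aestronglyMeasurable,
      integral_withDensity_eq_integral_toReal_smul₀ hint.1.aemeasurable.ennreal_ofReal
        (Filter.Eventually.of_forall fun x => ENNReal.ofReal_lt_top),
      integral_withDensity_eq_integral_toReal_smul₀ hintn.1.aemeasurable.ennreal_ofReal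
        (Filter.Eventually.of_forall fun x => ENNReal.ofReal_lt_top)]
    have hf : Continuous fun x => f (toUnitTorus x) := f.continuous.comp continuous_toUnitTorus
    have hbd : ∀ᵐ x ∂μ, ‖f (toUnitTorus x)‖ ≤ ‖f‖ :=
      Filter.Eventually.of_forall fun x => f.norm_coe_le_norm _
    simp only [ENNReal.toReal_ofReal', smul_eq_mul]
    rw [← sub_eq_zero, ← integral_sub]
    · have hz := hker ⟨fun θ => (f θ : ℂ), by fun_prop⟩
      simp only [ContinuousMap.coe_mk, ← Complex.ofReal_mul] at hz
      rw [integral_complex_ofReal] at hz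
      have hz' : ∫ x, h x * f (toUnitTorus x) ∂μ = 0 := by exact_mod_cast hz
      refine Eq.trans ?_ hz'
      refine integral_congr_ae (Filter.Eventually.of_forall fun x => ?_)
      simp only [← sub_mul]
      congr 1
      rcases le_total 0 (h x) with hx | hx
      · rw [max_eq_left hx, max_eq_right (by linarith)]; ring
      · rw [max_eq_right hx, max_eq_left (by linarith)]; ring
    · exact Integrable.mul_bdd (c := ‖f‖) hint.pos_part hf.aestronglyMeasurable hbd
    · exact Integrable.mul_bdd (c := ‖f‖) hintn.pos_part hf.aestronglyMeasurable hbd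
  -- no information is lost in the pushforward, as the boundary of the square is null
  have hback : ∀ ν : Measure Plane, ν ≪ μ → (ν.map toUnitTorus).map ofUnitTorus = ν := by
    intro ν hν
    rw [Measure.map_map measurable_ofUnitTorus hmeas]
    have : ofUnitTorus ∘ toUnitTorus =ᵐ[ν] id := hν.ae_le ae_ofUnitTorus_toUnitTorus
    rw [Measure.map_congr this, Measure.map_id]
  have heq : μp = μm := by
    rw [← hback μp (withDensity_absolutelyContinuous _ _),
      ← hback μm (withDensity_absolutelyContinuous _ _), hmap]
  have hd := (withDensity_eq_iff hint.1.aemeasurable.ennreal_ofReal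
    hintn.1.aemeasurable.ennreal_ofReal ?_).1 heq
  · filter_upwards [hd] with x hx
    rcases le_total 0 (h x) with hx0 | hx0
    · rw [ENNReal.ofReal_of_nonpos (by simpa using hx0 : -h x ≤ 0), ENNReal.ofReal_eq_zero] at hx
      exact le_antisymm hx hx0
    · rw [ENNReal.ofReal_of_nonpos hx0, eq_comm, ENNReal.ofReal_eq_zero] at hx
      exact le_antisymm hx0 (by simpa using hx)
  · have := measure_lt_top μp Set.univ
    rw [hμp, withDensity_apply _ MeasurableSet.univ, setLIntegral_univ] at this
    exact this.ne

/-! ### Centred Gaussian random variables -/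

section Gaussian

variable {Ω : Type*} [MeasurableSpace Ω] {P : Measure Ω}

lemma hasSubgaussianMGF_of_hasLaw_gaussianReal [IsProbabilityMeasure P] {Y : Ω → ℝ} {v V : ℝ≥0}
    (hY : HasLaw Y (gaussianReal 0 v) P) (hvV : v ≤ V) : HasSubgaussianMGF Y V P where
  integrable_exp_mul t := by
    have h : Integrable (fun x => Real.exp (t * x)) (P.map Y) := by
      rw [hY.map_eq]; exact integrable_exp_mul_gaussianReal t
    exact h.comp_aemeasurable hY.aemeasurable
  mgf_le t := by
    rw [mgf_gaussianReal hY.map_eq]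
    refine Real.exp_le_exp.2 ?_
    have : (v : ℝ) ≤ V := by exact_mod_cast hvV
    simp only [zero_mul, zero_add]
    gcongr

lemma gaussian_tail_le [IsProbabilityMeasure P] {Y : Ω → ℝ} {v V : ℝ≥0}
    (hY : HasLaw Y (gaussianReal 0 v) P) (hvV : v ≤ V) {a : ℝ} (ha : 0 ≤ a) :
    P {ω | a ≤ |Y ω|} ≤ ENNReal.ofReal (2 * Real.exp (-a ^ 2 / (2 * V))) := by
  have h1 := (hasSubgaussianMGF_of_hasLaw_gaussianReal hY hvV).measure_ge_le ha
  have h2 := (hasSubgaussianMGF_of_hasLaw_gaussianReal hY hvV).neg.measure_ge_le ha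
  have hsub : {ω | a ≤ |Y ω|} ⊆ {ω | a ≤ Y ω} ∪ {ω | a ≤ (-Y) ω} := by
    intro ω hω
    rcases le_abs.1 (show a ≤ |Y ω| from hω) with h | h
    · exact Or.inl h
    · exact Or.inr h
  refine (measure_mono hsub).trans ?_
  rw [ENNReal.le_ofReal_iff_toReal_le (measure_ne_top _ _) (by positivity)]
  refine (measureReal_union_le _ _).trans ?_
  rw [two_mul]
  exact add_le_add h1 h2

lemma hasLaw_gaussianReal_of_tendsto [IsProbabilityMeasure P] {Y : ℕ → Ω → ℝ} {Z : Ω → ℝ}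
    {v : ℕ → ℝ≥0} {w : ℝ≥0} (hY : ∀ n, HasLaw (Y n) (gaussianReal 0 (v n)) P)
    (hYZ : ∀ᵐ ω ∂P, Filter.Tendsto (fun n => Y n ω) Filter.atTop (nhds (Z ω)))
    (hv : Filter.Tendsto v Filter.atTop (nhds w)) : HasLaw Z (gaussianReal 0 w) P := by
  have hZ : AEMeasurable Z P :=
    aemeasurable_of_tendsto_metrizable_ae _ (fun n => (hY n).aemeasurable) hYZ
  refine ⟨hZ, ?_⟩
  have : IsProbabilityMeasure (P.map Z) := Measure.isProbabilityMeasure_map hZ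
  refine Measure.ext_of_charFun ?_
  ext t
  have hchar : ∀ X : Ω → ℝ, AEMeasurable X P →
      charFun (P.map X) t = ∫ ω, Complex.exp (t * X ω * Complex.I) ∂P := by
    intro X hX
    rw [charFun_apply_real, integral_map hX (by fun_prop)]
  have h1 : Filter.Tendsto (fun n => ∫ ω, Complex.exp (t * Y n ω * Complex.I) ∂P) Filter.atTop
      (nhds (∫ ω, Complex.exp (t * Z ω * Complex.I) ∂P)) := by
    refine tendsto_integral_of_dominated_convergence (fun _ => 1) (fun n => ?_)
      (integrable_const 1) (fun n => Filter.Eventually.of_forall fun ω => ?_) ?_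
    · have := (hY n).aemeasurable
      exact (by fun_prop : AEMeasurable _ P).aestronglyMeasurable
    · rw [← Complex.ofReal_mul, Complex.norm_exp_ofReal_mul_I]
    · filter_upwards [hYZ] with ω hω
      have hcont : Continuous fun x : ℝ => Complex.exp (t * x * Complex.I) := by fun_prop
      exact (hcont.tendsto _).comp hω
  have h2 : Filter.Tendsto (fun n => ∫ ω, Complex.exp (t * Y n ω * Complex.I) ∂P) Filter.atTop
      (nhds (charFun (gaussianReal 0 w) t)) := by
    have : ∀ n, ∫ ω, Complex.exp (t * Y n ω * Complex.I) ∂P = charFun (gaussianReal 0 (v n)) t :=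
      fun n => by rw [← hchar _ (hY n).aemeasurable, (hY n).map_eq]
    simp_rw [this, charFun_gaussianReal]
    have hcont : Continuous fun x : ℝ≥0 =>
        Complex.exp (t * (0 : ℝ) * Complex.I - ((x : ℝ) : ℂ) * t ^ 2 / 2) := by fun_prop
    exact (hcont.tendsto w).comp hv
  rw [hchar Z hZ]
  exact tendsto_nhds_unique h1 h2

lemma gaussianPDF_le (v : ℝ≥0) (x : ℝ) :
    gaussianPDF 0 v x ≤ ENNReal.ofReal (Real.sqrt (2 * Real.pi * v))⁻¹ := by
  unfold gaussianPDF gaussianPDFReal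
  refine ENNReal.ofReal_le_ofReal ?_
  refine mul_le_of_le_one_right (by positivity) ?_
  rw [Real.exp_le_one_iff]
  refine div_nonpos_of_nonpos_of_nonneg ?_ (by positivity)
  nlinarith [sq_nonneg (x - 0)]

lemma gaussianReal_Icc_le {v : ℝ≥0} (hv : v ≠ 0) (a b : ℝ) :
    gaussianReal 0 v (Set.Icc a b) ≤
      ENNReal.ofReal (Real.sqrt (2 * Real.pi * v))⁻¹ * ENNReal.ofReal (b - a) := by
  rw [gaussianReal_apply 0 hv, ← Real.volume_Icc]
  refine (setLIntegral_mono measurable_const fun x _ => gaussianPDF_le v x).trans ?_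
  rw [setLIntegral_const]

lemma le_gaussianReal_Icc {v : ℝ≥0} {c C R : ℝ} (hc : 0 < c) (hcv : c ≤ v) (hvC : v ≤ C)
    {a b : ℝ} (hab : ∀ x ∈ Set.Icc a b, |x| ≤ R) :
    ENNReal.ofReal ((Real.sqrt (2 * Real.pi * C))⁻¹ * Real.exp (-R ^ 2 / (2 * c))) *
      ENNReal.ofReal (b - a) ≤ gaussianReal 0 v (Set.Icc a b) := by
  have hv0 : (0 : ℝ) < v := hc.trans_le hcv
  have hv : v ≠ 0 := by rintro rfl; simp at hv0
  rw [gaussianReal_apply 0 hv, ← Real.volume_Icc, ← setLIntegral_const]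
  refine setLIntegral_mono' measurableSet_Icc fun x hx => ?_
  unfold gaussianPDF gaussianPDFReal
  refine ENNReal.ofReal_le_ofReal ?_
  have hx2 : x ^ 2 ≤ R ^ 2 := sq_le_sq' (by linarith [neg_abs_le x, hab x hx])
    ((le_abs_self x).trans (hab x hx))
  gcongr ?_ * ?_
  · gcongr
  · refine Real.exp_le_exp.2 ?_
    rw [sub_zero, neg_div, neg_div, neg_le_neg_iff]
    gcongr

/-- Two jointly Gaussian variables `U` and `W + ρ U` with `W` independent of `U` are both within
`η` of `y` with probability at most of order `η ^ 2`. -/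
lemma gaussian_pair_le [IsProbabilityMeasure P] {U W : Ω → ℝ} (hU : Measurable U)
    (hW : Measurable W) {v₁ v₂ : ℝ≥0} (hv₁ : v₁ ≠ 0) (hv₂ : v₂ ≠ 0)
    (h : ∀ s r : ℝ, HasLaw (fun ω => s * U ω + r * W ω)
      (gaussianReal 0 ((s ^ 2).toNNReal * v₁ + (r ^ 2).toNNReal * v₂)) P) (ρ y η : ℝ) :
    P {ω | |U ω - y| ≤ η ∧ |W ω + ρ * U ω - y| ≤ η} ≤
      (ENNReal.ofReal (Real.sqrt (2 * Real.pi * v₁))⁻¹ * ENNReal.ofReal (2 * η)) *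
      (ENNReal.ofReal (Real.sqrt (2 * Real.pi * v₂))⁻¹ * ENNReal.ofReal (2 * η)) := by
  have hUlaw : P.map U = gaussianReal 0 v₁ := by simpa using (h 1 0).map_eq
  have hWlaw : P.map W = gaussianReal 0 v₂ := by simpa using (h 0 1).map_eq
  have hind : IndepFun U W P := by
    rw [indepFun_iff_charFun_prod hU.aemeasurable hW.aemeasurable]
    intro t
    have e1 : charFun (P.map fun ω => WithLp.toLp 2 (U ω, W ω)) t =
        charFun (P.map fun ω => t.fst * U ω + t.snd * W ω) 1 := by
      rw [charFun_apply, charFun_apply_real, integral_map (by fun_prop) (by fun_prop),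
        integral_map (by fun_prop) (by fun_prop)]
      refine integral_congr_ae (Filter.Eventually.of_forall fun ω => ?_)
      simp [WithLp.prod_inner_apply]
    rw [e1, (h t.fst t.snd).map_eq, hUlaw, hWlaw, charFun_gaussianReal, charFun_gaussianReal,
      charFun_gaussianReal, ← Complex.exp_add]
    congr 1
    push_cast
    rw [Real.coe_toNNReal _ (sq_nonneg _), Real.coe_toNNReal _ (sq_nonneg _)]
    push_cast
    simp only [WithLp.ofLp_fst, WithLp.ofLp_snd]
    ring
  have hmap := (indepFun_iff_map_prod_eq_prod_map_map hU.aemeasurable hW.aemeasurable).1 hind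
  set T : Set (ℝ × ℝ) := {p | |p.1 - y| ≤ η ∧ |p.2 + ρ * p.1 - y| ≤ η} with hT
  have hTm : MeasurableSet T := by
    have c₁ : IsClosed {p : ℝ × ℝ | |p.1 - y| ≤ η} := isClosed_le (by fun_prop) continuous_const
    have c₂ : IsClosed {p : ℝ × ℝ | |p.2 + ρ * p.1 - y| ≤ η} :=
      isClosed_le (by fun_prop) continuous_const
    exact (c₁.inter c₂).measurableSet
  have e : P {ω | |U ω - y| ≤ η ∧ |W ω + ρ * U ω - y| ≤ η} =
      (P.map fun ω => (U ω, W ω)) T := by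
    rw [Measure.map_apply (hU.prodMk hW) hTm]; rfl
  rw [e, hmap, hUlaw, hWlaw, Measure.prod_apply hTm]
  calc ∫⁻ u, gaussianReal 0 v₂ (Prod.mk u ⁻¹' T) ∂gaussianReal 0 v₁
      ≤ ∫⁻ u, (Set.Icc (y - η) (y + η)).indicator (fun _ =>
          ENNReal.ofReal (Real.sqrt (2 * Real.pi * v₂))⁻¹ * ENNReal.ofReal (2 * η)) u
          ∂gaussianReal 0 v₁ := by
        refine lintegral_mono fun u => ?_
        by_cases hu : u ∈ Set.Icc (y - η) (y + η)
        · rw [Set.indicator_of_mem hu]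
          have hsub : Prod.mk u ⁻¹' T ⊆ Set.Icc (y - ρ * u - η) (y - ρ * u + η) := by
            rintro w ⟨-, hw⟩
            have := abs_le.1 hw
            simp only at this
            constructor <;> linarith
          refine (measure_mono hsub).trans ((gaussianReal_Icc_le hv₂ _ _).trans (le_of_eq ?_))
          congr 2; ring
        · have : Prod.mk u ⁻¹' T = ∅ := by
            ext w
            simp only [Set.mem_empty_iff_false, iff_false]
            rintro ⟨hu', -⟩
            have := abs_le.1 hu'
            simp only at this
            exact hu ⟨by linarith, by linarith⟩
          rw [this, measure_empty]
          exact zero_le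
    _ = (ENNReal.ofReal (Real.sqrt (2 * Real.pi * v₂))⁻¹ * ENNReal.ofReal (2 * η)) *
          gaussianReal 0 v₁ (Set.Icc (y - η) (y + η)) := by
        rw [lintegral_indicator_const measurableSet_Icc]
    _ ≤ _ := by
        rw [mul_comm]
        gcongr
        refine (gaussianReal_Icc_le hv₁ _ _).trans (le_of_eq ?_)
        congr 2; ring

end Gaussian

/-! ### Dyadic shells of frequencies -/

/-- The frequencies `k` with `|k₁|, |k₂| < 2 ^ N`. -/
noncomputable def freqBox (N : ℕ) : Finset (ℤ × ℤ) :=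
  Finset.Ioo (-2 ^ N) (2 ^ N) ×ˢ Finset.Ioo (-2 ^ N) (2 ^ N)

/-- The frequencies `k` with `2 ^ j ≤ max |k₁| |k₂| < 2 ^ (j + 1)`. -/
noncomputable def freqShell (j : ℕ) : Finset (ℤ × ℤ) := freqBox (j + 1) \ freqBox j

lemma mem_freqBox {N : ℕ} {k : ℤ × ℤ} : k ∈ freqBox N ↔ |k.1| < 2 ^ N ∧ |k.2| < 2 ^ N := by
  simp only [freqBox, Finset.mem_product, Finset.mem_Ioo, abs_lt]

lemma freqBox_mono : Monotone freqBox := by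
  intro M N h k hk
  have h2 : (2 : ℤ) ^ M ≤ 2 ^ N := pow_le_pow_right₀ (by norm_num) h
  rw [mem_freqBox] at hk ⊢
  exact ⟨hk.1.trans_le h2, hk.2.trans_le h2⟩

lemma freqBox_zero : freqBox 0 = {0} := by
  ext k
  rw [mem_freqBox]
  simp [Int.abs_lt_one_iff, Prod.ext_iff]

lemma exists_mem_freqBox (k : ℤ × ℤ) : ∃ N, k ∈ freqBox N := by
  refine ⟨k.1.natAbs + k.2.natAbs, mem_freqBox.2 ?_⟩
  have h : ((k.1.natAbs + k.2.natAbs : ℕ) : ℤ) < 2 ^ (k.1.natAbs + k.2.natAbs) := by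
    exact_mod_cast Nat.lt_two_pow_self
  push_cast at h
  constructor
  · linarith [abs_nonneg k.2]
  · linarith [abs_nonneg k.1]

lemma tendsto_freqBox : Filter.Tendsto freqBox Filter.atTop Filter.atTop :=
  Filter.tendsto_atTop_finset_of_monotone freqBox_mono exists_mem_freqBox

lemma sum_freqBox {M : Type*} [AddCommGroup M] (f : ℤ × ℤ → M) (N : ℕ) :
    ∑ k ∈ freqBox N, f k = f 0 + ∑ j ∈ Finset.range N, ∑ k ∈ freqShell j, f k := by
  induction N with
  | zero => simp [freqBox_zero]
  | succ N ih =>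
    rw [Finset.sum_range_succ, ← add_assoc, ← ih, freqShell, add_comm (∑ k ∈ freqBox N, f k),
      Finset.sum_sdiff (freqBox_mono N.le_succ)]

lemma card_freqShell_le (j : ℕ) : ((freqShell j).card : ℝ) ≤ 16 * 4 ^ j := by
  have h1 : (freqShell j).card ≤ (freqBox (j + 1)).card := Finset.card_le_card Finset.sdiff_subset
  have h2 : (freqBox (j + 1)).card ≤ 16 * 4 ^ j := by
    rw [freqBox, Finset.card_product, Int.card_Ioo]
    have : ((2 : ℤ) ^ (j + 1) - -2 ^ (j + 1) - 1).toNat ≤ 4 * 2 ^ j := by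
      rw [Int.toNat_le]; push_cast; rw [pow_succ]; linarith
    calc _ ≤ (4 * 2 ^ j) * (4 * 2 ^ j) := Nat.mul_le_mul this this
      _ = 16 * 4 ^ j := by rw [show (4 : ℕ) = 2 * 2 from rfl, mul_pow]; ring
  exact_mod_cast h1.trans h2

lemma abs_le_of_mem_freqShell {j : ℕ} {k : ℤ × ℤ} (hk : k ∈ freqShell j) :
    |(k.1 : ℝ)| ≤ 2 * 2 ^ j ∧ |(k.2 : ℝ)| ≤ 2 * 2 ^ j := by
  have h := mem_freqBox.1 (Finset.mem_sdiff.1 hk).1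
  rw [pow_succ'] at h
  exact ⟨by exact_mod_cast h.1.le, by exact_mod_cast h.2.le⟩

lemma le_freqNorm_of_mem_freqShell {j : ℕ} {k : ℤ × ℤ} (hk : k ∈ freqShell j) :
    (2 : ℝ) ^ j ≤ freqNorm k := by
  have h := (Finset.mem_sdiff.1 hk).2
  rw [mem_freqBox, not_and_or, not_lt, not_lt] at h
  unfold freqNorm
  rcases h with h | h
  · have h' : (2 : ℝ) ^ j ≤ |(k.1 : ℝ)| := by exact_mod_cast h
    exact h'.trans (Real.abs_le_sqrt (by linarith [sq_nonneg (k.2 : ℝ)]))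
  · have h' : (2 : ℝ) ^ j ≤ |(k.2 : ℝ)| := by exact_mod_cast h
    exact h'.trans (Real.abs_le_sqrt (by linarith [sq_nonneg (k.1 : ℝ)]))

lemma freqNorm_pos {k : ℤ × ℤ} (hk : k ≠ 0) : 0 < freqNorm k := by
  unfold freqNorm
  refine Real.sqrt_pos.2 ?_
  have : ¬ (k.1 = 0 ∧ k.2 = 0) := fun h => hk (Prod.ext h.1 h.2)
  by_cases h1 : k.1 = 0
  · have h2 : (k.2 : ℝ) ≠ 0 := by exact_mod_cast fun h => this ⟨h1, h⟩
    positivity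
  · have h2 : (k.1 : ℝ) ≠ 0 := by exact_mod_cast h1
    positivity

lemma freqNorm_neg (k : ℤ × ℤ) : freqNorm (-k) = freqNorm k := by
  simp [freqNorm]

lemma ne_zero_of_mem_freqShell {j : ℕ} {k : ℤ × ℤ} (hk : k ∈ freqShell j) : k ≠ 0 := by
  rintro rfl
  have := le_freqNorm_of_mem_freqShell hk
  have h2 : (0 : ℝ) < 2 ^ j := by positivity
  simp [freqNorm] at this
  linarith

/-! ### Gaussian Fourier coefficients -/

/-- Independent centred Gaussian coefficients `Z k`, with variances `q k` comparable to
`|k| ^ (-2 - 2 H)`. The joint law is encoded by the laws of the finite linear combinations. -/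
structure IsGaussianFourier {Ω : Type*} [MeasurableSpace Ω] (P : Measure Ω) (H : ℝ)
    (Z : ℤ × ℤ → Ω → ℝ) (q : ℤ × ℤ → ℝ) (c C : ℝ) : Prop where
  H_pos : 0 < H
  H_lt_one : H < 1
  c_pos : 0 < c
  measurable : ∀ k, Measurable (Z k)
  coeff_zero : Z 0 = 0
  var_zero : q 0 = 0
  law : ∀ (F : Finset (ℤ × ℤ)) (a : ℤ × ℤ → ℝ),
    HasLaw (fun ω => ∑ k ∈ F, a k * Z k ω)
      (gaussianReal 0 (∑ k ∈ F, a k ^ 2 * q k).toNNReal) P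
  le_var : ∀ k, k ≠ 0 → c * freqNorm k ^ (-(2 + 2 * H)) ≤ q k
  var_le : ∀ k, k ≠ 0 → q k ≤ C * freqNorm k ^ (-(2 + 2 * H))

section Coefficients

variable {Ω : Type*} [MeasurableSpace Ω] {P : Measure Ω} {H : ℝ} {Z : ℤ × ℤ → Ω → ℝ}
  {q : ℤ × ℤ → ℝ} {c C : ℝ}

namespace IsGaussianFourier

lemma var_nonneg (hZ : IsGaussianFourier P H Z q c C) (k : ℤ × ℤ) : 0 ≤ q k := by
  rcases eq_or_ne k 0 with rfl | hk
  · exact hZ.var_zero.ge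
  · have := freqNorm_pos hk
    exact le_trans (mul_nonneg hZ.c_pos.le (by positivity)) (hZ.le_var k hk)

lemma C_pos (hZ : IsGaussianFourier P H Z q c C) : 0 < C := by
  have hk : ((1, 0) : ℤ × ℤ) ≠ 0 := by simp
  have h := (hZ.le_var _ hk).trans (hZ.var_le _ hk)
  have h2 : 0 < freqNorm (1, 0) ^ (-(2 + 2 * H)) := Real.rpow_pos_of_pos (freqNorm_pos hk) _
  exact hZ.c_pos.trans_le (le_of_mul_le_mul_right h h2)

lemma var_le_of_mem_freqShell (hZ : IsGaussianFourier P H Z q c C) {j : ℕ} {k : ℤ × ℤ}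
    (hk : k ∈ freqShell j) : q k ≤ C * (2 : ℝ) ^ (-(2 + 2 * H) * j) := by
  refine (hZ.var_le k (ne_zero_of_mem_freqShell hk)).trans ?_
  refine mul_le_mul_of_nonneg_left ?_ hZ.C_pos.le
  rw [mul_comm _ (j : ℝ), Real.rpow_mul (by norm_num), Real.rpow_natCast]
  have h2 : (0 : ℝ) < 2 ^ j := by positivity
  exact Real.rpow_le_rpow_of_nonpos h2 (le_freqNorm_of_mem_freqShell hk)
    (by linarith [hZ.H_pos])

/-- Variance of a shell of modes whose amplitudes are at most `A`. -/
lemma sum_freqShell_le (hZ : IsGaussianFourier P H Z q c C) {j : ℕ} {a : ℤ × ℤ → ℝ} {A : ℝ}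
    (hA : 0 ≤ A) (ha : ∀ k ∈ freqShell j, a k ^ 2 ≤ A) :
    ∑ k ∈ freqShell j, a k ^ 2 * q k ≤ 16 * C * A * (2 : ℝ) ^ (-(2 * H) * j) := by
  have hC := hZ.C_pos
  calc ∑ k ∈ freqShell j, a k ^ 2 * q k
      ≤ ∑ k ∈ freqShell j, A * (C * (2 : ℝ) ^ (-(2 + 2 * H) * j)) :=
        Finset.sum_le_sum fun k hk => mul_le_mul (ha k hk) (hZ.var_le_of_mem_freqShell hk)
          (hZ.var_nonneg k) hA
    _ = (freqShell j).card * (A * (C * (2 : ℝ) ^ (-(2 + 2 * H) * j))) := by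
        rw [Finset.sum_const, nsmul_eq_mul]
    _ ≤ (16 * 4 ^ j) * (A * (C * (2 : ℝ) ^ (-(2 + 2 * H) * j))) := by
        gcongr
        exact card_freqShell_le j
    _ = 16 * C * A * (2 : ℝ) ^ (-(2 * H) * j) := by
        have : (2 : ℝ) ^ (-(2 + 2 * H) * j) * 4 ^ j = (2 : ℝ) ^ (-(2 * H) * j) := by
          rw [show (4 : ℝ) = 2 ^ (2 : ℝ) by norm_num, ← Real.rpow_natCast, ← Real.rpow_mul (by norm_num),
            ← Real.rpow_add (by norm_num)]
          congr 1; ring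
        rw [← this]; ring

lemma summable_var (hZ : IsGaussianFourier P H Z q c C) : Summable q := by
  have hgeo : Summable fun j : ℕ => 16 * C * 1 * (2 : ℝ) ^ (-(2 * H) * j) := by
    have : (fun j : ℕ => 16 * C * 1 * (2 : ℝ) ^ (-(2 * H) * j)) =
        fun j : ℕ => 16 * C * 1 * ((2 : ℝ) ^ (-(2 * H))) ^ j := by
      funext j
      rw [Real.rpow_mul (by norm_num), Real.rpow_natCast]
    rw [this]
    refine (summable_geometric_of_lt_one (by positivity) ?_).mul_left _
    exact Real.rpow_lt_one_of_one_lt_of_neg (by norm_num) (by linarith [hZ.H_pos])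
  have hC := hZ.C_pos
  refine summable_of_sum_le (c := ∑' j : ℕ, 16 * C * 1 * (2 : ℝ) ^ (-(2 * H) * j))
    hZ.var_nonneg fun F => ?_
  obtain ⟨N, hN⟩ := (tendsto_freqBox.eventually (Filter.eventually_ge_atTop F)).exists
  calc ∑ k ∈ F, q k ≤ ∑ k ∈ freqBox N, q k :=
        Finset.sum_le_sum_of_subset_of_nonneg hN fun k _ _ => hZ.var_nonneg k
    _ = ∑ j ∈ Finset.range N, ∑ k ∈ freqShell j, q k := by
        rw [sum_freqBox, hZ.var_zero, zero_add]
    _ ≤ ∑ j ∈ Finset.range N, 16 * C * 1 * (2 : ℝ) ^ (-(2 * H) * j) := by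
        refine Finset.sum_le_sum fun j _ => ?_
        have := hZ.sum_freqShell_le (j := j) (a := fun _ => 1) (A := 1) zero_le_one (fun k _ => by norm_num)
        simpa using this
    _ ≤ _ := hgeo.sum_le_tsum _ fun j _ => by positivity

lemma isProbabilityMeasure (hZ : IsGaussianFourier P H Z q c C) : IsProbabilityMeasure P := by
  have h := hZ.law ∅ 0
  have hP := (HasLaw.isProbabilityMeasure_iff h).2 inferInstance
  exact hP

end IsGaussianFourier

end Coefficients

/-! ### Uniform bounds for random trigonometric sums -/

/-- Super-exponential decay beats exponential growth. -/
lemma summable_pow_mul_exp_neg {A r κ : ℝ} (hA : 0 ≤ A) (hr : 1 < r) (hκ : 0 < κ) :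
    Summable fun j : ℕ => A ^ j * Real.exp (-(κ * r ^ j)) := by
  obtain ⟨m, hm⟩ := pow_unbounded_of_one_lt A hr
  have hrm : 0 < r ^ m := by positivity
  refine Summable.of_nonneg_of_le (fun j => by positivity)
    (f := fun j : ℕ => (m.factorial / κ ^ m) * (A / r ^ m) ^ j) (fun j => ?_) ?_
  · have hx : 0 < κ * r ^ j := by positivity
    have h := Real.pow_div_factorial_le_exp (κ * r ^ j) hx.le m
    have h2 : Real.exp (-(κ * r ^ j)) ≤ m.factorial / (κ * r ^ j) ^ m := by
      rw [Real.exp_neg, inv_le_comm₀ (Real.exp_pos _) (by positivity), inv_div]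
      exact h
    calc A ^ j * Real.exp (-(κ * r ^ j)) ≤ A ^ j * (m.factorial / (κ * r ^ j) ^ m) := by gcongr
      _ = _ := by
        rw [mul_pow, div_pow, ← pow_mul, ← pow_mul, mul_comm j m]
        field_simp
  · exact (summable_geometric_of_lt_one (by positivity) ((div_lt_one hrm).2 hm)).mul_left _

lemma freqDot_sub_le (k : ℤ × ℤ) (x x' : Plane) {B r : ℝ} (h1 : |(k.1 : ℝ)| ≤ B)
    (h2 : |(k.2 : ℝ)| ≤ B) (hr : ∀ i, |x i - x' i| ≤ r) :
    |freqDot k x - freqDot k x'| ≤ 2 * B * r := by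
  have hB : 0 ≤ B := (abs_nonneg _).trans h1
  have e : freqDot k x - freqDot k x' = k.1 * (x 0 - x' 0) + k.2 * (x 1 - x' 1) := by
    unfold freqDot; ring
  rw [e]
  calc |(k.1 : ℝ) * (x 0 - x' 0) + k.2 * (x 1 - x' 1)|
      ≤ |(k.1 : ℝ)| * |x 0 - x' 0| + |(k.2 : ℝ)| * |x 1 - x' 1| := by
        rw [← abs_mul, ← abs_mul]; exact abs_add_le _ _
    _ ≤ B * r + B * r := by gcongr <;> exact hr _
    _ = _ := by ring

lemma abs_cos_sub_cos_le (a b : ℝ) : |Real.cos a - Real.cos b| ≤ |a - b| := by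
  have h := Real.lipschitzWith_cos.dist_le_mul a b
  simpa [Real.dist_eq] using h

/-- The grid point `(2π a / N, 2π b / N)`. -/
noncomputable def gridPoint (N : ℕ) (p : ℕ × ℕ) : Plane :=
  !₂[2 * Real.pi * p.1 / N, 2 * Real.pi * p.2 / N]

lemma exists_near_grid {N : ℕ} (hN : 0 < N) (t : ℝ) :
    ∃ a ∈ Finset.range N, ∃ s : ℝ, (∃ m : ℤ, t = s + m * (2 * Real.pi)) ∧
      |s - 2 * Real.pi * a / N| ≤ 2 * Real.pi / N := by
  have hpi := Real.two_pi_pos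
  have hN' : (0 : ℝ) < N := by exact_mod_cast hN
  set s := toIcoMod hpi 0 t with hs
  have hmem := toIcoMod_mem_Ico hpi 0 t
  rw [← hs, zero_add] at hmem
  have h0 : 0 ≤ s * N / (2 * Real.pi) := by have := hmem.1; positivity
  have hlt : s * N / (2 * Real.pi) < N := by
    rw [div_lt_iff₀ hpi, mul_comm (N : ℝ)]; exact mul_lt_mul_of_pos_right hmem.2 hN'
  refine ⟨⌊s * N / (2 * Real.pi)⌋₊, Finset.mem_range.2 ((Nat.floor_lt h0).2 hlt), s,
    ⟨toIcoDiv hpi 0 t, ?_⟩, ?_⟩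
  · have := toIcoMod_add_toIcoDiv_zsmul hpi 0 t
    rw [zsmul_eq_mul] at this
    exact this.symm
  · have h1 := Nat.floor_le h0
    have h2 := Nat.lt_floor_add_one (s * N / (2 * Real.pi))
    set f : ℝ := (⌊s * N / (2 * Real.pi)⌋₊ : ℝ)
    rw [le_div_iff₀ hpi] at h1
    rw [div_lt_iff₀ hpi] at h2
    have e : s - 2 * Real.pi * f / N = (s * N - f * (2 * Real.pi)) / N := by field_simp
    rw [e, abs_div, abs_of_pos hN', abs_of_nonneg (by linarith)]
    gcongr
    linarith

lemma exists_near_gridPoint {N : ℕ} (hN : 0 < N) (x : Plane) :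
    ∃ p ∈ Finset.range N ×ˢ Finset.range N, ∃ x' : Plane,
      (∀ (k : ℤ × ℤ) (θ : ℝ), Real.cos (freqDot k x + θ) = Real.cos (freqDot k x' + θ)) ∧
      ∀ i, |x' i - gridPoint N p i| ≤ 2 * Real.pi / N := by
  obtain ⟨a, ha, s, ⟨m, hm⟩, hs⟩ := exists_near_grid hN (x 0)
  obtain ⟨b, hb, t, ⟨n, hn⟩, ht⟩ := exists_near_grid hN (x 1)
  refine ⟨(a, b), Finset.mem_product.2 ⟨ha, hb⟩, !₂[s, t], fun k θ => ?_, fun i => ?_⟩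
  · have : freqDot k x + θ = (freqDot k !₂[s, t] + θ) + ((k.1 * m + k.2 * n : ℤ) : ℝ) *
        (2 * Real.pi) := by
      simp only [freqDot, hm, hn, Matrix.cons_val_zero, Matrix.cons_val_one]
      push_cast; ring
    rw [this, Real.cos_add_int_mul_two_pi]
  · fin_cases i
    · simpa [gridPoint] using hs
    · simpa [gridPoint] using ht

/-- A trigonometric sum over the `j`-th shell whose coefficients and whose values on a grid of mesh
of order `8 ^ (-j)` are bounded by `ε` is bounded by `2 ε`. -/
lemma abs_sum_freqShell_le_of_grid {j : ℕ} {b θ : ℤ × ℤ → ℝ} {ε : ℝ} (hε : 0 ≤ ε)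
    (hb : ∀ k ∈ freqShell j, |b k| ≤ ε)
    (hgrid : ∀ p ∈ Finset.range (600 * 8 ^ j) ×ˢ Finset.range (600 * 8 ^ j),
      |∑ k ∈ freqShell j, b k * Real.cos (freqDot k (gridPoint (600 * 8 ^ j) p) + θ k)| ≤ ε)
    (x : Plane) :
    |∑ k ∈ freqShell j, b k * Real.cos (freqDot k x + θ k)| ≤ 2 * ε := by
  obtain ⟨p, hp, x', hx', hnear⟩ := exists_near_gridPoint (N := 600 * 8 ^ j) (by positivity) x
  have hgp := hgrid p hp
  set g := gridPoint (600 * 8 ^ j) p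
  have hdiff : |∑ k ∈ freqShell j, b k * Real.cos (freqDot k x' + θ k)
      - ∑ k ∈ freqShell j, b k * Real.cos (freqDot k g + θ k)| ≤ ε := by
    rw [← Finset.sum_sub_distrib]
    calc _ ≤ ∑ k ∈ freqShell j, |b k * Real.cos (freqDot k x' + θ k) -
            b k * Real.cos (freqDot k g + θ k)| :=
          Finset.abs_sum_le_sum_abs _ _
      _ ≤ ∑ k ∈ freqShell j, ε * (2 * (2 * 2 ^ j) * (2 * Real.pi / (600 * 8 ^ j : ℕ))) := by
          refine Finset.sum_le_sum fun k hk => ?_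
          rw [← mul_sub, abs_mul]
          obtain ⟨b1, b2⟩ := abs_le_of_mem_freqShell hk
          refine mul_le_mul (hb k hk) ?_ (abs_nonneg _) hε
          refine (abs_cos_sub_cos_le _ _).trans ?_
          rw [add_sub_add_right_eq_sub]
          exact freqDot_sub_le k _ _ b1 b2 hnear
      _ = (freqShell j).card * (ε * (2 * (2 * 2 ^ j) * (2 * Real.pi / (600 * 8 ^ j : ℕ)))) := by
          rw [Finset.sum_const, nsmul_eq_mul]
      _ ≤ (16 * 4 ^ j) * (ε * (2 * (2 * 2 ^ j) * (2 * Real.pi / (600 * 8 ^ j : ℕ)))) := by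
          have := Real.pi_pos
          gcongr
          exact card_freqShell_le j
      _ = ε * (128 * Real.pi / 600) := by
          have h8 : (8 : ℝ) ^ j = 4 ^ j * 2 ^ j := by rw [← mul_pow]; norm_num
          push_cast
          rw [h8]
          field_simp
          ring
      _ ≤ _ := by
          refine mul_le_of_le_one_right hε ?_
          have := Real.pi_lt_four
          linarith
  have e : ∑ k ∈ freqShell j, b k * Real.cos (freqDot k x + θ k) =
      ∑ k ∈ freqShell j, b k * Real.cos (freqDot k x' + θ k) :=
    Finset.sum_congr rfl fun k _ => by rw [hx']
  rw [e]
  have htri := abs_sub_abs_le_abs_sub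
    (∑ k ∈ freqShell j, b k * Real.cos (freqDot k x' + θ k))
    (∑ k ∈ freqShell j, b k * Real.cos (freqDot k g + θ k))
  linarith

namespace IsGaussianFourier

variable {Ω : Type*} [MeasurableSpace Ω] {P : Measure Ω} {H : ℝ} {Z : ℤ × ℤ → Ω → ℝ}
  {q : ℤ × ℤ → ℝ} {c C : ℝ}

/-- A trigonometric sum over the `j`-th shell with variance `O (2 ^ (-2 ρ j))` is uniformly
`O (2 ^ (-β j))` almost surely, for `β < ρ`: the bound holds on a grid of mesh `8 ^ (-j)` and for
each coefficient by the Gaussian tail, and a crude Lipschitz bound fills the grid. -/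
lemma ae_exists_sup_bound (hZ : IsGaussianFourier P H Z q c C) (a θ : ℤ × ℤ → ℝ) {ρ β D : ℝ}
    (hβ : β < ρ)
    (hvar : ∀ j : ℕ, ∑ k ∈ freqShell j, a k ^ 2 * q k ≤ D * (2 : ℝ) ^ (-(2 * ρ) * j)) :
    ∀ᵐ ω ∂P, ∃ K : ℝ, 0 ≤ K ∧ ∀ (j : ℕ) (x : Plane),
      |∑ k ∈ freqShell j, a k * Z k ω * Real.cos (freqDot k x + θ k)|
        ≤ K * (2 : ℝ) ^ (-β * j) := by
  have hP := hZ.isProbabilityMeasure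
  wlog hD : 0 < D generalizing D
  · refine this (D := max D 1) (fun j => (hvar j).trans ?_) (by positivity)
    gcongr
    exact le_max_left _ _
  set Y : ℕ → Plane → Ω → ℝ := fun j x ω =>
    ∑ k ∈ freqShell j, a k * Z k ω * Real.cos (freqDot k x + θ k) with hY
  set N : ℕ → ℕ := fun j => 600 * 8 ^ j with hN
  set V : ℕ → ℝ≥0 := fun j => (D * (2 : ℝ) ^ (-(2 * ρ) * j)).toNNReal with hV
  have hVcoe : ∀ j, (V j : ℝ) = D * (2 : ℝ) ^ (-(2 * ρ) * j) := fun j =>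
    Real.coe_toNNReal _ (by positivity)
  set bad : ℕ → Set Ω := fun j =>
    (⋃ k ∈ freqShell j, {ω | (2 : ℝ) ^ (-β * j) ≤ |a k * Z k ω|}) ∪
    ⋃ p ∈ Finset.range (N j) ×ˢ Finset.range (N j),
      {ω | (2 : ℝ) ^ (-β * j) ≤ |Y j (gridPoint (N j) p) ω|} with hbad
  set τ : ℕ → ℝ := fun j => 2 * Real.exp (-(1 / (2 * D) * ((2 : ℝ) ^ (2 * (ρ - β))) ^ j)) with hτ
  -- the ratio of squared threshold to variance grows like `2 ^ (2 (ρ - β) j)`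
  have htail : ∀ (j : ℕ) (X : Ω → ℝ) (v : ℝ), v ≤ D * (2 : ℝ) ^ (-(2 * ρ) * j) →
      HasLaw X (gaussianReal 0 v.toNNReal) P →
      P {ω | (2 : ℝ) ^ (-β * j) ≤ |X ω|} ≤ ENNReal.ofReal (τ j) := by
    intro j X v hv hX
    refine (gaussian_tail_le hX (Real.toNNReal_le_toNNReal hv) (by positivity)).trans (le_of_eq ?_)
    simp only [hτ]
    congr 3
    change _ / (2 * (V j : ℝ)) = _
    rw [hVcoe]
    have e : ((2 : ℝ) ^ (-β * j)) ^ 2 =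
        (2 : ℝ) ^ (-(2 * ρ) * j) * ((2 : ℝ) ^ (2 * (ρ - β))) ^ j := by
      rw [← Real.rpow_natCast, ← Real.rpow_natCast, ← Real.rpow_mul (by norm_num),
        ← Real.rpow_mul (by norm_num), ← Real.rpow_add (by norm_num)]
      congr 1; push_cast; ring
    rw [e]
    have : (2 : ℝ) ^ (-(2 * ρ) * j) ≠ 0 := by positivity
    field_simp
  have hcoef : ∀ j, ∀ k ∈ freqShell j,
      P {ω | (2 : ℝ) ^ (-β * j) ≤ |a k * Z k ω|} ≤ ENNReal.ofReal (τ j) := by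
    intro j k hk
    have h := hZ.law {k} a
    simp only [Finset.sum_singleton] at h
    refine htail j _ _ (le_trans ?_ (hvar j)) h
    exact Finset.single_le_sum (f := fun k => a k ^ 2 * q k)
      (fun i _ => mul_nonneg (sq_nonneg _) (hZ.var_nonneg i)) hk
  have hgrid : ∀ (j : ℕ) (x : Plane), P {ω | (2 : ℝ) ^ (-β * j) ≤ |Y j x ω|} ≤ ENNReal.ofReal (τ j) := by
    intro j x
    have h := hZ.law (freqShell j) (fun k => a k * Real.cos (freqDot k x + θ k))
    have e : Y j x = fun ω => ∑ k ∈ freqShell j, a k * Real.cos (freqDot k x + θ k) * Z k ω := by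
      funext ω
      exact Finset.sum_congr rfl fun k _ => by ring
    rw [← e] at h
    refine htail j _ _ (le_trans ?_ (hvar j)) h
    refine Finset.sum_le_sum fun k _ => ?_
    rw [mul_pow]
    have h1 := Real.cos_sq_le_one (freqDot k x + θ k)
    exact mul_le_mul_of_nonneg_right (mul_le_of_le_one_right (sq_nonneg _) h1) (hZ.var_nonneg k)
  -- `360000 * 64 ^ j` grid points and at most `16 * 4 ^ j` coefficients
  have hbadP : ∀ j, P (bad j) ≤ ENNReal.ofReal (400000 * 64 ^ j * τ j) := by
    intro j
    have hτ0 : 0 ≤ τ j := by simp only [hτ]; positivity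
    have h1 : P (⋃ k ∈ freqShell j, {ω | (2 : ℝ) ^ (-β * j) ≤ |a k * Z k ω|}) ≤
        ENNReal.ofReal ((freqShell j).card * τ j) := by
      refine (measure_biUnion_finset_le _ _).trans ((Finset.sum_le_sum (hcoef j)).trans ?_)
      rw [Finset.sum_const, nsmul_eq_mul, ENNReal.ofReal_mul (Nat.cast_nonneg _),
        ENNReal.ofReal_natCast]
    have h2 : P (⋃ p ∈ Finset.range (N j) ×ˢ Finset.range (N j),
        {ω | (2 : ℝ) ^ (-β * j) ≤ |Y j (gridPoint (N j) p) ω|}) ≤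
        ENNReal.ofReal ((N j * N j : ℕ) * τ j) := by
      refine (measure_biUnion_finset_le _ _).trans ((Finset.sum_le_sum
        (fun p _ => hgrid j _)).trans ?_)
      rw [Finset.sum_const, nsmul_eq_mul, ENNReal.ofReal_mul (Nat.cast_nonneg _),
        ENNReal.ofReal_natCast, Finset.card_product, Finset.card_range]
    refine (measure_union_le _ _).trans ((add_le_add h1 h2).trans ?_)
    rw [← ENNReal.ofReal_add (by positivity) (by positivity), ← add_mul]
    refine ENNReal.ofReal_le_ofReal (mul_le_mul_of_nonneg_right ?_ hτ0)
    have hc := card_freqShell_le j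
    have h48 : (4 : ℝ) ^ j ≤ 64 ^ j := pow_le_pow_left₀ (by norm_num) (by norm_num) j
    have h64 : ((8 : ℝ) ^ j) * 8 ^ j = 64 ^ j := by rw [← mul_pow]; norm_num
    have hNN : ((N j * N j : ℕ) : ℝ) = 360000 * 64 ^ j := by
      simp only [hN]
      push_cast
      rw [← h64]; ring
    rw [hNN]
    linarith
  have hsum : ∑' j, P (bad j) ≠ ∞ := by
    have hs : Summable fun j => 400000 * 64 ^ j * τ j := by
      have h := (summable_pow_mul_exp_neg (A := 64) (r := (2 : ℝ) ^ (2 * (ρ - β)))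
        (κ := 1 / (2 * D)) (by norm_num)
        (Real.one_lt_rpow (by norm_num) (by linarith)) (by positivity)).mul_left 800000
      refine h.congr fun j => ?_
      simp only [hτ]; ring
    refine ne_top_of_le_ne_top ?_ (ENNReal.tsum_le_tsum hbadP)
    rw [← ENNReal.ofReal_tsum_of_nonneg (fun j => by simp only [hτ]; positivity) hs]
    exact ENNReal.ofReal_ne_top
  filter_upwards [ae_eventually_notMem hsum] with ω hω
  obtain ⟨J, hJ⟩ := Filter.eventually_atTop.1 hω
  set M : ℕ → ℝ := fun j => (∑ k ∈ freqShell j, |a k * Z k ω|) / (2 : ℝ) ^ (-β * j) with hM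
  have hM0 : ∀ j, 0 ≤ M j := fun j => by simp only [hM]; positivity
  -- Borel–Cantelli leaves finitely many shells, which are bounded by their own coefficient sums
  refine ⟨2 + ∑ j ∈ Finset.range J, M j, by positivity, fun j x => ?_⟩
  have h2pos : (0 : ℝ) < (2 : ℝ) ^ (-β * j) := by positivity
  rcases lt_or_ge j J with hjJ | hjJ
  · calc |∑ k ∈ freqShell j, a k * Z k ω * Real.cos (freqDot k x + θ k)|
        ≤ ∑ k ∈ freqShell j, |a k * Z k ω| := by
          refine (Finset.abs_sum_le_sum_abs _ _).trans (Finset.sum_le_sum fun k _ => ?_)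
          rw [abs_mul]
          exact mul_le_of_le_one_right (abs_nonneg _) (Real.abs_cos_le_one _)
      _ = M j * (2 : ℝ) ^ (-β * j) := by simp only [hM]; field_simp
      _ ≤ _ := by
          refine mul_le_mul_of_nonneg_right ?_ h2pos.le
          have := Finset.single_le_sum (fun i _ => hM0 i) (Finset.mem_range.2 hjJ)
          linarith
  · have hnot := hJ j hjJ
    simp only [hbad, Set.mem_union, Set.mem_iUnion, Set.mem_ofPred_eq, not_or, not_exists,
      not_le] at hnot
    obtain ⟨hn1, hn2⟩ := hnot
    have hsum0 : 0 ≤ ∑ j ∈ Finset.range J, M j := Finset.sum_nonneg fun i _ => hM0 i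
    refine (abs_sum_freqShell_le_of_grid h2pos.le (fun k hk => (hn1 k hk).le)
      (fun p hp => (hn2 p hp).le) x).trans ?_
    exact mul_le_mul_of_nonneg_right (by linarith) h2pos.le

end IsGaussianFourier

/-! ### The random field and its Hölder regularity -/

section Field

variable {Ω : Type*} [MeasurableSpace Ω] {P : Measure Ω} {H : ℝ} {Z : ℤ × ℤ → Ω → ℝ}
  {q : ℤ × ℤ → ℝ} {c C : ℝ}

/-- The contribution of the `j`-th shell to the field with Fourier coefficients `z`. -/
noncomputable def shellField (z : ℤ × ℤ → ℝ) (j : ℕ) (x : Plane) : ℝ :=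
  ∑ k ∈ freqShell j, z k * fourierMode k x

/-- The field `∑ z_k e_k`, summed shell by shell. The limit is written as a `limsup`, which keeps
the dependence on the coefficients measurable without any convergence assumption. -/
noncomputable def trigField (z : ℤ × ℤ → ℝ) (x : Plane) : ℝ :=
  Filter.limsup (fun N => ∑ j ∈ Finset.range N, shellField z j x) Filter.atTop

lemma continuous_shellField (z : ℤ × ℤ → ℝ) (j : ℕ) : Continuous (shellField z j) := by
  unfold shellField
  exact continuous_finsetSum _ fun k _ => continuous_const.mul (continuous_fourierMode k)

lemma measurable_trigField (hZ : ∀ k, Measurable (Z k)) :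
    Measurable fun p : Ω × Plane => trigField (fun k => Z k p.1) p.2 := by
  unfold trigField
  refine Measurable.limsup fun N => ?_
  refine Finset.measurable_fun_sum _ fun j _ => ?_
  unfold shellField
  refine Finset.measurable_fun_sum _ fun k _ => ?_
  exact ((hZ k).comp measurable_fst).mul
    ((continuous_fourierMode k).measurable.comp measurable_snd)

/-- Quantitative control of the shells: with exponent `β`, they decay like `2 ^ (-β j)` and have
Lipschitz constants of order `2 ^ ((1 - β) j)`. -/
structure HasShellBound (z : ℤ × ℤ → ℝ) (β K : ℝ) : Prop where
  nonneg : 0 ≤ K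
  abs_le : ∀ (j : ℕ) (x : Plane), |shellField z j x| ≤ K * (2 : ℝ) ^ (-β * j)
  lipschitz : ∀ (j : ℕ) (x x' : Plane),
    |shellField z j x - shellField z j x'| ≤ K * (2 : ℝ) ^ ((1 - β) * j) * dist x x'

lemma sqrt_two_div_two_pi_sq_le : (Real.sqrt 2 / (2 * Real.pi)) ^ 2 ≤ 1 := by
  rw [div_pow, Real.sq_sqrt (by norm_num), div_le_one (by positivity)]
  nlinarith [Real.pi_gt_three]

lemma abs_apply_sub_le_dist (x x' : Plane) (i : Fin 2) : |x i - x' i| ≤ dist x x' := by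
  rw [dist_eq_norm]
  exact PiLp.norm_apply_le (x - x') i

/-- A bound for both partial derivatives of a shell is a Lipschitz bound. -/
lemma abs_shellField_sub_le {z : ℤ × ℤ → ℝ} {j : ℕ} {B : ℝ}
    (h1 : ∀ x : Plane, |∑ k ∈ freqShell j, Real.sqrt 2 / (2 * Real.pi) * k.1 * z k *
      Real.cos (freqDot k x + (modePhase k + Real.pi / 2))| ≤ B)
    (h2 : ∀ x : Plane, |∑ k ∈ freqShell j, Real.sqrt 2 / (2 * Real.pi) * k.2 * z k *
      Real.cos (freqDot k x + (modePhase k + Real.pi / 2))| ≤ B) (x x' : Plane) :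
    |shellField z j x - shellField z j x'| ≤ 2 * B * dist x x' := by
  have hB : 0 ≤ B := (abs_nonneg _).trans (h1 0)
  set f : ℝ → ℝ := fun t => shellField z j (x' + t • (x - x')) with hf
  set f' : ℝ → ℝ := fun t =>
    (x 0 - x' 0) * (∑ k ∈ freqShell j, Real.sqrt 2 / (2 * Real.pi) * k.1 * z k *
      Real.cos (freqDot k (x' + t • (x - x')) + (modePhase k + Real.pi / 2))) +
    (x 1 - x' 1) * (∑ k ∈ freqShell j, Real.sqrt 2 / (2 * Real.pi) * k.2 * z k *
      Real.cos (freqDot k (x' + t • (x - x')) + (modePhase k + Real.pi / 2))) with hf'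
  have hderiv : ∀ t, HasDerivAt f (f' t) t := by
    intro t
    have hk : ∀ k ∈ freqShell j, HasDerivAt
        (fun t => z k * fourierMode k (x' + t • (x - x')))
        (z k * (Real.sqrt 2 / (2 * Real.pi) *
          (Real.cos (freqDot k (x' + t • (x - x')) + (modePhase k + Real.pi / 2)) *
            (k.1 * (x 0 - x' 0) + k.2 * (x 1 - x' 1))))) t := by
      intro k _
      simp_rw [fourierMode_eq_cos]
      refine HasDerivAt.const_mul _ (HasDerivAt.const_mul _ ?_)
      have e : (fun t : ℝ => freqDot k (x' + t • (x - x')) + modePhase k) = fun t : ℝ =>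
          t * (k.1 * (x 0 - x' 0) + k.2 * (x 1 - x' 1)) + (freqDot k x' + modePhase k) := by
        funext t
        simp only [freqDot, PiLp.add_apply, PiLp.smul_apply, PiLp.sub_apply, smul_eq_mul]
        ring
      have hlin : HasDerivAt (fun t : ℝ => freqDot k (x' + t • (x - x')) + modePhase k)
          (k.1 * (x 0 - x' 0) + k.2 * (x 1 - x' 1)) t := by
        rw [e]
        simpa using ((hasDerivAt_id t).mul_const
          (k.1 * (x 0 - x' 0) + k.2 * (x 1 - x' 1))).add_const (freqDot k x' + modePhase k)
      have := hlin.cos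
      rw [← add_assoc, Real.cos_add_pi_div_two]
      exact this
    have h := HasDerivAt.fun_sum hk
    refine h.congr_deriv ?_
    simp only [hf', Finset.mul_sum]
    rw [← Finset.sum_add_distrib]
    exact Finset.sum_congr rfl fun k _ => by ring
  have hbound : ∀ t, ‖f' t‖ ≤ 2 * B * dist x x' := by
    intro t
    rw [Real.norm_eq_abs]
    simp only [hf']
    refine (abs_add_le _ _).trans ?_
    rw [abs_mul, abs_mul]
    have a0 := mul_le_mul (abs_apply_sub_le_dist x x' 0) (h1 (x' + t • (x - x')))
      (abs_nonneg _) dist_nonneg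
    have a1 := mul_le_mul (abs_apply_sub_le_dist x x' 1) (h2 (x' + t • (x - x')))
      (abs_nonneg _) dist_nonneg
    linarith
  have h := norm_image_sub_le_of_norm_deriv_le_segment_01' (f := f) (f' := f')
    (fun t _ => (hderiv t).hasDerivWithinAt) (fun t _ => hbound t)
  simpa [hf] using h

namespace IsGaussianFourier

lemma ae_exists_hasShellBound (hZ : IsGaussianFourier P H Z q c C) {β : ℝ} (hβ : β < H) :
    ∀ᵐ ω ∂P, ∃ K, HasShellBound (fun k => Z k ω) β K := by
  set c₀ := Real.sqrt 2 / (2 * Real.pi) with hc₀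
  have hc₀1 : c₀ ^ 2 ≤ 1 := sqrt_two_div_two_pi_sq_le
  have hC := hZ.C_pos
  have hv0 : ∀ j : ℕ, ∑ k ∈ freqShell j, c₀ ^ 2 * q k ≤ 16 * C * 1 * (2 : ℝ) ^ (-(2 * H) * j) :=
    fun j => hZ.sum_freqShell_le zero_le_one fun k _ => hc₀1
  have hpow : ∀ (j : ℕ) (b : ℝ), |b| ≤ 2 * 2 ^ j → (c₀ * b) ^ 2 ≤ 4 * 4 ^ j := by
    intro j b hb
    rw [mul_pow]
    have h1 : b ^ 2 ≤ 4 * 4 ^ j := by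
      rw [← sq_abs]
      calc |b| ^ 2 ≤ (2 * 2 ^ j) ^ 2 := by gcongr
        _ = 4 * 4 ^ j := by rw [mul_pow, ← pow_mul, mul_comm j 2, pow_mul]; norm_num
    calc c₀ ^ 2 * b ^ 2 ≤ 1 * (4 * 4 ^ j) := by gcongr
      _ = _ := one_mul _
  have hexp : ∀ j : ℕ, 16 * C * (4 * 4 ^ j) * (2 : ℝ) ^ (-(2 * H) * j) =
      64 * C * (2 : ℝ) ^ (-(2 * (H - 1)) * j) := by
    intro j
    have : (2 : ℝ) ^ (-(2 * (H - 1)) * j) = 4 ^ j * (2 : ℝ) ^ (-(2 * H) * j) := by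
      rw [show (4 : ℝ) = 2 ^ (2 : ℝ) by norm_num, ← Real.rpow_natCast, ← Real.rpow_mul (by norm_num),
        ← Real.rpow_add (by norm_num)]
      congr 1; ring
    rw [this]; ring
  -- a derivative multiplies the amplitudes in the `j`-th shell by at most `2 ^ (j + 1)`, which lowers
  -- the regularity index from `H` to `H - 1`
  have hv1 : ∀ j : ℕ, ∑ k ∈ freqShell j, (c₀ * k.1) ^ 2 * q k ≤
      64 * C * (2 : ℝ) ^ (-(2 * (H - 1)) * j) := fun j => by
    rw [← hexp]
    exact hZ.sum_freqShell_le (by positivity) fun k hk => hpow j _ (abs_le_of_mem_freqShell hk).1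
  have hv2 : ∀ j : ℕ, ∑ k ∈ freqShell j, (c₀ * k.2) ^ 2 * q k ≤
      64 * C * (2 : ℝ) ^ (-(2 * (H - 1)) * j) := fun j => by
    rw [← hexp]
    exact hZ.sum_freqShell_le (by positivity) fun k hk => hpow j _ (abs_le_of_mem_freqShell hk).2
  filter_upwards [hZ.ae_exists_sup_bound (fun _ => c₀) modePhase hβ hv0,
    hZ.ae_exists_sup_bound (fun k => c₀ * k.1) (fun k => modePhase k + Real.pi / 2)
      (sub_lt_sub_right hβ 1) hv1,
    hZ.ae_exists_sup_bound (fun k => c₀ * k.2) (fun k => modePhase k + Real.pi / 2)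
      (sub_lt_sub_right hβ 1) hv2] with ω ⟨K₀, hK₀, h0⟩ ⟨K₁, hK₁, h1⟩ ⟨K₂, hK₂, h2⟩
  refine ⟨max K₀ (2 * max K₁ K₂), ⟨le_max_of_le_left hK₀, fun j x => ?_, fun j x x' => ?_⟩⟩
  · have e : shellField (fun k => Z k ω) j x =
        ∑ k ∈ freqShell j, c₀ * Z k ω * Real.cos (freqDot k x + modePhase k) := by
      unfold shellField
      refine Finset.sum_congr rfl fun k _ => ?_
      rw [fourierMode_eq_cos]; ring
    rw [e]
    refine (h0 j x).trans ?_
    gcongr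
    exact le_max_left _ _
  · have hexp2 : (2 : ℝ) ^ (-(β - 1) * j) = (2 : ℝ) ^ ((1 - β) * j) := by
      congr 1; ring
    have h := abs_shellField_sub_le (z := fun k => Z k ω) (j := j)
      (B := max K₁ K₂ * (2 : ℝ) ^ ((1 - β) * j))
      (fun x => (h1 j x).trans (by rw [hexp2]; gcongr; exact le_max_left _ _))
      (fun x => (h2 j x).trans (by rw [hexp2]; gcongr; exact le_max_right _ _)) x x'
    refine h.trans ?_
    have : 2 * max K₁ K₂ ≤ max K₀ (2 * max K₁ K₂) := le_max_right _ _
    calc 2 * (max K₁ K₂ * (2 : ℝ) ^ ((1 - β) * j)) * dist x x'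
        = (2 * max K₁ K₂) * (2 : ℝ) ^ ((1 - β) * j) * dist x x' := by ring
      _ ≤ _ := by gcongr

end IsGaussianFourier

namespace HasShellBound

variable {z : ℤ × ℤ → ℝ} {β K : ℝ}

lemma summable_bound (hβ : 0 < β) : Summable fun j : ℕ => K * (2 : ℝ) ^ (-β * j) := by
  have : (fun j : ℕ => K * (2 : ℝ) ^ (-β * j)) = fun j : ℕ => K * ((2 : ℝ) ^ (-β)) ^ j := by
    funext j
    rw [Real.rpow_mul (by norm_num), Real.rpow_natCast]
  rw [this]
  refine (summable_geometric_of_lt_one (by positivity) ?_).mul_left _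
  exact Real.rpow_lt_one_of_one_lt_of_neg (by norm_num) (by linarith)

lemma summable_shellField (hz : HasShellBound z β K) (hβ : 0 < β) (x : Plane) :
    Summable fun j => shellField z j x :=
  Summable.of_norm_bounded (summable_bound hβ) fun j => hz.abs_le j x

lemma hasSum (hz : HasShellBound z β K) (hβ : 0 < β) (x : Plane) :
    HasSum (fun j => shellField z j x) (trigField z x) := by
  have h := (hz.summable_shellField hβ x).hasSum
  have e : trigField z x = ∑' j, shellField z j x := h.tendsto_sum_nat.limsup_eq
  rw [e]
  exact h

lemma holder (hz : HasShellBound z β K) (hβ : 0 < β) {s : ℝ} (hs : 0 < s) (hsβ : s < β)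
    (hs1 : s < 1) : ∃ K', 0 ≤ K' ∧ ∀ x x', |trigField z x - trigField z x'| ≤ K' * dist x x' ^ s := by
  have hK := hz.nonneg
  have hsum : Summable fun j : ℕ => 2 * K * (2 : ℝ) ^ (-(β - s) * j) :=
    summable_bound (K := 2 * K) (by linarith)
  refine ⟨∑' j : ℕ, 2 * K * (2 : ℝ) ^ (-(β - s) * j), tsum_nonneg fun j => by positivity,
    fun x x' => ?_⟩
  have hd : 0 ≤ dist x x' := dist_nonneg
  -- interpolate between the sup bound and the Lipschitz bound
  have hj : ∀ j : ℕ, ‖shellField z j x - shellField z j x'‖ ≤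
      2 * K * (2 : ℝ) ^ (-(β - s) * j) * dist x x' ^ s := by
    intro j
    set Δ := |shellField z j x - shellField z j x'|
    have hΔ : 0 ≤ Δ := abs_nonneg _
    have b1 : Δ ≤ 2 * K * (2 : ℝ) ^ (-β * j) := by
      have := hz.abs_le j x
      have := hz.abs_le j x'
      exact (abs_sub _ _).trans (by linarith)
    have b2 : Δ ≤ 2 * K * (2 : ℝ) ^ ((1 - β) * j) * dist x x' := by
      refine (hz.lipschitz j x x').trans ?_
      gcongr
      linarith
    calc Δ = Δ ^ (1 - s) * Δ ^ s := by
          rw [← Real.rpow_add_of_nonneg hΔ (by linarith) hs.le, sub_add_cancel, Real.rpow_one]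
      _ ≤ (2 * K * (2 : ℝ) ^ (-β * j)) ^ (1 - s) *
          (2 * K * (2 : ℝ) ^ ((1 - β) * j) * dist x x') ^ s := by
          have : 0 ≤ 1 - s := by linarith
          gcongr
      _ = ((2 * K) ^ (1 - s) * (2 * K) ^ s) *
          (((2 : ℝ) ^ (-β * j)) ^ (1 - s) * ((2 : ℝ) ^ ((1 - β) * j)) ^ s) * dist x x' ^ s := by
          rw [Real.mul_rpow (x := 2 * K) (y := (2 : ℝ) ^ (-β * j)) (by positivity) (by positivity),
            Real.mul_rpow (y := dist x x') (by positivity) (by positivity),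
            Real.mul_rpow (x := 2 * K) (y := (2 : ℝ) ^ ((1 - β) * j)) (by positivity)
              (by positivity)]
          ring
      _ = _ := by
          rw [← Real.rpow_add_of_nonneg (by positivity) (by linarith) hs.le, sub_add_cancel,
            Real.rpow_one, ← Real.rpow_mul (by norm_num), ← Real.rpow_mul (by norm_num),
            ← Real.rpow_add (by norm_num)]
          congr 3; ring
  have hS := (hz.hasSum hβ x).sub (hz.hasSum hβ x')
  rw [← hS.tsum_eq, ← tsum_mul_right]
  exact tsum_of_norm_bounded (hsum.mul_right _).hasSum hj

lemma continuous (hz : HasShellBound z β K) (hβ : 0 < β) : Continuous (trigField z) := by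
  have e : trigField z = fun x => ∑' j, shellField z j x :=
    funext fun x => (hz.hasSum hβ x).tsum_eq.symm
  rw [e]
  exact continuous_tsum (fun j => continuous_shellField z j) (summable_bound hβ) fun j x =>
    hz.abs_le j x

lemma tendsto_sum_freqBox (hz : HasShellBound z β K) (hβ : 0 < β) (h0 : z 0 = 0) (x : Plane) :
    Filter.Tendsto (fun N => ∑ k ∈ freqBox N, z k * fourierMode k x) Filter.atTop
      (nhds (trigField z x)) := by
  have h := (hz.hasSum hβ x).tendsto_sum_nat
  refine h.congr fun N => ?_
  rw [sum_freqBox, h0, zero_mul, zero_add]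
  rfl

lemma tendsto_integral (hz : HasShellBound z β K) (hβ : 0 < β) (h0 : z 0 = 0) {g : Plane → ℝ}
    (hg : Continuous g) (hg1 : ∀ x, |g x| ≤ 1) :
    Filter.Tendsto (fun N => ∫ x in torus, (∑ k ∈ freqBox N, z k * fourierMode k x) * g x)
      Filter.atTop (nhds (∫ x in torus, trigField z x * g x)) := by
  refine tendsto_integral_of_dominated_convergence
    (fun _ => ∑' j : ℕ, K * (2 : ℝ) ^ (-β * j)) (fun N => ?_) (integrable_const _)
    (fun N => Filter.Eventually.of_forall fun x => ?_)
    (Filter.Eventually.of_forall fun x => (hz.tendsto_sum_freqBox hβ h0 x).mul_const _)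
  · refine Continuous.aestronglyMeasurable (Continuous.mul ?_ hg)
    exact continuous_finsetSum _ fun k _ => continuous_const.mul (continuous_fourierMode k)
  · rw [norm_mul, sum_freqBox, h0, zero_mul, zero_add]
    have hK := hz.nonneg
    refine (mul_le_of_le_one_right (norm_nonneg _) (hg1 x)).trans ?_
    refine (norm_sum_le _ _).trans ?_
    refine (Finset.sum_le_sum fun j _ => hz.abs_le j x).trans ?_
    exact (summable_bound hβ).sum_le_tsum _ fun j _ => by positivity

lemma integral_eq_zero (hz : HasShellBound z β K) (hβ : 0 < β) (h0 : z 0 = 0) :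
    ∫ x in torus, trigField z x = 0 := by
  have h := hz.tendsto_integral hβ h0 (g := fun _ => 1) continuous_const (by simp)
  simp only [mul_one] at h
  refine tendsto_nhds_unique h ?_
  have : ∀ N, ∫ x in torus, ∑ k ∈ freqBox N, z k * fourierMode k x = 0 := by
    intro N
    rw [integral_finsetSum _ fun k _ => ((continuous_fourierMode k).integrable_torus).const_mul _]
    refine Finset.sum_eq_zero fun k _ => ?_
    rw [integral_const_mul]
    rcases eq_or_ne k 0 with rfl | hk
    · rw [h0, zero_mul]
    · rw [integral_fourierMode hk, mul_zero]
  simp_rw [this]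
  exact tendsto_const_nhds

lemma abs_fourierMode_le_one (k : ℤ × ℤ) (x : Plane) : |fourierMode k x| ≤ 1 := by
  rw [fourierMode_eq_cos, abs_mul]
  have h1 : |Real.sqrt 2 / (2 * Real.pi)| ≤ 1 := by
    rw [← sq_le_one_iff_abs_le_one]
    exact sqrt_two_div_two_pi_sq_le
  exact mul_le_one₀ h1 (abs_nonneg _) (Real.abs_cos_le_one _)

lemma integral_mul_fourierMode (hz : HasShellBound z β K) (hβ : 0 < β) (h0 : z 0 = 0) {l : ℤ × ℤ}
    (hl : l ≠ 0) : ∫ x in torus, trigField z x * fourierMode l x = z l := by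
  have h := hz.tendsto_integral hβ h0 (continuous_fourierMode l) (abs_fourierMode_le_one l)
  refine tendsto_nhds_unique h ?_
  have : ∀ N, ∫ x in torus, (∑ k ∈ freqBox N, z k * fourierMode k x) * fourierMode l x =
      if l ∈ freqBox N then z l else 0 := by
    intro N
    simp_rw [Finset.sum_mul, mul_assoc]
    have hint : ∀ k, Integrable (fun x => fourierMode k x * fourierMode l x)
        ((volume : Measure Plane).restrict torus) := fun k =>
      ((continuous_fourierMode k).mul (continuous_fourierMode l)).integrable_torus
    rw [integral_finsetSum _ fun k _ => (hint k).const_mul _]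
    rw [← Finset.sum_ite_eq' (freqBox N) l z]
    refine Finset.sum_congr rfl fun k _ => ?_
    rw [integral_const_mul]
    rcases eq_or_ne k 0 with rfl | hk
    · rw [h0, zero_mul, ite_self]
    · rw [integral_fourierMode_mul hk hl, mul_ite, mul_one, mul_zero]
  simp_rw [this]
  obtain ⟨N, hN⟩ := exists_mem_freqBox l
  refine tendsto_const_nhds.congr' ?_
  filter_upwards [Filter.eventually_ge_atTop N] with M hM
  rw [if_pos (freqBox_mono hM hN)]

lemma fourierMode_periodic (k : ℤ × ℤ) (x : Plane) (i : Fin 2) :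
    fourierMode k (x + EuclideanSpace.single i (2 * Real.pi)) = fourierMode k x := by
  rw [fourierMode_eq_cos, fourierMode_eq_cos]
  have : freqDot k (x + EuclideanSpace.single i (2 * Real.pi)) + modePhase k =
      (freqDot k x + modePhase k) + ((if i = 0 then k.1 else k.2 : ℤ) : ℝ) * (2 * Real.pi) := by
    fin_cases i <;> simp [freqDot] <;> ring
  rw [this, Real.cos_add_int_mul_two_pi]

/-- The random series is a continuous version of the element of `L²_#` with the same Fourier
coefficients. -/
lemma isContinuousVersion (hz : HasShellBound z β K) (hβ : 0 < β) (h0 : z 0 = 0) {u : L2Mean0}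
    (hu : ∀ k, k ≠ 0 → fourierCoeffReal u k = z k) : IsContinuousVersion u (trigField z) where
  continuous := hz.continuous hβ
  periodic x i := by
    unfold trigField shellField
    simp_rw [fourierMode_periodic]
  ae_eq := by
    set w := ((u : L2Mean0) : Lp ℝ 2 ((volume : Measure Plane).restrict torus))
    have hw : MemLp w 2 ((volume : Measure Plane).restrict torus) := Lp.memLp w
    have hwi : Integrable w ((volume : Measure Plane).restrict torus) :=
      hw.integrable (by norm_num)
    have hfi := (hz.continuous hβ).integrable_torus
    have h := ae_eq_zero_of_integral_fourierMode (h := fun x => trigField z x - w x)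
      (hfi.sub hwi) ?_ fun k hk => ?_
    · filter_upwards [h] with x hx
      exact sub_eq_zero.1 hx
    · rw [integral_sub hfi hwi, hz.integral_eq_zero hβ h0, show ∫ x in torus, w x = 0 from u.2,
        sub_zero]
    · simp_rw [sub_mul]
      rw [integral_sub, hz.integral_mul_fourierMode hβ h0 hk, ← hu k hk]
      · exact sub_self _
      · exact ((hz.continuous hβ).mul (continuous_fourierMode k)).integrable_torus
      · exact hwi.mul_bdd (c := 1) (continuous_fourierMode k).aestronglyMeasurable
          (Filter.Eventually.of_forall (abs_fourierMode_le_one k))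

end HasShellBound

/-- The variance of `s X(x) + r X(x')` for the field with coefficient variances `q`. -/
noncomputable def fieldVar (q : ℤ × ℤ → ℝ) (s r : ℝ) (x x' : Plane) : ℝ :=
  ∑' k, (s * fourierMode k x + r * fourierMode k x') ^ 2 * q k

namespace IsGaussianFourier

lemma summable_fieldVar (hZ : IsGaussianFourier P H Z q c C) (s r : ℝ) (x x' : Plane) :
    Summable fun k => (s * fourierMode k x + r * fourierMode k x') ^ 2 * q k := by
  refine Summable.of_nonneg_of_le (fun k => mul_nonneg (sq_nonneg _) (hZ.var_nonneg k))
    (fun k => ?_) (hZ.summable_var.mul_left ((|s| + |r|) ^ 2))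
  refine mul_le_mul_of_nonneg_right ?_ (hZ.var_nonneg k)
  rw [← sq_abs]
  refine pow_le_pow_left₀ (abs_nonneg _) ((abs_add_le _ _).trans ?_) 2
  rw [abs_mul, abs_mul]
  exact add_le_add
    (mul_le_of_le_one_right (abs_nonneg _) (HasShellBound.abs_fourierMode_le_one k x))
    (mul_le_of_le_one_right (abs_nonneg _) (HasShellBound.abs_fourierMode_le_one k x'))

lemma hasLaw_trigField (hZ : IsGaussianFourier P H Z q c C) (s r : ℝ) (x x' : Plane) :
    HasLaw (fun ω => s * trigField (fun k => Z k ω) x + r * trigField (fun k => Z k ω) x')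
      (gaussianReal 0 (fieldVar q s r x x').toNNReal) P := by
  have hP := hZ.isProbabilityMeasure
  refine hasLaw_gaussianReal_of_tendsto (fun N => hZ.law (freqBox N)
    fun k => s * fourierMode k x + r * fourierMode k x') ?_ ?_
  · filter_upwards [hZ.ae_exists_hasShellBound (half_lt_self hZ.H_pos)] with ω ⟨K, hK⟩
    have h0 : (fun k => Z k ω) 0 = 0 := by simp [hZ.coeff_zero]
    have h := ((hK.tendsto_sum_freqBox (half_pos hZ.H_pos) h0 x).const_mul s).add
      ((hK.tendsto_sum_freqBox (half_pos hZ.H_pos) h0 x').const_mul r)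
    refine h.congr fun N => ?_
    rw [Finset.mul_sum, Finset.mul_sum, ← Finset.sum_add_distrib]
    exact Finset.sum_congr rfl fun k _ => by ring
  · refine (continuous_real_toNNReal.tendsto _).comp ?_
    exact (hZ.summable_fieldVar s r x x').hasSum.comp tendsto_freqBox

end IsGaussianFourier

end Field

/-! ### Variance bounds and strong local nondeterminism -/

section Variance

/-- For a displacement `h` there are of order `|h| ^ (-2)` frequencies `k` of length of order
`|h|⁻¹` for which `k · h` stays away from the multiples of `π`. -/
lemma exists_transverse_freqs {a b : ℝ} (ha : |a| ≤ 1 / 2) (hb : |b| ≤ 1 / 2)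
    (hab : a ≠ 0 ∨ b ≠ 0) :
    ∃ (m : ℕ) (F : Finset (ℤ × ℤ)), 0 < m ∧ 2 * m * |a| ≤ 1 ∧ 2 * m * |b| ≤ 1 ∧ F.card = m ^ 2 ∧
      ∀ k ∈ F, 0 < k.2 ∧ freqNorm k ≤ 3 * m ∧ 1 / 2 ≤ |k.1 * a + k.2 * b| ∧
        |k.1 * a + k.2 * b| ≤ 3 / 2 := by
  set M := max |a| |b| with hM
  have hM0 : 0 < M := by
    rcases hab with h | h
    · exact lt_max_of_lt_left (abs_pos.2 h)
    · exact lt_max_of_lt_right (abs_pos.2 h)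
  have hM1 : M ≤ 1 / 2 := max_le ha hb
  set m := ⌊1 / (2 * M)⌋₊ with hm
  have hm1 : 1 ≤ m := by
    rw [hm, Nat.one_le_floor_iff, le_div_iff₀ (by positivity)]; linarith
  have hmM : 2 * m * M ≤ 1 := by
    have := Nat.floor_le (a := 1 / (2 * M)) (by positivity)
    rw [← hm, le_div_iff₀ (by positivity)] at this
    linarith
  have hmM' : 1 / 2 ≤ (m + 1) * M := by
    have := Nat.lt_floor_add_one (1 / (2 * M))
    rw [← hm, div_lt_iff₀ (by positivity)] at this
    linarith
  have hm0 : (0 : ℝ) < m := by exact_mod_cast hm1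
  set I := Finset.Icc (m + 1) (2 * m) ×ˢ Finset.Icc 1 m with hI
  have hIcard : I.card = m ^ 2 := by
    rw [hI, Finset.card_product, Nat.card_Icc, Nat.card_Icc, sq]
    congr 1
    omega
  -- the sign `σ` keeps the two terms of `k · h` from cancelling
  set σ : ℤ := if 0 ≤ a * b then 1 else -1 with hσ
  have hσsq : σ * σ = 1 := by rw [hσ]; split_ifs <;> norm_num
  have hσ0 : σ ≠ 0 := by rintro h; rw [h] at hσsq; simp at hσsq
  have hσabs : |(σ : ℝ)| = 1 := by rw [hσ]; split_ifs <;> simp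
  have hσab : 0 ≤ (σ : ℝ) * (a * b) := by
    rw [hσ]; split_ifs with h
    · simpa using h
    · push Not at h; push_cast; linarith
  have hnorm : ∀ u v : ℕ, u ≤ 2 * m → v ≤ m → ∀ w : ℤ × ℤ,
      ((w.1 : ℝ) ^ 2 + (w.2 : ℝ) ^ 2 = (u : ℝ) ^ 2 + (v : ℝ) ^ 2) → freqNorm w ≤ 3 * m := by
    intro u v hu hv w hw
    unfold freqNorm
    rw [hw]
    have hu' : (u : ℝ) ≤ 2 * m := by exact_mod_cast hu
    have hv' : (v : ℝ) ≤ m := by exact_mod_cast hv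
    refine Real.sqrt_le_iff.2 ⟨by positivity, ?_⟩
    have h1 : (u : ℝ) ^ 2 ≤ (2 * m) ^ 2 := by gcongr
    have h2 : (v : ℝ) ^ 2 ≤ (m : ℝ) ^ 2 := by gcongr
    nlinarith
  have hsq : (σ : ℝ) ^ 2 = 1 := by rw [sq]; exact_mod_cast hσsq
  -- the larger coordinate of `h` is paired with the index in `[m + 1, 2 m]`
  have hrange : ∀ u v : ℕ, m + 1 ≤ u → u ≤ 2 * m → v ≤ m → ∀ A B : ℝ, |A| = M → |B| ≤ M →
      0 ≤ A * B → 1 / 2 ≤ |u * A + v * B| ∧ |u * A + v * B| ≤ 3 / 2 := by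
    intro u v hu1 hu2 hv A B hA hB hAB
    have hu1' : (m : ℝ) + 1 ≤ u := by exact_mod_cast hu1
    have hu2' : (u : ℝ) ≤ 2 * m := by exact_mod_cast hu2
    have hv' : (v : ℝ) ≤ m := by exact_mod_cast hv
    have e : |u * A + v * B| = u * |A| + v * |B| := by
      have hs : 0 ≤ (u * A) * (v * B) := by
        have : (u * A) * (v * B) = (u * v : ℝ) * (A * B) := by ring
        rw [this]; positivity
      have : |(u : ℝ) * A + v * B| = |(u : ℝ) * A| + |v * B| := by
        rcases mul_nonneg_iff.1 hs with ⟨h1, h2⟩ | ⟨h1, h2⟩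
        · rw [abs_of_nonneg h1, abs_of_nonneg h2, abs_of_nonneg (add_nonneg h1 h2)]
        · rw [abs_of_nonpos h1, abs_of_nonpos h2, abs_of_nonpos (add_nonpos h1 h2)]; ring
      rw [this, abs_mul, abs_mul, Nat.abs_cast, Nat.abs_cast]
    rw [e, hA]
    constructor
    · have : 0 ≤ (v : ℝ) * |B| := by positivity
      nlinarith
    · have h1 : (u : ℝ) * M ≤ 2 * m * M := by gcongr
      have h2 : (v : ℝ) * |B| ≤ m * M := by gcongr
      linarith
  rcases le_total |b| |a| with h | h
  · have hMa : |a| = M := (max_eq_left h).symm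
    refine ⟨m, I.image fun p => (σ * p.1, (p.2 : ℤ)), hm1, by rw [hMa]; exact hmM,
      le_trans (by rw [hM]; gcongr; exact le_max_right _ _) hmM, ?_, ?_⟩
    · rw [Finset.card_image_of_injective, hIcard]
      rintro ⟨u, v⟩ ⟨u', v'⟩ huv
      simp only [Prod.mk.injEq] at huv
      have h1 := mul_left_cancel₀ hσ0 huv.1
      exact Prod.ext (by exact_mod_cast h1) (by exact_mod_cast huv.2)
    · intro k hk
      obtain ⟨⟨u, v⟩, huv, rfl⟩ := Finset.mem_image.1 hk
      simp only [hI, Finset.mem_product, Finset.mem_Icc] at huv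
      have hr := hrange u v huv.1.1 huv.1.2 huv.2.2 (σ * a) b (by rw [abs_mul, hσabs, one_mul, hMa])
        (le_max_right _ _) (by linarith)
      refine ⟨by simp only; omega, hnorm u v huv.1.2 huv.2.2 _ ?_, ?_⟩
      · push_cast; rw [mul_pow, hsq, one_mul]
      · push_cast
        rw [show (σ : ℝ) * u * a = u * (σ * a) by ring]
        exact hr
  · have hMb : |b| = M := (max_eq_right h).symm
    refine ⟨m, I.image fun p => (σ * p.2, (p.1 : ℤ)), hm1,
      le_trans (by rw [hM]; gcongr; exact le_max_left _ _) hmM, by rw [hMb]; exact hmM, ?_, ?_⟩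
    · rw [Finset.card_image_of_injective, hIcard]
      rintro ⟨u, v⟩ ⟨u', v'⟩ huv
      simp only [Prod.mk.injEq] at huv
      have h1 := mul_left_cancel₀ hσ0 huv.1
      exact Prod.ext (by exact_mod_cast huv.2) (by exact_mod_cast h1)
    · intro k hk
      obtain ⟨⟨u, v⟩, huv, rfl⟩ := Finset.mem_image.1 hk
      simp only [hI, Finset.mem_product, Finset.mem_Icc] at huv
      have hr := hrange u v huv.1.1 huv.1.2 huv.2.2 b (σ * a) hMb
        (by rw [abs_mul, hσabs, one_mul]; exact le_max_left _ _) (by linarith)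
      refine ⟨by simp only; omega, hnorm u v huv.1.2 huv.2.2 _ ?_, ?_⟩
      · push_cast; rw [mul_pow, hsq, one_mul]; ring
      · push_cast
        rw [show (σ : ℝ) * v * a + u * b = u * b + v * (σ * a) by ring]
        exact hr

lemma one_div_sixteen_le_sin_sq {u : ℝ} (h1 : 1 / 2 ≤ |u|) (h2 : |u| ≤ 3 / 2) :
    1 / 16 ≤ Real.sin u ^ 2 := by
  have hpi := Real.pi_gt_three
  have hpi4 := Real.pi_lt_four
  have h := Real.mul_le_sin (abs_nonneg u) (by linarith)
  have h3 : 1 / 4 ≤ Real.sin |u| := by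
    refine le_trans ?_ h
    rw [div_mul_eq_mul_div, le_div_iff₀ (by linarith)]
    linarith
  have h4 : Real.sin u ^ 2 = Real.sin |u| ^ 2 := by
    rcases abs_cases u with ⟨h, -⟩ | ⟨h, -⟩ <;> rw [h]
    rw [Real.sin_neg]; ring
  rw [h4]
  nlinarith

variable {Ω : Type*} [MeasurableSpace Ω] {P : Measure Ω} {H : ℝ} {Z : ℤ × ℤ → Ω → ℝ}
  {q : ℤ × ℤ → ℝ} {c C : ℝ}

namespace IsGaussianFourier

lemma fieldVar_nonneg (hZ : IsGaussianFourier P H Z q c C) (s r : ℝ) (x x' : Plane) :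
    0 ≤ fieldVar q s r x x' :=
  tsum_nonneg fun k => mul_nonneg (sq_nonneg _) (hZ.var_nonneg k)

/-- The modes `k` and `-k` are the sine and the cosine of the same frequency, so that together they
contribute a translation invariant quantity. -/
lemma le_mode_pair (hZ : IsGaussianFourier P H Z q c C) (s r : ℝ) (x x' : Plane) {k : ℤ × ℤ}
    (hk : 0 < k.2) :
    (Real.sqrt 2 / (2 * Real.pi)) ^ 2 * (c * freqNorm k ^ (-(2 + 2 * H))) *
        (s ^ 2 + r ^ 2 + 2 * s * r * Real.cos (freqDot k x - freqDot k x')) ≤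
      (s * fourierMode k x + r * fourierMode k x') ^ 2 * q k +
      (s * fourierMode (-k) x + r * fourierMode (-k) x') ^ 2 * q (-k) := by
  have hk0 : k ≠ 0 := by rintro rfl; simp at hk
  have l1 := hZ.le_var k hk0
  have l2 := hZ.le_var (-k) (neg_ne_zero.2 hk0)
  rw [freqNorm_neg] at l2
  set L := c * freqNorm k ^ (-(2 + 2 * H))
  have e1 : ∀ x, fourierMode k x = Real.sqrt 2 / (2 * Real.pi) * Real.sin (freqDot k x) := by
    intro x
    unfold fourierMode freqDot
    rw [if_pos (Or.inl hk)]
  have e2 : ∀ x, fourierMode (-k) x = Real.sqrt 2 / (2 * Real.pi) * Real.cos (freqDot k x) := by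
    intro x
    unfold fourierMode freqDot
    rw [if_neg (by simp only [Prod.snd_neg, Prod.fst_neg]; omega)]
    congr 1
    rw [← Real.cos_neg]
    congr 1
    simp only [Prod.snd_neg, Prod.fst_neg]; push_cast; ring
  rw [e1, e1, e2, e2]
  set c₀ := Real.sqrt 2 / (2 * Real.pi)
  set A := freqDot k x
  set B := freqDot k x'
  calc c₀ ^ 2 * L * (s ^ 2 + r ^ 2 + 2 * s * r * Real.cos (A - B))
      = (s * (c₀ * Real.sin A) + r * (c₀ * Real.sin B)) ^ 2 * L +
        (s * (c₀ * Real.cos A) + r * (c₀ * Real.cos B)) ^ 2 * L := by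
        rw [Real.cos_sub]
        linear_combination (-(c₀ ^ 2 * L * s ^ 2)) * Real.sin_sq_add_cos_sq A -
          (c₀ ^ 2 * L * r ^ 2) * Real.sin_sq_add_cos_sq B
    _ ≤ _ := by gcongr

lemma sum_mode_pairs_le (hZ : IsGaussianFourier P H Z q c C) (s r : ℝ) (x x' : Plane)
    (F : Finset (ℤ × ℤ)) :
    ∑ k ∈ F, ((s * fourierMode k x + r * fourierMode k x') ^ 2 * q k +
      (s * fourierMode (-k) x + r * fourierMode (-k) x') ^ 2 * q (-k)) ≤
      2 * fieldVar q s r x x' := by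
  have hs := hZ.summable_fieldVar s r x x'
  have hs' : Summable fun k => (s * fourierMode (-k) x + r * fourierMode (-k) x') ^ 2 * q (-k) :=
    (Equiv.neg (ℤ × ℤ)).summable_iff.2 hs
  have e : ∑' k, (s * fourierMode (-k) x + r * fourierMode (-k) x') ^ 2 * q (-k) =
      fieldVar q s r x x' :=
    (Equiv.neg (ℤ × ℤ)).tsum_eq fun k => (s * fourierMode k x + r * fourierMode k x') ^ 2 * q k
  rw [two_mul]
  nth_rewrite 2 [← e]
  unfold fieldVar
  rw [← hs.tsum_add hs']
  exact (hs.add hs').sum_le_tsum F fun k _ => add_nonneg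
    (mul_nonneg (sq_nonneg _) (hZ.var_nonneg _)) (mul_nonneg (sq_nonneg _) (hZ.var_nonneg _))

lemma exists_le_fieldVar_one (hZ : IsGaussianFourier P H Z q c C) :
    ∃ κ, 0 < κ ∧ ∀ x x', κ ≤ fieldVar q 1 0 x x' := by
  have hk0 : ((0, 1) : ℤ × ℤ) ≠ 0 := by simp
  have hfn := freqNorm_pos hk0
  have hc := hZ.c_pos
  refine ⟨(Real.sqrt 2 / (2 * Real.pi)) ^ 2 * (c * freqNorm (0, 1) ^ (-(2 + 2 * H))) / 2,
    by positivity, fun x x' => ?_⟩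
  have h1 := hZ.le_mode_pair 1 0 x x' (k := (0, 1)) (by simp)
  have h2 := hZ.sum_mode_pairs_le 1 0 x x' {(0, 1)}
  rw [Finset.sum_singleton] at h2
  have h3 := h1.trans h2
  simp only [one_pow, ne_eq, OfNat.ofNat_ne_zero, not_false_eq_true, zero_pow, add_zero, mul_zero,
    zero_mul, mul_one] at h3
  linarith

lemma fieldVar_one_le (hZ : IsGaussianFourier P H Z q c C) (x x' : Plane) :
    fieldVar q 1 0 x x' ≤ ∑' k, q k := by
  refine (hZ.summable_fieldVar 1 0 x x').tsum_le_tsum (fun k => ?_) hZ.summable_var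
  refine mul_le_of_le_one_left (hZ.var_nonneg k) ?_
  rw [one_mul, zero_mul, add_zero, sq_le_one_iff_abs_le_one]
  exact HasShellBound.abs_fourierMode_le_one k x

/-- Conditionally on `X(x)`, the value `X(x')` keeps a variance of order `|x - x'| ^ (2 H)`. -/
lemma exists_le_fieldVar (hZ : IsGaussianFourier P H Z q c C) :
    ∃ κ, 0 < κ ∧ ∀ (ρ : ℝ) (x x' : Plane), x ≠ x' → (∀ i, |x i - x' i| ≤ 1 / 2) →
      κ * dist x x' ^ (2 * H) ≤ fieldVar q (-ρ) 1 x x' := by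
  have hc := hZ.c_pos
  have hH := hZ.H_pos
  set c₀ := Real.sqrt 2 / (2 * Real.pi) with hc₀
  have hc₀0 : 0 < c₀ := by positivity
  refine ⟨c₀ ^ 2 * (c * 3 ^ (-(2 + 2 * H))) * (1 / 16) / 2, by positivity, fun ρ x x' hne hi => ?_⟩
  have hab : x 0 - x' 0 ≠ 0 ∨ x 1 - x' 1 ≠ 0 := by
    by_contra! hcon
    refine hne (PiLp.ext fun i => ?_)
    fin_cases i
    · exact sub_eq_zero.1 hcon.1
    · exact sub_eq_zero.1 hcon.2
  obtain ⟨m, F, hm, ha, hb, hcard, hF⟩ := exists_transverse_freqs (hi 0) (hi 1) hab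
  have hm0 : (0 : ℝ) < m := by exact_mod_cast hm
  have hd : dist x x' ≤ 1 / m := by
    rw [EuclideanSpace.dist_eq, Fin.sum_univ_two, Real.dist_eq, Real.dist_eq]
    refine Real.sqrt_le_iff.2 ⟨by positivity, ?_⟩
    have ha' : |x 0 - x' 0| ≤ 1 / (2 * m) := by rw [le_div_iff₀ (by positivity)]; linarith
    have hb' : |x 1 - x' 1| ≤ 1 / (2 * m) := by rw [le_div_iff₀ (by positivity)]; linarith
    have key : ∀ A B : ℝ, 0 ≤ A → 0 ≤ B → A ≤ 1 / (2 * m) → B ≤ 1 / (2 * m) →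
        A ^ 2 + B ^ 2 ≤ (1 / m : ℝ) ^ 2 := by
      intro A B hA hB hA' hB'
      rw [show 1 / (2 * (m : ℝ)) = (1 / m) / 2 by field_simp] at hA' hB'
      nlinarith [sq_nonneg (1 / (m : ℝ))]
    exact key _ _ (abs_nonneg _) (abs_nonneg _) ha' hb'
  have hdpow : dist x x' ^ (2 * H) ≤ (m : ℝ) ^ (-(2 * H)) := by
    refine (Real.rpow_le_rpow dist_nonneg hd (by positivity)).trans (le_of_eq ?_)
    rw [one_div, Real.inv_rpow hm0.le, Real.rpow_neg hm0.le]
  have hterm : ∀ k ∈ F, c₀ ^ 2 * (c * (3 * m : ℝ) ^ (-(2 + 2 * H))) * (1 / 16) ≤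
      (-ρ * fourierMode k x + 1 * fourierMode k x') ^ 2 * q k +
      (-ρ * fourierMode (-k) x + 1 * fourierMode (-k) x') ^ 2 * q (-k) := by
    intro k hk
    obtain ⟨hk2, hkn, hk3, hk4⟩ := hF k hk
    have hk0 : k ≠ 0 := by rintro rfl; simp at hk2
    refine le_trans ?_ (hZ.le_mode_pair (-ρ) 1 x x' hk2)
    have hfn := freqNorm_pos hk0
    have e : freqDot k x - freqDot k x' = k.1 * (x 0 - x' 0) + k.2 * (x 1 - x' 1) := by
      unfold freqDot; ring
    rw [← e] at hk3 hk4
    have hsin := one_div_sixteen_le_sin_sq hk3 hk4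
    have hpow : (3 * m : ℝ) ^ (-(2 + 2 * H)) ≤ freqNorm k ^ (-(2 + 2 * H)) :=
      Real.rpow_le_rpow_of_nonpos hfn hkn (by linarith)
    -- `1 + ρ ^ 2 - 2 ρ cos φ = (ρ - cos φ) ^ 2 + sin φ ^ 2`
    have hquad : 1 / 16 ≤ (-ρ) ^ 2 + 1 ^ 2 +
        2 * (-ρ) * 1 * Real.cos (freqDot k x - freqDot k x') := by
      nlinarith [sq_nonneg (ρ - Real.cos (freqDot k x - freqDot k x')),
        Real.sin_sq_add_cos_sq (freqDot k x - freqDot k x')]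
    gcongr
  have hsum := (Finset.card_nsmul_le_sum F _ _ hterm).trans (hZ.sum_mode_pairs_le (-ρ) 1 x x' F)
  rw [hcard, nsmul_eq_mul] at hsum
  have e : ((m ^ 2 : ℕ) : ℝ) * (c₀ ^ 2 * (c * (3 * m : ℝ) ^ (-(2 + 2 * H))) * (1 / 16)) =
      c₀ ^ 2 * (c * 3 ^ (-(2 + 2 * H))) * (1 / 16) * (m : ℝ) ^ (-(2 * H)) := by
    have h1 : (m : ℝ) ^ (-(2 * H)) = (m : ℝ) ^ 2 * (m : ℝ) ^ (-(2 + 2 * H)) := by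
      rw [← Real.rpow_natCast (m : ℝ) 2, ← Real.rpow_add hm0]
      congr 1; push_cast; ring
    rw [Real.mul_rpow (by norm_num) hm0.le, h1]
    push_cast; ring
  rw [e] at hsum
  have hfin : c₀ ^ 2 * (c * 3 ^ (-(2 + 2 * H))) * (1 / 16) * dist x x' ^ (2 * H) ≤
      c₀ ^ 2 * (c * 3 ^ (-(2 + 2 * H))) * (1 / 16) * (m : ℝ) ^ (-(2 * H)) := by gcongr
  linarith

/-- Gram–Schmidt for the pair `X(x)`, `X(x')`. -/
lemma exists_fieldVar_decomp (hZ : IsGaussianFourier P H Z q c C) (x x' : Plane) :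
    ∃ ρ : ℝ, ∀ s r : ℝ, fieldVar q (s - r * ρ) r x x' =
      s ^ 2 * fieldVar q 1 0 x x' + r ^ 2 * fieldVar q (-ρ) 1 x x' := by
  obtain ⟨κ, hκ, hle⟩ := hZ.exists_le_fieldVar_one
  have hv : fieldVar q 1 0 x x' ≠ 0 := (hκ.trans_le (hle x x')).ne'
  have s1 := hZ.summable_fieldVar 1 0 x x'
  have s2 := hZ.summable_fieldVar 0 1 x x'
  have s3 := hZ.summable_fieldVar 1 1 x x'
  have sc : Summable fun k => fourierMode k x * fourierMode k x' * q k := by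
    refine (((s3.sub s1).sub s2).mul_left (1 / 2)).congr fun k => ?_
    ring
  set G := ∑' k, fourierMode k x * fourierMode k x' * q k
  have hquad : ∀ a b : ℝ, fieldVar q a b x x' =
      a ^ 2 * fieldVar q 1 0 x x' + b ^ 2 * fieldVar q 0 1 x x' + 2 * a * b * G := by
    intro a b
    have h := ((s1.hasSum.mul_left (a ^ 2)).add (s2.hasSum.mul_left (b ^ 2))).add
      (sc.hasSum.mul_left (2 * a * b))
    refine Eq.trans ?_ h.tsum_eq
    unfold fieldVar
    congr 1; funext k; ring
  refine ⟨G / fieldVar q 1 0 x x', fun s r => ?_⟩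
  rw [hquad (s - r * _), hquad (-_)]
  field_simp
  ring

end IsGaussianFourier

end Variance

/-! ### The upper bound: counting the squares that meet the level set -/

section Upper

/-- Indices of the lattice points `2 ^ (-n-2) ℤ²` in a neighbourhood of the torus. -/
noncomputable def latticeIndex (n : ℕ) : Finset (ℤ × ℤ) :=
  Finset.Icc (-(16 * 2 ^ n)) (16 * 2 ^ n) ×ˢ Finset.Icc (-(16 * 2 ^ n)) (16 * 2 ^ n)

/-- The lattice point `2 ^ (-n-2) p`. -/
noncomputable def latticePoint (n : ℕ) (p : ℤ × ℤ) : Plane :=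
  !₂[p.1 / (4 * 2 ^ n : ℝ), p.2 / (4 * 2 ^ n : ℝ)]

lemma card_latticeIndex_le (n : ℕ) : ((latticeIndex n).card : ℝ) ≤ 1089 * 4 ^ n := by
  have h : (latticeIndex n).card ≤ 1089 * 4 ^ n := by
    rw [latticeIndex, Finset.card_product, Int.card_Icc]
    have : ((16 * 2 ^ n : ℤ) + 1 - -(16 * 2 ^ n)).toNat ≤ 33 * 2 ^ n := by
      rw [Int.toNat_le]; push_cast
      have : (1 : ℤ) ≤ 2 ^ n := one_le_pow₀ (by norm_num)
      linarith
    calc _ ≤ (33 * 2 ^ n) * (33 * 2 ^ n) := Nat.mul_le_mul this this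
      _ = 1089 * 4 ^ n := by rw [show (4 : ℕ) = 2 * 2 from rfl, mul_pow]; ring
  exact_mod_cast h

lemma dist_le_of_abs_sub_le {x x' : Plane} {r : ℝ} (hr : ∀ i, |x i - x' i| ≤ r) :
    dist x x' ≤ 2 * r := by
  have hr0 : 0 ≤ r := (abs_nonneg _).trans (hr 0)
  rw [EuclideanSpace.dist_eq, Fin.sum_univ_two, Real.dist_eq, Real.dist_eq]
  refine Real.sqrt_le_iff.2 ⟨by positivity, ?_⟩
  have key : ∀ A B : ℝ, 0 ≤ A → 0 ≤ B → A ≤ r → B ≤ r → A ^ 2 + B ^ 2 ≤ (2 * r) ^ 2 := by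
    intro A B hA hB hA' hB'
    nlinarith
  exact key _ _ (abs_nonneg _) (abs_nonneg _) (hr 0) (hr 1)

lemma exists_near_lattice (n : ℕ) {t : ℝ} (ht : t ∈ Set.Icc (-Real.pi) Real.pi) :
    ∃ a ∈ Finset.Icc (-(16 * 2 ^ n) : ℤ) (16 * 2 ^ n), |t - a / (4 * 2 ^ n : ℝ)| ≤
      1 / 4 * (1 / 2) ^ n := by
  have hpi := Real.pi_lt_four
  have h2 : (0 : ℝ) < 2 ^ n := by positivity
  refine ⟨⌊t * (4 * 2 ^ n)⌋, Finset.mem_Icc.2 ⟨Int.le_floor.2 ?_, ?_⟩, ?_⟩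
  · push_cast
    nlinarith [ht.1]
  · have : (⌊t * (4 * 2 ^ n)⌋ : ℝ) ≤ 16 * 2 ^ n := by
      refine (Int.floor_le _).trans ?_
      nlinarith [ht.2]
    exact_mod_cast this
  · have h1 := Int.floor_le (t * (4 * 2 ^ n))
    have h3 := Int.lt_floor_add_one (t * (4 * 2 ^ n))
    set f : ℝ := (⌊t * (4 * 2 ^ n)⌋ : ℝ)
    have e : t - f / (4 * 2 ^ n) = (t * (4 * 2 ^ n) - f) / (4 * 2 ^ n) := by field_simp
    rw [e, abs_div, abs_of_nonneg (by linarith), abs_of_pos (by positivity), div_le_iff₀ (by positivity)]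
    rw [div_pow, one_pow]
    field_simp
    linarith

lemma exists_near_latticePoint (n : ℕ) {x : Plane} (hx : x ∈ torus) :
    ∃ p ∈ latticeIndex n, ∀ i, |x i - latticePoint n p i| ≤ 1 / 4 * (1 / 2) ^ n := by
  obtain ⟨a, ha, ha'⟩ := exists_near_lattice n (hx 0)
  obtain ⟨b, hb, hb'⟩ := exists_near_lattice n (hx 1)
  refine ⟨(a, b), Finset.mem_product.2 ⟨ha, hb⟩, fun i => ?_⟩
  fin_cases i
  · simpa [latticePoint] using ha'
  · simpa [latticePoint] using hb'

/-- If a Hölder field is close to `y` at few lattice points, then its level set has small packing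
dimension. -/
lemma dimP_levelSet_le {v : Plane → ℝ} {y d : ℝ} (hd : 0 ≤ d)
    (h : ∀ u, d < u → ∃ s K B : ℝ, 0 ≤ s ∧ 0 ≤ K ∧
      (∀ x x', |v x - v x'| ≤ K * dist x x' ^ s) ∧
      ∀ n : ℕ, (((latticeIndex n).filter fun p =>
        |v (latticePoint n p) - y| ≤ K * (2 : ℝ) ^ (-s * n)).card : ℝ) ≤ B * (2 : ℝ) ^ (n * u)) :
    dimP (levelSet y v) ≤ ENNReal.ofReal d := by
  classical
  refine dimP_le_of_cover hd fun u hu => ?_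
  obtain ⟨s, K, B, hs, hK, hv, hcount⟩ := h u hu
  refine ⟨B, fun n => ?_⟩
  set A := (latticeIndex n).filter fun p => |v (latticePoint n p) - y| ≤ K * (2 : ℝ) ^ (-s * n)
  refine ⟨A.image fun p => {x | ∀ i, |x i - latticePoint n p i| ≤ 1 / 4 * (1 / 2) ^ n}, ?_, ?_, ?_⟩
  · exact le_trans (by exact_mod_cast Finset.card_image_le) (hcount n)
  · rintro x ⟨hxt, hxy⟩
    obtain ⟨p, hp, hxp⟩ := exists_near_latticePoint n hxt
    have hd : dist (latticePoint n p) x ≤ (1 / 2) ^ n := by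
      rw [dist_comm]
      refine (dist_le_of_abs_sub_le hxp).trans ?_
      have : (0 : ℝ) < (1 / 2) ^ n := by positivity
      linarith
    have hpA : p ∈ A := by
      refine Finset.mem_filter.2 ⟨hp, ?_⟩
      rw [← hxy]
      refine (hv _ _).trans ?_
      refine mul_le_mul_of_nonneg_left ((Real.rpow_le_rpow dist_nonneg hd hs).trans (le_of_eq ?_)) hK
      rw [← Real.rpow_natCast, ← Real.rpow_mul (by norm_num), one_div,
        Real.inv_rpow (by norm_num), ← Real.rpow_neg (by norm_num)]
      congr 1; ring
    simp only [Finset.mem_image, Set.mem_iUnion, exists_prop]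
    exact ⟨_, ⟨p, hpA, rfl⟩, hxp⟩
  · intro t ht x hx x' hx'
    obtain ⟨p, -, rfl⟩ := Finset.mem_image.1 ht
    have : ∀ i, |x i - x' i| ≤ 1 / 2 * (1 / 2) ^ n := by
      intro i
      have h1 := hx i
      have h2 := hx' i
      have := abs_sub_le (x i) (latticePoint n p i) (x' i)
      rw [abs_sub_comm (latticePoint n p i)] at this
      linarith
    refine (dist_le_of_abs_sub_le this).trans (le_of_eq ?_)
    ring

variable {Ω : Type*} [MeasurableSpace Ω] {P : Measure Ω} {H : ℝ} {Z : ℤ × ℤ → Ω → ℝ}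
  {q : ℤ × ℤ → ℝ} {c C : ℝ}

namespace IsGaussianFourier

lemma hasLaw_trigField_one (hZ : IsGaussianFourier P H Z q c C) (x : Plane) :
    HasLaw (fun ω => trigField (fun k => Z k ω) x)
      (gaussianReal 0 (fieldVar q 1 0 x x).toNNReal) P := by
  simpa using hZ.hasLaw_trigField 1 0 x x

lemma measurable_trigField_left (hZ : IsGaussianFourier P H Z q c C) (x : Plane) :
    Measurable fun ω => trigField (fun k => Z k ω) x :=
  Measurable.comp (g := fun p : Ω × Plane => trigField (fun k => Z k p.1) p.2)
    (f := fun ω => (ω, x)) (measurable_trigField hZ.measurable) measurable_prodMk_right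

lemma measurableSet_near (hZ : IsGaussianFourier P H Z q c C) (x : Plane) (y η : ℝ) :
    MeasurableSet {ω | |trigField (fun k => Z k ω) x - y| ≤ η} := by
  have := hZ.measurable_trigField_left x
  exact measurableSet_le (by fun_prop) measurable_const

lemma prob_near_eq (hZ : IsGaussianFourier P H Z q c C) (x : Plane) (y η : ℝ) :
    P {ω | |trigField (fun k => Z k ω) x - y| ≤ η} =
      gaussianReal 0 (fieldVar q 1 0 x x).toNNReal (Set.Icc (y - η) (y + η)) := by
  rw [← (hZ.hasLaw_trigField_one x).map_eq,
    Measure.map_apply (hZ.measurable_trigField_left x) measurableSet_Icc]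
  congr 1
  ext ω
  simp only [Set.mem_ofPred_eq, Set.mem_preimage, Set.mem_Icc, abs_le]
  constructor <;> rintro ⟨h1, h2⟩ <;> constructor <;> linarith

lemma exists_prob_near_le (hZ : IsGaussianFourier P H Z q c C) :
    ∃ B : ℝ, 0 < B ∧ ∀ (x : Plane) (y η : ℝ), 0 ≤ η →
      P {ω | |trigField (fun k => Z k ω) x - y| ≤ η} ≤ ENNReal.ofReal (B * η) := by
  obtain ⟨κ, hκ, hle⟩ := hZ.exists_le_fieldVar_one
  have hpi := Real.pi_pos
  refine ⟨(Real.sqrt (2 * Real.pi * κ))⁻¹ * 2, by positivity, fun x y η hη => ?_⟩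
  rw [hZ.prob_near_eq]
  have hv : 0 < fieldVar q 1 0 x x := hκ.trans_le (hle x x)
  refine (gaussianReal_Icc_le (by simpa using hv) _ _).trans ?_
  rw [← ENNReal.ofReal_mul (by positivity), mul_assoc (Real.sqrt (2 * Real.pi * κ))⁻¹, show y + η - (y - η) = 2 * η by ring]
  refine ENNReal.ofReal_le_ofReal ?_
  rw [Real.coe_toNNReal _ hv.le]
  gcongr
  exact hle x x

/-- First moment bound for the number of lattice points where the field is close to `y`. -/
lemma ae_exists_count_le (hZ : IsGaussianFourier P H Z q c C) (y : ℝ) {s u : ℝ} (hsu : 2 - s < u)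
    (K : ℝ) (hK : 0 ≤ K) :
    ∀ᵐ ω ∂P, ∃ B : ℝ, ∀ n : ℕ, (((latticeIndex n).filter fun p =>
      |trigField (fun k => Z k ω) (latticePoint n p) - y| ≤ K * (2 : ℝ) ^ (-s * n)).card : ℝ) ≤
        B * (2 : ℝ) ^ (n * u) := by
  obtain ⟨B₀, hB₀, hprob⟩ := hZ.exists_prob_near_le
  set S : ℕ → ℤ × ℤ → Set Ω := fun n p =>
    {ω | |trigField (fun k => Z k ω) (latticePoint n p) - y| ≤ K * (2 : ℝ) ^ (-s * n)} with hS
  have hSm : ∀ n p, MeasurableSet (S n p) := fun n p => hZ.measurableSet_near _ _ _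
  set G : Ω → ℝ≥0∞ := fun ω => ∑' n : ℕ, ENNReal.ofReal ((2 : ℝ) ^ (-(n * u))) *
    ∑ p ∈ latticeIndex n, (S n p).indicator 1 ω with hG
  have hGm : Measurable G := by
    refine Measurable.tsum fun n => Measurable.const_mul ?_ _
    exact Finset.measurable_fun_sum _ fun p _ => measurable_one.indicator (hSm n p)
  have hterm : ∀ n : ℕ, ∫⁻ ω, ENNReal.ofReal ((2 : ℝ) ^ (-(n * u))) *
      ∑ p ∈ latticeIndex n, (S n p).indicator 1 ω ∂P ≤
      ENNReal.ofReal (1089 * B₀ * K * ((2 : ℝ) ^ (2 - s - u)) ^ n) := by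
    intro n
    rw [lintegral_const_mul _
        (Finset.measurable_fun_sum _ fun p _ => measurable_one.indicator (hSm n p)),
      lintegral_finsetSum _ fun p _ => measurable_one.indicator (hSm n p)]
    have h1 : ∑ p ∈ latticeIndex n, ∫⁻ ω, (S n p).indicator 1 ω ∂P ≤
        ENNReal.ofReal ((1089 * 4 ^ n) * (B₀ * (K * (2 : ℝ) ^ (-s * n)))) := by
      calc _ ≤ ∑ p ∈ latticeIndex n, ENNReal.ofReal (B₀ * (K * (2 : ℝ) ^ (-s * n))) := by
            refine Finset.sum_le_sum fun p _ => ?_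
            rw [lintegral_indicator_one (hSm n p)]
            exact hprob _ _ _ (by positivity)
        _ = ENNReal.ofReal ((latticeIndex n).card * (B₀ * (K * (2 : ℝ) ^ (-s * n)))) := by
            rw [Finset.sum_const, nsmul_eq_mul, ENNReal.ofReal_mul (Nat.cast_nonneg _),
              ENNReal.ofReal_natCast]
        _ ≤ _ := by
            refine ENNReal.ofReal_le_ofReal ?_
            gcongr
            exact card_latticeIndex_le n
    refine (mul_le_mul_right h1 _).trans (le_of_eq ?_)
    rw [← ENNReal.ofReal_mul (by positivity)]
    congr 1
    have : ((2 : ℝ) ^ (2 - s - u)) ^ n = (2 : ℝ) ^ (-(n * u)) * (4 ^ n * (2 : ℝ) ^ (-s * n)) := by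
      rw [show (4 : ℝ) = 2 ^ (2 : ℝ) by norm_num, ← Real.rpow_natCast, ← Real.rpow_natCast,
        ← Real.rpow_mul (by norm_num), ← Real.rpow_mul (by norm_num),
        ← Real.rpow_add (by norm_num), ← Real.rpow_add (by norm_num)]
      congr 1; ring
    rw [this]; ring
  have hGint : ∫⁻ ω, G ω ∂P ≠ ∞ := by
    rw [hG, lintegral_tsum fun n => (Measurable.const_mul (Finset.measurable_fun_sum _ fun p _ =>
      measurable_one.indicator (hSm n p)) _).aemeasurable]
    refine ne_top_of_le_ne_top ?_ (ENNReal.tsum_le_tsum hterm)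
    rw [← ENNReal.ofReal_tsum_of_nonneg (fun n => by positivity)]
    · exact ENNReal.ofReal_ne_top
    · refine (summable_geometric_of_lt_one (by positivity) ?_).mul_left _
      exact Real.rpow_lt_one_of_one_lt_of_neg (by norm_num) (by linarith)
  filter_upwards [ae_lt_top hGm hGint] with ω hω
  refine ⟨(G ω).toReal, fun n => ?_⟩
  have h1 : ENNReal.ofReal ((2 : ℝ) ^ (-(n * u))) * ∑ p ∈ latticeIndex n, (S n p).indicator 1 ω ≤
      G ω := ENNReal.le_tsum n
  have h2 : ∑ p ∈ latticeIndex n, (S n p).indicator 1 ω =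
      (((latticeIndex n).filter fun p =>
        |trigField (fun k => Z k ω) (latticePoint n p) - y| ≤ K * (2 : ℝ) ^ (-s * n)).card : ℝ≥0∞) := by
    rw [Finset.card_filter]
    push_cast
    refine Finset.sum_congr rfl fun p _ => ?_
    simp only [Set.indicator_apply, hS, Set.mem_ofPred_eq, Pi.one_apply]
  rw [h2, ← ENNReal.ofReal_natCast, ← ENNReal.ofReal_mul (by positivity)] at h1
  have h3 := (ENNReal.ofReal_le_iff_le_toReal hω.ne).1 h1
  calc _ = (2 : ℝ) ^ (-(n * u)) * (((latticeIndex n).filter fun p =>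
        |trigField (fun k => Z k ω) (latticePoint n p) - y| ≤ K * (2 : ℝ) ^ (-s * n)).card : ℝ) *
        (2 : ℝ) ^ (n * u) := by
        rw [mul_right_comm, ← Real.rpow_add (by norm_num), neg_add_cancel, Real.rpow_zero, one_mul]
    _ ≤ _ := by gcongr

/-- Almost surely, the packing dimension of the level set is at most `2 - H`. -/
lemma ae_dimP_levelSet_le (hZ : IsGaussianFourier P H Z q c C) (y : ℝ) :
    ∀ᵐ ω ∂P, dimP (levelSet y (trigField fun k => Z k ω)) ≤ ENNReal.ofReal (2 - H) := by
  have hH := hZ.H_pos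
  have hH1 := hZ.H_lt_one
  -- a sequence of Hölder exponents increasing to `H`
  set s : ℕ → ℝ := fun m => H * (1 - 1 / (m + 2)) with hs
  have hm2 : ∀ m : ℕ, (0 : ℝ) < 1 / ((m : ℝ) + 2) ∧ 1 / ((m : ℝ) + 2) < 1 := fun m => by
    have : (0 : ℝ) ≤ m := Nat.cast_nonneg m
    constructor
    · positivity
    · rw [div_lt_one (by positivity)]; linarith
  have hs0 : ∀ m, 0 < s m := fun m => mul_pos hH (by linarith [(hm2 m).2])
  have hsH : ∀ m, s m < H := fun m => by
    simp only [hs]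
    nlinarith [(hm2 m).1]
  have hcount : ∀ᵐ ω ∂P, ∀ (m : ℕ) (K : ℕ), ∃ B : ℝ, ∀ n : ℕ, (((latticeIndex n).filter fun p =>
      |trigField (fun k => Z k ω) (latticePoint n p) - y| ≤ K * (2 : ℝ) ^ (-(s m) * n)).card : ℝ) ≤
        B * (2 : ℝ) ^ (n * (2 - s m + (H - s m))) := by
    rw [ae_all_iff]; intro m
    rw [ae_all_iff]; intro K
    exact hZ.ae_exists_count_le y (by linarith [hsH m]) K (Nat.cast_nonneg K)
  have hreg : ∀ᵐ ω ∂P, ∀ m : ℕ, ∃ K, HasShellBound (fun k => Z k ω) ((s m + H) / 2) K := by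
    rw [ae_all_iff]; intro m
    exact hZ.ae_exists_hasShellBound (by linarith [hsH m])
  filter_upwards [hcount, hreg] with ω hω hω'
  refine dimP_levelSet_le (by linarith) fun u hu => ?_
  obtain ⟨m, hm⟩ : ∃ m : ℕ, 2 - s m + (H - s m) ≤ u := by
    obtain ⟨m, hm⟩ := exists_nat_gt (2 * H / (u - (2 - H)))
    refine ⟨m, ?_⟩
    have hpos : 0 < u - (2 - H) := by linarith
    have hmpos : (0 : ℝ) < (m : ℝ) + 2 := by positivity
    rw [div_lt_iff₀ hpos] at hm
    have : 2 * H / ((m : ℝ) + 2) ≤ u - (2 - H) := by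
      rw [div_le_iff₀ hmpos]
      nlinarith
    have e : 2 - s m + (H - s m) = 2 - H + 2 * H / ((m : ℝ) + 2) := by
      simp only [hs]; field_simp; ring
    linarith
  obtain ⟨K₀, hK₀⟩ := hω' m
  obtain ⟨K, hK, hhol⟩ := hK₀.holder (by linarith [hs0 m]) (hs0 m) (by linarith [hsH m])
    (by linarith [hsH m])
  obtain ⟨N, hN⟩ := exists_nat_ge K
  obtain ⟨B, hB⟩ := hω m N
  refine ⟨s m, N, |B|, (hs0 m).le, Nat.cast_nonneg N, fun x x' => (hhol x x').trans ?_,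
    fun n => (hB n).trans ?_⟩
  · gcongr
  · have h1 : (2 : ℝ) ^ ((n : ℝ) * (2 - s m + (H - s m))) ≤ (2 : ℝ) ^ ((n : ℝ) * u) := by
      refine Real.rpow_le_rpow_of_exponent_le (by norm_num) ?_
      gcongr
    exact mul_le_mul (le_abs_self B) h1 (by positivity) (abs_nonneg B)

end IsGaussianFourier

end Upper

/-! ### Second moments and limsup events -/

section SecondMoment

variable {Ω : Type*} [MeasurableSpace Ω] {P : Measure Ω}

/-- The Paley–Zygmund inequality at level one half. -/
lemma sq_half_le_mul_measure [IsProbabilityMeasure P] {M : Ω → ℝ≥0∞} (hM : Measurable M)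
    {a b : ℝ≥0∞} (ha : a ≠ ∞) (h1 : a ≤ ∫⁻ ω, M ω ∂P) (h2 : ∫⁻ ω, M ω ^ 2 ∂P ≤ b) :
    (a / 2) ^ 2 ≤ b * P {ω | a / 2 ≤ M ω} := by
  set S : Set Ω := {ω | a / 2 ≤ M ω} with hS
  have hSm : MeasurableSet S := measurableSet_le measurable_const hM
  have hSc : ∫⁻ ω in Sᶜ, M ω ∂P ≤ a / 2 := by
    calc ∫⁻ ω in Sᶜ, M ω ∂P ≤ ∫⁻ _ in Sᶜ, a / 2 ∂P :=
          setLIntegral_mono' hSm.compl fun ω hω => (not_le.1 (show ¬ a / 2 ≤ M ω from hω)).le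
      _ = a / 2 * P Sᶜ := by rw [setLIntegral_const]
      _ ≤ a / 2 := mul_le_of_le_one_right' prob_le_one
  have hSi : ∫⁻ ω in S, M ω ∂P ≤ (b * P S) ^ (1 / 2 : ℝ) := by
    have h := ENNReal.lintegral_mul_le_Lp_mul_Lq P Real.HolderConjugate.two_two
      hM.aemeasurable (g := S.indicator 1) (measurable_one.indicator hSm).aemeasurable
    have e1 : ∫⁻ ω, (M * S.indicator (1 : Ω → ℝ≥0∞)) ω ∂P = ∫⁻ ω in S, M ω ∂P := by
      rw [← lintegral_indicator hSm]
      refine lintegral_congr fun ω => ?_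
      by_cases h : ω ∈ S <;> simp [h]
    have e2 : ∫⁻ ω, (S.indicator 1 ω : ℝ≥0∞) ^ (2 : ℝ) ∂P = P S := by
      rw [← lintegral_indicator_one hSm]
      refine lintegral_congr fun ω => ?_
      by_cases h : ω ∈ S <;> simp [h]
    rw [e1, e2] at h
    refine h.trans ?_
    rw [ENNReal.mul_rpow_of_nonneg _ _ (by norm_num)]
    gcongr
    simpa using h2
  have h3 : a / 2 ≤ (b * P S) ^ (1 / 2 : ℝ) := by
    have h4 : a / 2 + a / 2 ≤ a / 2 + (b * P S) ^ (1 / 2 : ℝ) := by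
      rw [ENNReal.add_halves]
      refine h1.trans ?_
      rw [← lintegral_add_compl M hSm, add_comm]
      exact add_le_add hSc hSi
    have : a / 2 ≠ ∞ := by finiteness
    exact (ENNReal.add_le_add_iff_left this).1 h4
  calc (a / 2) ^ 2 ≤ ((b * P S) ^ (1 / 2 : ℝ)) ^ 2 := by gcongr
    _ = b * P S := by
      rw [← ENNReal.rpow_natCast, ← ENNReal.rpow_mul]; norm_num

lemma le_measure_iInter_iUnion [IsFiniteMeasure P] {F : ℕ → Set Ω} (hF : ∀ n, MeasurableSet (F n))
    {p : ℝ≥0∞} (hp : ∀ n, p ≤ P (F n)) : p ≤ P (⋂ N, ⋃ n ≥ N, F n) := by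
  have hm : ∀ N, MeasurableSet (⋃ n ≥ N, F n) := fun N =>
    MeasurableSet.iUnion fun n => MeasurableSet.iUnion fun _ => hF n
  have hanti : Antitone fun N => ⋃ n ≥ N, F n := fun N N' h =>
    Set.biUnion_subset_biUnion_left fun n hn => le_trans h hn
  refine ge_of_tendsto' (tendsto_measure_iInter_atTop (fun N => (hm N).nullMeasurableSet) hanti
    ⟨0, measure_ne_top _ _⟩) fun N => (hp N).trans (measure_mono ?_)
  exact Set.subset_biUnion_of_mem (u := F) (le_refl N)

/-- If the masses `M n` have first moments bounded below and second moments bounded above, and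
the energies `e m n` have means bounded uniformly in `n`, then with positive probability the
masses are bounded below and all energies bounded above simultaneously for infinitely many `n`. -/
lemma exists_frequently_mass_energy [IsProbabilityMeasure P] {M : ℕ → Ω → ℝ≥0∞}
    {e : ℕ → ℕ → Ω → ℝ≥0∞} (hM : ∀ n, Measurable (M n)) (he : ∀ m n, Measurable (e m n))
    {a b : ℝ≥0∞} (ha : a ≠ 0) (ha' : a ≠ ∞) (hb : b ≠ ∞) (h1 : ∀ n, a ≤ ∫⁻ ω, M n ω ∂P)
    (h2 : ∀ n, ∫⁻ ω, M n ω ^ 2 ∂P ≤ b) {B : ℕ → ℝ≥0∞} (hB : ∀ m, B m ≠ ∞)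
    (h3 : ∀ m n, ∫⁻ ω, e m n ω ∂P ≤ B m) :
    ∃ (E : Set Ω) (A : ℕ → ℝ≥0∞), MeasurableSet E ∧ 0 < P E ∧ (∀ m, A m ≠ ∞) ∧
      ∀ ω ∈ E, ∃ᶠ n in Filter.atTop, a / 2 ≤ M n ω ∧ ∀ m, e m n ω ≤ A m := by
  have ha2 : 0 < (a / 2) ^ 2 := ENNReal.pow_pos (ENNReal.half_pos ha) 2
  have hb0 : b ≠ 0 := by
    rintro rfl
    have := sq_half_le_mul_measure (hM 0) ha' (h1 0) (h2 0)
    rw [zero_mul] at this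
    exact ha2.ne' (le_antisymm this zero_le)
  set p : ℝ≥0∞ := (a / 2) ^ 2 / b with hp
  have hp0 : p ≠ 0 := (ENNReal.div_pos ha2.ne' hb).ne'
  have hpt : p ≠ ∞ := by
    refine ENNReal.div_ne_top ?_ hb0
    finiteness
  have hp2 : p / 2 ≠ 0 := (ENNReal.half_pos hp0).ne'
  obtain ⟨ε, hε, hsum⟩ := ENNReal.exists_pos_sum_of_countable hp2 ℕ
  -- by Markov's inequality the `m`-th energy exceeds `A m` with probability at most `ε m`; the summand
  -- `1` keeps `A m` positive
  set A : ℕ → ℝ≥0∞ := fun m => (B m + 1) / ε m with hA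
  have hε0 : ∀ m, (ε m : ℝ≥0∞) ≠ 0 := fun m => by simpa using (hε m).ne'
  have hA' : ∀ m, A m ≠ ∞ := fun m => ENNReal.div_ne_top (by simpa using hB m) (hε0 m)
  have hA0 : ∀ m, A m ≠ 0 := fun m => (ENNReal.div_pos (by simp) (by simp)).ne'
  set F : ℕ → Set Ω := fun n => {ω | a / 2 ≤ M n ω} ∩ ⋂ m, {ω | e m n ω ≤ A m} with hF
  have hFm : ∀ n, MeasurableSet (F n) := fun n => (measurableSet_le measurable_const (hM n)).inter
    (MeasurableSet.iInter fun m => measurableSet_le (he m n) measurable_const)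
  have hFp : ∀ n, p / 2 ≤ P (F n) := by
    intro n
    have hS : p ≤ P {ω | a / 2 ≤ M n ω} :=
      ENNReal.div_le_of_le_mul' (sq_half_le_mul_measure (hM n) ha' (h1 n) (h2 n))
    have hbad : ∀ m, P {ω | A m ≤ e m n ω} ≤ ε m := by
      intro m
      refine (meas_ge_le_lintegral_div (he m n).aemeasurable (hA0 m) (hA' m)).trans ?_
      refine ENNReal.div_le_of_le_mul ?_
      rw [hA, ENNReal.mul_div_cancel (hε0 m) ENNReal.coe_ne_top]
      exact (h3 m n).trans le_self_add
    have hsub : {ω | a / 2 ≤ M n ω} ⊆ F n ∪ ⋃ m, {ω | A m ≤ e m n ω} := by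
      intro ω hω
      by_cases h : ∀ m, e m n ω ≤ A m
      · exact Or.inl ⟨hω, Set.mem_iInter.2 h⟩
      · push Not at h
        obtain ⟨m, hm⟩ := h
        exact Or.inr (Set.mem_iUnion.2 ⟨m, hm.le⟩)
    have h4 : p ≤ P (F n) + p / 2 := by
      refine hS.trans ((measure_mono hsub).trans ((measure_union_le _ _).trans ?_))
      gcongr
      exact (measure_iUnion_le _).trans ((ENNReal.tsum_le_tsum hbad).trans hsum.le)
    have h5 : p / 2 + p / 2 ≤ P (F n) + p / 2 := by rwa [ENNReal.add_halves]
    exact (ENNReal.add_le_add_iff_right (by finiteness)).1 h5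
  refine ⟨⋂ N, ⋃ n ≥ N, F n, A, MeasurableSet.iInter fun N => MeasurableSet.iUnion fun n =>
    MeasurableSet.iUnion fun _ => hFm n, (pos_iff_ne_zero.2 hp2).trans_le
      (le_measure_iInter_iUnion hFm hFp), hA', fun ω hω => ?_⟩
  rw [Filter.frequently_atTop]
  intro N
  obtain ⟨n, hn⟩ := Set.mem_iUnion.1 (Set.mem_iInter.1 hω N)
  obtain ⟨hnN, hn⟩ := Set.mem_iUnion.1 hn
  exact ⟨n, hnN, hn.1, fun m => Set.mem_iInter.1 hn.2 m⟩

end SecondMoment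

/-! ### Riesz energies of Lebesgue measure on a square -/

section Kernel

lemma lintegral_ball_enorm_rpow_lt_top {s : ℝ} (hs : s < 2) :
    ∫⁻ u in Metric.ball (0 : Plane) 1, ‖u‖ₑ ^ (-s) < ∞ := by
  have h := integrableOn_ball_of_norm_le_rpow (μ := (volume : Measure Plane)) (r := 1) (C := 1)
    (α := s) (f := fun u : Plane => ‖u‖ ^ (-s)) (by simp) (by simpa using hs)
    (Filter.Eventually.of_forall fun u => by
      rw [one_mul, Real.norm_of_nonneg (by positivity)])
    (by exact (measurable_norm.pow_const _).aestronglyMeasurable)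
  refine lt_of_le_of_lt (le_of_eq ?_) h.2
  refine setLIntegral_congr_fun_ae measurableSet_ball ?_
  have h0 : ∀ᵐ u : Plane, u ≠ 0 := by
    simp [ae_iff]
  filter_upwards [h0] with u hu _
  rw [Real.enorm_eq_ofReal (by positivity), ← ENNReal.ofReal_rpow_of_pos (norm_pos_iff.2 hu),
    ofReal_norm]

/-- The square `[0, 1/2]²`: a part of the torus on which coordinate differences are at most `1/2`, as
the two-point variance bound requires. -/
def halfSquare : Set Plane := {x | ∀ i, x i ∈ Set.Icc (0 : ℝ) (1 / 2)}

lemma isCompact_halfSquare : IsCompact halfSquare := by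
  have h : IsCompact ((EuclideanSpace.equiv (Fin 2) ℝ).toHomeomorph ⁻¹'
      (Set.univ.pi fun _ => Set.Icc (0 : ℝ) (1 / 2))) :=
    (EuclideanSpace.equiv (Fin 2) ℝ).toHomeomorph.isCompact_preimage.2
      (isCompact_univ_pi fun _ => isCompact_Icc)
  convert h using 1
  ext x
  simp [halfSquare, Pi.le_def, forall_and]

lemma measurableSet_halfSquare : MeasurableSet halfSquare :=
  isCompact_halfSquare.isClosed.measurableSet

lemma halfSquare_subset_torus : halfSquare ⊆ torus := fun x hx i => by
  have := Real.pi_gt_three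
  exact ⟨by linarith [(hx i).1], by linarith [(hx i).2]⟩

lemma volume_halfSquare_ne_zero : volume halfSquare ≠ 0 := by
  have ho : IsOpen ({x | ∀ i, x i ∈ Set.Ioo (0 : ℝ) (1 / 2)} : Set Plane) := by
    simp only [Set.ofPred_forall]
    exact isOpen_iInter_of_finite fun i => isOpen_Ioo.preimage (by fun_prop)
  have hn : ({x | ∀ i, x i ∈ Set.Ioo (0 : ℝ) (1 / 2)} : Set Plane).Nonempty :=
    ⟨!₂[1 / 4, 1 / 4], fun i => by fin_cases i <;> norm_num⟩
  refine ((ho.measure_pos volume hn).trans_le (measure_mono ?_)).ne'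
  exact fun x hx i => Set.Ioo_subset_Icc_self (hx i)

lemma volume_halfSquare_ne_top : volume halfSquare ≠ ∞ := isCompact_halfSquare.measure_lt_top.ne

lemma abs_sub_le_of_mem_halfSquare {x x' : Plane} (hx : x ∈ halfSquare) (hx' : x' ∈ halfSquare)
    (i : Fin 2) : |x i - x' i| ≤ 1 / 2 := by
  rw [abs_le]
  exact ⟨by linarith [(hx i).1, (hx' i).2], by linarith [(hx i).2, (hx' i).1]⟩

lemma dist_lt_one_of_mem_halfSquare {x x' : Plane} (hx : x ∈ halfSquare) (hx' : x' ∈ halfSquare) :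
    dist x x' < 1 := by
  have h0 := abs_le.1 (abs_sub_le_of_mem_halfSquare hx hx' 0)
  have h1 := abs_le.1 (abs_sub_le_of_mem_halfSquare hx hx' 1)
  rw [EuclideanSpace.dist_eq, Fin.sum_univ_two, Real.dist_eq, Real.dist_eq, sq_abs, sq_abs]
  rw [Real.sqrt_lt' one_pos]
  generalize x 0 - x' 0 = p at *
  generalize x 1 - x' 1 = r at *
  nlinarith

lemma rieszEnergy_halfSquare_lt_top {s : ℝ} (hs : s < 2) :
    rieszEnergy s ((volume : Measure Plane).restrict halfSquare) < ∞ := by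
  set K := ∫⁻ u in Metric.ball (0 : Plane) 1, ‖u‖ₑ ^ (-s) with hK
  have hin : ∀ x ∈ halfSquare, ∫⁻ x' in halfSquare, edist x x' ^ (-s) ≤ K := by
    intro x hx
    calc ∫⁻ x' in halfSquare, edist x x' ^ (-s)
        ≤ ∫⁻ x', (Metric.ball (0 : Plane) 1).indicator (fun u => ‖u‖ₑ ^ (-s)) (x - x') := by
          rw [← lintegral_indicator measurableSet_halfSquare]
          refine lintegral_mono fun x' => ?_
          by_cases hx' : x' ∈ halfSquare
          · have : x - x' ∈ Metric.ball (0 : Plane) 1 := by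
              rw [mem_ball_zero_iff, ← dist_eq_norm]
              exact dist_lt_one_of_mem_halfSquare hx hx'
            rw [Set.indicator_of_mem hx', Set.indicator_of_mem this, edist_eq_enorm_sub]
          · rw [Set.indicator_of_notMem hx']
            exact zero_le
      _ = ∫⁻ u, (Metric.ball (0 : Plane) 1).indicator (fun u => ‖u‖ₑ ^ (-s)) u :=
          lintegral_sub_left_eq_self (μ := (volume : Measure Plane)) _ x
      _ = K := lintegral_indicator measurableSet_ball _
  calc rieszEnergy s ((volume : Measure Plane).restrict halfSquare)
      ≤ ∫⁻ _ in halfSquare, K := setLIntegral_mono' measurableSet_halfSquare hin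
    _ = K * volume halfSquare := setLIntegral_const _ _
    _ < ∞ := ENNReal.mul_lt_top (lintegral_ball_enorm_rpow_lt_top hs)
        volume_halfSquare_ne_top.lt_top

end Kernel

/-! ### Approximate local times -/

section LocalTime

/-- The density `(2 η)⁻¹ 1 {|v - y| ≤ η}` with `η = 1 / (n + 1)`. -/
noncomputable def levelDensity (y : ℝ) (n : ℕ) (v : Plane → ℝ) (x : Plane) : ℝ≥0∞ :=
  {x | |v x - y| ≤ 1 / ((n : ℝ) + 1)}.indicator (fun _ => ENNReal.ofReal (((n : ℝ) + 1) / 2)) x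

/-- The approximate local time of the field `v` at the level `y`, on the square `[0, 1/2]²`. -/
noncomputable def approxLocalTime (y : ℝ) (n : ℕ) (v : Plane → ℝ) : Measure Plane :=
  (volume.restrict halfSquare).withDensity (levelDensity y n v)

instance (y : ℝ) (n : ℕ) (v : Plane → ℝ) : IsFiniteMeasure (approxLocalTime y n v) := by
  refine isFiniteMeasure_withDensity (ne_of_lt (lt_of_le_of_lt (lintegral_mono
    (g := fun _ => ENNReal.ofReal (((n : ℝ) + 1) / 2)) fun x => ?_) ?_))
  · exact Set.indicator_le_self _ _ x
  · rw [setLIntegral_const]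
    exact ENNReal.mul_lt_top ENNReal.ofReal_lt_top volume_halfSquare_ne_top.lt_top

lemma approxLocalTime_univ (y : ℝ) (n : ℕ) (v : Plane → ℝ) :
    approxLocalTime y n v Set.univ = ∫⁻ x in halfSquare, levelDensity y n v x := by
  rw [approxLocalTime, withDensity_apply _ MeasurableSet.univ, Measure.restrict_univ]

lemma measurable_levelDensity {y : ℝ} {n : ℕ} {v : Plane → ℝ} (hv : Measurable v) :
    Measurable (levelDensity y n v) :=
  measurable_const.indicator (measurableSet_le (by fun_prop) measurable_const)

lemma rieszEnergy_approxLocalTime {y : ℝ} {n : ℕ} {v : Plane → ℝ} (hv : Measurable v) (γ : ℝ) :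
    rieszEnergy γ (approxLocalTime y n v) =
      ∫⁻ p : Plane × Plane, levelDensity y n v p.1 * levelDensity y n v p.2 *
        edist p.1 p.2 ^ (-γ) ∂(volume.restrict halfSquare).prod (volume.restrict halfSquare) := by
  have hd : Measurable (levelDensity y n v) := measurable_levelDensity hv
  have hk : Measurable fun p : Plane × Plane => edist p.1 p.2 ^ (-γ) := by fun_prop
  have hin : ∀ x : Plane, ∫⁻ x', edist x x' ^ (-γ) ∂approxLocalTime y n v =
      ∫⁻ x' in halfSquare, levelDensity y n v x' * edist x x' ^ (-γ) := by
    intro x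
    rw [approxLocalTime, lintegral_withDensity_eq_lintegral_mul _ hd (by fun_prop)]
    rfl
  have hm : Measurable fun x : Plane =>
      ∫⁻ x' in halfSquare, levelDensity y n v x' * edist x x' ^ (-γ) :=
    Measurable.lintegral_prod_right'
      (f := fun p : Plane × Plane => levelDensity y n v p.2 * edist p.1 p.2 ^ (-γ))
      ((hd.comp measurable_snd).mul hk)
  rw [rieszEnergy, lintegral_congr hin, approxLocalTime,
    lintegral_withDensity_eq_lintegral_mul _ hd hm, lintegral_prod]
  · refine lintegral_congr fun x => ?_
    rw [Pi.mul_apply, ← lintegral_const_mul _ (by fun_prop)]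
    simp only [mul_assoc]
  · exact (((hd.comp measurable_fst).mul (hd.comp measurable_snd)).mul hk).aemeasurable

lemma rieszEnergy_zero {X : Type*} [MetricSpace X] [MeasurableSpace X] (ν : Measure X) :
    rieszEnergy 0 ν = ν Set.univ ^ 2 := by
  simp [rieszEnergy, sq]

/-- For a continuous field the approximate local times concentrate on the level set. -/
lemma eventually_approxLocalTime_compl {y : ℝ} {v : Plane → ℝ} (hv : Continuous v)
    {U : Set Plane} (hU : IsOpen U) (hLU : levelSet y v ⊆ U) :
    ∀ᶠ n : ℕ in Filter.atTop, approxLocalTime y n v Uᶜ = 0 := by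
  have hpos : ∃ m : ℝ, 0 < m ∧ ∀ x ∈ halfSquare \ U, m ≤ |v x - y| := by
    rcases (halfSquare \ U).eq_empty_or_nonempty with he | hne
    · exact ⟨1, one_pos, by simp [he]⟩
    · obtain ⟨x₀, hx₀, hmin⟩ := (isCompact_halfSquare.diff hU).exists_isMinOn hne
        (f := fun x => |v x - y|) (by fun_prop)
      refine ⟨|v x₀ - y|, abs_pos.2 fun h => hx₀.2 (hLU ⟨halfSquare_subset_torus hx₀.1, ?_⟩),
        fun x hx => hmin hx⟩
      linarith
  obtain ⟨m, hm, hle⟩ := hpos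
  have hev : ∀ᶠ n : ℕ in Filter.atTop, 1 / ((n : ℝ) + 1) < m :=
    tendsto_one_div_add_atTop_nhds_zero_nat.eventually_lt_const hm
  filter_upwards [hev] with n hn
  rw [approxLocalTime, withDensity_apply _ hU.measurableSet.compl,
    Measure.restrict_restrict hU.measurableSet.compl]
  refine (setLIntegral_congr_fun (hU.measurableSet.compl.inter measurableSet_halfSquare)
    (g := fun _ => 0) fun x hx => ?_).trans (by simp)
  refine Set.indicator_of_notMem (fun h => ?_) _
  exact absurd (hle x ⟨hx.2, hx.1⟩) (not_le.2 (lt_of_le_of_lt h hn))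

variable {Ω : Type*} [MeasurableSpace Ω] {P : Measure Ω} {H : ℝ} {Z : ℤ × ℤ → Ω → ℝ}
  {q : ℤ × ℤ → ℝ} {c C : ℝ}

namespace IsGaussianFourier

lemma measurable_trigField_right (hZ : IsGaussianFourier P H Z q c C) (ω : Ω) :
    Measurable (trigField fun k => Z k ω) :=
  Measurable.comp (g := fun p : Ω × Plane => trigField (fun k => Z k p.1) p.2)
    (f := fun x => (ω, x)) (measurable_trigField hZ.measurable) measurable_prodMk_left

lemma measurable_levelDensity_trigField (hZ : IsGaussianFourier P H Z q c C) (y : ℝ) (n : ℕ) :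
    Measurable fun p : Ω × Plane => levelDensity y n (trigField fun k => Z k p.1) p.2 := by
  have h := measurable_trigField hZ.measurable
  have hs : MeasurableSet {p : Ω × Plane |
      |trigField (fun k => Z k p.1) p.2 - y| ≤ 1 / ((n : ℝ) + 1)} :=
    measurableSet_le (by fun_prop) measurable_const
  exact measurable_const.indicator hs

lemma measurable_mass (hZ : IsGaussianFourier P H Z q c C) (y : ℝ) (n : ℕ) :
    Measurable fun ω => approxLocalTime y n (trigField fun k => Z k ω) Set.univ := by
  simp only [approxLocalTime_univ]
  exact (hZ.measurable_levelDensity_trigField y n).lintegral_prod_right'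

lemma measurable_energy_integrand (hZ : IsGaussianFourier P H Z q c C) (y : ℝ) (n : ℕ) (γ : ℝ) :
    Measurable fun r : Ω × (Plane × Plane) =>
      levelDensity y n (trigField fun k => Z k r.1) r.2.1 *
      levelDensity y n (trigField fun k => Z k r.1) r.2.2 * edist r.2.1 r.2.2 ^ (-γ) := by
  have h := hZ.measurable_levelDensity_trigField y n
  have h1 : Measurable fun r : Ω × (Plane × Plane) =>
      levelDensity y n (trigField fun k => Z k r.1) r.2.1 :=
    Measurable.comp (g := fun p : Ω × Plane => levelDensity y n (trigField fun k => Z k p.1) p.2)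
      (f := fun r : Ω × (Plane × Plane) => (r.1, r.2.1)) h (by fun_prop)
  have h2 : Measurable fun r : Ω × (Plane × Plane) =>
      levelDensity y n (trigField fun k => Z k r.1) r.2.2 :=
    Measurable.comp (g := fun p : Ω × Plane => levelDensity y n (trigField fun k => Z k p.1) p.2)
      (f := fun r : Ω × (Plane × Plane) => (r.1, r.2.2)) h (by fun_prop)
  exact (h1.mul h2).mul (by fun_prop)

lemma measurable_energy (hZ : IsGaussianFourier P H Z q c C) (y : ℝ) (n : ℕ) (γ : ℝ) :
    Measurable fun ω => rieszEnergy γ (approxLocalTime y n (trigField fun k => Z k ω)) := by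
  simp only [rieszEnergy_approxLocalTime (hZ.measurable_trigField_right _)]
  exact (hZ.measurable_energy_integrand y n γ).lintegral_prod_right'

/-- The mean mass of the approximate local times is bounded below. -/
lemma exists_le_lintegral_mass (hZ : IsGaussianFourier P H Z q c C) (y : ℝ) :
    ∃ a : ℝ≥0∞, a ≠ 0 ∧ a ≠ ∞ ∧ ∀ n : ℕ,
      a ≤ ∫⁻ ω, approxLocalTime y n (trigField fun k => Z k ω) Set.univ ∂P := by
  have := hZ.isProbabilityMeasure
  obtain ⟨κ, hκ, hle⟩ := hZ.exists_le_fieldVar_one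
  set V := ∑' k, q k with hV
  have hκV : κ ≤ V := (hle 0 0).trans (hZ.fieldVar_one_le 0 0)
  set l : ℝ := (Real.sqrt (2 * Real.pi * V))⁻¹ * Real.exp (-(|y| + 1) ^ 2 / (2 * κ)) with hl
  have hl0 : 0 < l := by
    have := Real.pi_pos
    have : 0 < V := hκ.trans_le hκV
    positivity
  refine ⟨ENNReal.ofReal l * volume halfSquare, mul_ne_zero (by simpa using hl0)
    volume_halfSquare_ne_zero, ENNReal.mul_ne_top ENNReal.ofReal_ne_top volume_halfSquare_ne_top,
    fun n => ?_⟩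
  have hn : (0 : ℝ) < (n : ℝ) + 1 := by positivity
  have hn1 : 1 / ((n : ℝ) + 1) ≤ 1 := by
    rw [div_le_one hn]; linarith [(Nat.cast_nonneg n : (0 : ℝ) ≤ n)]
  simp only [approxLocalTime_univ]
  rw [lintegral_lintegral_swap (hZ.measurable_levelDensity_trigField y n).aemeasurable,
    ← setLIntegral_const]
  refine lintegral_mono fun x => ?_
  have e : ∫⁻ ω, levelDensity y n (trigField fun k => Z k ω) x ∂P =
      ENNReal.ofReal (((n : ℝ) + 1) / 2) *
        P {ω | |trigField (fun k => Z k ω) x - y| ≤ 1 / ((n : ℝ) + 1)} := by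
    rw [← lintegral_indicator_const (hZ.measurableSet_near x y _)]
    rfl
  rw [e, hZ.prob_near_eq]
  have hb := le_gaussianReal_Icc (v := (fieldVar q 1 0 x x).toNNReal) (C := V) (R := |y| + 1) hκ
    (by rw [Real.coe_toNNReal _ (hZ.fieldVar_nonneg _ _ _ _)]; exact hle x x)
    (by rw [Real.coe_toNNReal _ (hZ.fieldVar_nonneg _ _ _ _)]; exact hZ.fieldVar_one_le x x)
    (a := y - 1 / ((n : ℝ) + 1)) (b := y + 1 / ((n : ℝ) + 1)) (fun u hu => by
      have h1 := le_abs_self y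
      have h2 := neg_abs_le y
      rw [abs_le]
      constructor <;> linarith [hu.1, hu.2])
  refine le_trans (le_of_eq ?_) (mul_le_mul_right hb _)
  rw [mul_left_comm, ← ENNReal.ofReal_mul (by positivity),
    show ((n : ℝ) + 1) / 2 * (y + 1 / ((n : ℝ) + 1) - (y - 1 / ((n : ℝ) + 1))) = 1 by
      field_simp; ring_nf,
    ENNReal.ofReal_one, mul_one]

/-- Two-point estimate: the densities at `x` and `x'` have correlation `O(|x - x'| ^ (-H))`. -/
lemma exists_lintegral_levelDensity_mul_le (hZ : IsGaussianFourier P H Z q c C) (y : ℝ) :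
    ∃ B : ℝ, 0 < B ∧ ∀ n : ℕ, ∀ x ∈ halfSquare, ∀ x' ∈ halfSquare,
      ∫⁻ ω, levelDensity y n (trigField fun k => Z k ω) x *
        levelDensity y n (trigField fun k => Z k ω) x' ∂P ≤
          ENNReal.ofReal B * edist x x' ^ (-H) := by
  have := hZ.isProbabilityMeasure
  have hpi := Real.pi_pos
  obtain ⟨κ₁, hκ₁, hle₁⟩ := hZ.exists_le_fieldVar_one
  obtain ⟨κ₂, hκ₂, hle₂⟩ := hZ.exists_le_fieldVar
  refine ⟨(Real.sqrt (2 * Real.pi * κ₁))⁻¹ * (Real.sqrt (2 * Real.pi * κ₂))⁻¹, by positivity,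
    fun n x hx x' hx' => ?_⟩
  -- on the diagonal the right-hand side is `∞`
  rcases eq_or_ne x x' with rfl | hne
  · rw [edist_self, ENNReal.zero_rpow_of_neg (by linarith [hZ.H_pos]), ENNReal.mul_top]
    · exact le_top
    · have : 0 < (Real.sqrt (2 * Real.pi * κ₁))⁻¹ * (Real.sqrt (2 * Real.pi * κ₂))⁻¹ := by
        positivity
      exact (ENNReal.ofReal_pos.2 this).ne'
  have hd : 0 < dist x x' := dist_pos.2 hne
  have hn : (0 : ℝ) < (n : ℝ) + 1 := by positivity
  obtain ⟨ρ, hρ⟩ := exists_fieldVar_decomp hZ x x'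
  set η : ℝ := 1 / ((n : ℝ) + 1) with hη
  set U : Ω → ℝ := fun ω => trigField (fun k => Z k ω) x with hU
  set U' : Ω → ℝ := fun ω => trigField (fun k => Z k ω) x' with hU'
  have hUm : Measurable U := hZ.measurable_trigField_left x
  have hUm' : Measurable U' := hZ.measurable_trigField_left x'
  set v₁ := fieldVar q 1 0 x x' with hv₁
  set v₂ := fieldVar q (-ρ) 1 x x' with hv₂
  have h₁ : κ₁ ≤ v₁ := hle₁ x x'
  have h₂ : κ₂ * dist x x' ^ (2 * H) ≤ v₂ :=
    hle₂ ρ x x' hne (abs_sub_le_of_mem_halfSquare hx hx')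
  have h₂' : 0 < κ₂ * dist x x' ^ (2 * H) := by positivity
  -- `X(x') - ρ X(x)` is independent of `X(x)`
  have hp := gaussian_pair_le (P := P) (U := U) (W := fun ω => U' ω - ρ * U ω)
    (v₁ := v₁.toNNReal) (v₂ := v₂.toNNReal) hUm (by fun_prop)
    (by simpa using hκ₁.trans_le h₁) (by simpa using h₂'.trans_le h₂)
    (fun s r => by
      have h := hZ.hasLaw_trigField (s - r * ρ) r x x'
      rw [hρ s r, Real.toNNReal_add (mul_nonneg (sq_nonneg _) (hκ₁.le.trans h₁))
        (mul_nonneg (sq_nonneg _) (h₂'.le.trans h₂)), Real.toNNReal_mul (sq_nonneg _),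
        Real.toNNReal_mul (sq_nonneg _)] at h
      convert h using 2 with ω
      simp only [hU, hU']
      ring) ρ y η
  have e : ∫⁻ ω, levelDensity y n (trigField fun k => Z k ω) x *
        levelDensity y n (trigField fun k => Z k ω) x' ∂P =
      ENNReal.ofReal (((n : ℝ) + 1) / 2) * ENNReal.ofReal (((n : ℝ) + 1) / 2) *
        P {ω | |U ω - y| ≤ η ∧ |(U' ω - ρ * U ω) + ρ * U ω - y| ≤ η} := by
    simp only [sub_add_cancel]
    have hs : MeasurableSet {ω | |U ω - y| ≤ η ∧ |U' ω - y| ≤ η} :=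
      (hZ.measurableSet_near x y η).inter (hZ.measurableSet_near x' y η)
    rw [← lintegral_indicator_const hs]
    refine lintegral_congr fun ω => ?_
    simp only [levelDensity, Set.indicator_apply, Set.mem_ofPred_eq, hU, hU', hη]
    by_cases h1 : |trigField (fun k => Z k ω) x - y| ≤ 1 / ((n : ℝ) + 1) <;>
      by_cases h2 : |trigField (fun k => Z k ω) x' - y| ≤ 1 / ((n : ℝ) + 1) <;>
      simp only [h1, h2, if_true, if_false, and_self, and_true, and_false, mul_zero, zero_mul]
  rw [e]
  refine (mul_le_mul_right hp _).trans ?_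
  have hs₁ : (Real.sqrt (2 * Real.pi * v₁.toNNReal))⁻¹ ≤ (Real.sqrt (2 * Real.pi * κ₁))⁻¹ := by
    rw [Real.coe_toNNReal _ (hκ₁.le.trans h₁)]
    gcongr
  have hs₂ : (Real.sqrt (2 * Real.pi * v₂.toNNReal))⁻¹ ≤
      (Real.sqrt (2 * Real.pi * κ₂))⁻¹ * dist x x' ^ (-H) := by
    rw [Real.coe_toNNReal _ (h₂'.le.trans h₂)]
    calc (Real.sqrt (2 * Real.pi * v₂))⁻¹
        ≤ (Real.sqrt (2 * Real.pi * (κ₂ * dist x x' ^ (2 * H))))⁻¹ := by gcongr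
      _ = _ := by
        rw [← mul_assoc, Real.sqrt_mul (by positivity), mul_inv, Real.sqrt_eq_rpow (dist x x' ^ _),
          ← Real.rpow_mul hd.le, Real.rpow_neg hd.le]
        congr 3; ring
  rw [edist_dist, ENNReal.ofReal_rpow_of_pos hd]
  simp only [← ENNReal.ofReal_mul' (show (0 : ℝ) ≤ 2 * η by positivity)]
  rw [← ENNReal.ofReal_mul (by positivity), ← ENNReal.ofReal_mul (by positivity),
    ← ENNReal.ofReal_mul (by positivity), ← ENNReal.ofReal_mul (by positivity)]
  refine ENNReal.ofReal_le_ofReal ?_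
  calc _ = (Real.sqrt (2 * Real.pi * v₁.toNNReal))⁻¹ * (Real.sqrt (2 * Real.pi * v₂.toNNReal))⁻¹ := by
        rw [hη]; field_simp
    _ ≤ (Real.sqrt (2 * Real.pi * κ₁))⁻¹ *
        ((Real.sqrt (2 * Real.pi * κ₂))⁻¹ * dist x x' ^ (-H)) := by gcongr
    _ = _ := by ring

/-- The mean `γ`-energies of the approximate local times are bounded as long as `γ + H < 2`. -/
lemma exists_lintegral_energy_le (hZ : IsGaussianFourier P H Z q c C) (y : ℝ) {γ : ℝ} (hγ : 0 ≤ γ)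
    (hγH : γ + H < 2) :
    ∃ B : ℝ≥0∞, B ≠ ∞ ∧ ∀ n : ℕ,
      ∫⁻ ω, rieszEnergy γ (approxLocalTime y n (trigField fun k => Z k ω)) ∂P ≤ B := by
  have := hZ.isProbabilityMeasure
  obtain ⟨B, hB, hle⟩ := hZ.exists_lintegral_levelDensity_mul_le y
  refine ⟨ENNReal.ofReal B * rieszEnergy (γ + H) ((volume : Measure Plane).restrict halfSquare),
    ENNReal.mul_ne_top ENNReal.ofReal_ne_top (rieszEnergy_halfSquare_lt_top hγH).ne, fun n => ?_⟩
  simp only [rieszEnergy_approxLocalTime (hZ.measurable_trigField_right _)]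
  have hm := hZ.measurable_energy_integrand y n γ
  rw [lintegral_lintegral_swap hm.aemeasurable, lintegral_prod]
  swap
  · exact (Measurable.lintegral_prod_left' hm).aemeasurable
  have hK : Measurable fun x : Plane => ∫⁻ x' in halfSquare, edist x x' ^ (-(γ + H)) :=
    Measurable.lintegral_prod_right' (f := fun p : Plane × Plane => edist p.1 p.2 ^ (-(γ + H)))
      (by fun_prop)
  rw [rieszEnergy, ← lintegral_const_mul _ hK]
  refine setLIntegral_mono' measurableSet_halfSquare fun x hx => ?_
  rw [← lintegral_const_mul _ (by fun_prop)]
  refine setLIntegral_mono' measurableSet_halfSquare fun x' hx' => ?_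
  have hd : Measurable fun ω => levelDensity y n (trigField fun k => Z k ω) x *
      levelDensity y n (trigField fun k => Z k ω) x' := by
    have h := hZ.measurable_levelDensity_trigField y n
    have h' : ∀ u : Plane, Measurable fun ω => levelDensity y n (trigField fun k => Z k ω) u :=
      fun u => Measurable.comp
        (g := fun p : Ω × Plane => levelDensity y n (trigField fun k => Z k p.1) p.2)
        (f := fun ω => (ω, u)) h measurable_prodMk_right
    exact (h' x).mul (h' x')
  rw [lintegral_mul_const _ hd]
  refine (mul_le_mul_left (hle n x hx x' hx') _).trans (le_of_eq ?_)
  rw [mul_assoc]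
  congr 1
  -- the exponent rule `d ^ (-H) * d ^ (-γ) = d ^ (-(γ + H))` holds on the diagonal too: both sides
  -- are `∞`
  rcases eq_or_ne (edist x x') 0 with h0 | h0
  · have hH := hZ.H_pos
    rw [h0, ENNReal.zero_rpow_of_neg (y := -H) (by linarith),
      ENNReal.zero_rpow_of_neg (y := -(γ + H)) (by linarith)]
    rcases hγ.eq_or_lt with rfl | hγ
    · simp
    · rw [ENNReal.zero_rpow_of_neg (by linarith)]; simp
  · rw [← ENNReal.rpow_add _ _ h0 (edist_ne_top _ _)]
    congr 1; ring

/-- With positive probability the level set has Hausdorff dimension at least `2 - H`. -/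
lemma exists_le_dimH_levelSet (hZ : IsGaussianFourier P H Z q c C) (y : ℝ) :
    ∃ E : Set Ω, MeasurableSet E ∧ 0 < P E ∧ ∀ ω ∈ E, Continuous (trigField fun k => Z k ω) →
      ENNReal.ofReal (2 - H) ≤ dimH (levelSet y (trigField fun k => Z k ω)) := by
  have := hZ.isProbabilityMeasure
  have hH := hZ.H_pos
  have hH1 := hZ.H_lt_one
  -- exponents increasing to `2 - H`
  set γ : ℕ → ℝ := fun m => (2 - H) * (1 - 1 / (m + 2)) with hγ
  have hm2 : ∀ m : ℕ, (0 : ℝ) < 1 / ((m : ℝ) + 2) ∧ 1 / ((m : ℝ) + 2) < 1 := fun m => by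
    have : (0 : ℝ) ≤ m := Nat.cast_nonneg m
    constructor
    · positivity
    · rw [div_lt_one (by positivity)]; linarith
  have hγ0 : ∀ m, 0 < γ m := fun m => mul_pos (by linarith) (by linarith [(hm2 m).2])
  have hγH : ∀ m, γ m + H < 2 := fun m => by
    simp only [hγ]
    nlinarith [(hm2 m).1]
  have hγlim : Filter.Tendsto γ Filter.atTop (nhds (2 - H)) := by
    have h : Filter.Tendsto (fun m : ℕ => 1 / ((m : ℝ) + 2)) Filter.atTop (nhds 0) :=
      tendsto_const_nhds.div_atTop
        (tendsto_natCast_atTop_atTop.atTop_add tendsto_const_nhds)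
    have h2 := (h.const_sub 1).const_mul (2 - H)
    simpa [hγ] using h2
  obtain ⟨a, ha, ha', hmass⟩ := hZ.exists_le_lintegral_mass y
  obtain ⟨b, hb, hmass2⟩ := hZ.exists_lintegral_energy_le y le_rfl (by linarith : (0 : ℝ) + H < 2)
  choose B hB hen using fun m => hZ.exists_lintegral_energy_le y (hγ0 m).le (hγH m)
  obtain ⟨E, A, hE, hPE, hA, hfreq⟩ := exists_frequently_mass_energy (P := P)
    (fun n => hZ.measurable_mass y n) (fun m n => hZ.measurable_energy y n (γ m)) ha ha' hb hmass
    (fun n => by simpa only [rieszEnergy_zero] using hmass2 n) hB hen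
  refine ⟨E, hE, hPE, fun ω hω hc => ?_⟩
  have hm : ∀ m, ENNReal.ofReal (γ m) ≤ dimH (levelSet y (trigField fun k => Z k ω)) := fun m => by
    refine le_dimH_of_rieszEnergy (γ := (γ m).toNNReal) (by simpa using hγ0 m)
      (fun n => approxLocalTime y n (trigField fun k => Z k ω)) (ENNReal.half_pos ha).ne'
      (by finiteness) (hA m) (fun U hU hLU => eventually_approxLocalTime_compl hc hU hLU)
      ((hfreq ω hω).mono fun n hn => ⟨hn.1, ?_⟩)
    rw [Real.coe_toNNReal _ (hγ0 m).le]
    exact hn.2 m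
  exact le_of_tendsto' (ENNReal.tendsto_ofReal hγlim) hm

end IsGaussianFourier

end LocalTime

/-! ### Ornstein–Uhlenbeck processes as limits of sums of Wiener increments -/

section Deterministic

/-- Riemann–Stieltjes sums over the uniform partition of `[0, t]` converge. -/
lemma tendsto_riemann_sum {f g : ℝ → ℝ} (hf : Continuous f) (hg : Continuous g) {t : ℝ}
    (ht : 0 ≤ t) (ξ : ℕ → ℕ → ℝ)
    (hξ : ∀ n i : ℕ, ξ n i ∈ Set.Icc (i * t / (n + 1)) ((i + 1 : ℕ) * t / (n + 1))) :
    Filter.Tendsto (fun n : ℕ => ∑ i ∈ Finset.range (n + 1),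
      f (ξ n i) * ∫ r in (i * t / (n + 1))..((i + 1 : ℕ) * t / (n + 1)), g r) Filter.atTop
      (nhds (∫ r in (0 : ℝ)..t, f r * g r)) := by
  rw [Metric.tendsto_atTop]
  intro ε hε
  set K : ℝ := (∫ r in (0 : ℝ)..t, |g r|) + 1 with hK
  have hK0 : 0 < K := by
    have : 0 ≤ ∫ r in (0 : ℝ)..t, |g r| :=
      intervalIntegral.integral_nonneg ht fun _ _ => abs_nonneg _
    linarith
  obtain ⟨δ, hδ, hunif⟩ := Metric.uniformContinuousOn_iff.1
    (isCompact_Icc.uniformContinuousOn_of_continuous (s := Set.Icc 0 t) hf.continuousOn)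
    (ε / K) (by positivity)
  obtain ⟨N, hN⟩ := exists_nat_gt (t / δ)
  refine ⟨N, fun n hn => ?_⟩
  have hn0 : (0 : ℝ) < (n : ℝ) + 1 := by positivity
  have hmesh : t / (n + 1) < δ := by
    rw [div_lt_iff₀ hδ] at hN
    rw [div_lt_iff₀ hn0]
    have : (N : ℝ) ≤ n := by exact_mod_cast hn
    nlinarith
  set s : ℕ → ℝ := fun i => i * t / (n + 1) with hs
  have hmono : ∀ i, s i ≤ s (i + 1) := fun i => by
    simp only [hs]; push_cast; gcongr; linarith
  have hs0 : s 0 = 0 := by simp [hs]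
  have hsn : s (n + 1) = t := by simp only [hs]; push_cast; field_simp
  have hsucc : ∀ i, s (i + 1) - s i < δ := fun i => by
    have : s (i + 1) - s i = t / (n + 1) := by simp only [hs]; push_cast; ring
    rw [this]; exact hmesh
  have hsplit : ∀ h : ℝ → ℝ, Continuous h →
      ∑ i ∈ Finset.range (n + 1), ∫ r in s i..s (i + 1), h r = ∫ r in (0 : ℝ)..t, h r := by
    intro h hh
    rw [intervalIntegral.sum_integral_adjacent_intervals fun k _ => hh.intervalIntegrable _ _,
      hs0, hsn]
  have hmem : ∀ i < n + 1, ∀ r ∈ Set.Icc (s i) (s (i + 1)), r ∈ Set.Icc 0 t := by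
    intro i hi r hr
    have hsm : Monotone s := monotone_nat_of_le_succ hmono
    exact ⟨hs0 ▸ (hsm (Nat.zero_le i)).trans hr.1, hr.2.trans (hsn ▸ hsm hi)⟩
  rw [← hsplit (fun r => f r * g r) (hf.mul hg), Real.dist_eq, ← Finset.sum_sub_distrib]
  have hterm : ∀ i ∈ Finset.range (n + 1),
      |f (ξ n i) * (∫ r in s i..s (i + 1), g r) - ∫ r in s i..s (i + 1), f r * g r| ≤
        ε / K * ∫ r in s i..s (i + 1), |g r| := by
    intro i hi
    have hi := Finset.mem_range.1 hi
    rw [← intervalIntegral.integral_const_mul, ← intervalIntegral.integral_const_mul,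
      ← intervalIntegral.integral_sub (Continuous.intervalIntegrable (by fun_prop) _ _)
        (Continuous.intervalIntegrable (by fun_prop) _ _), ← Real.norm_eq_abs]
    refine (intervalIntegral.norm_integral_le_integral_norm (hmono i)).trans ?_
    refine intervalIntegral.integral_mono_on (hmono i) (Continuous.intervalIntegrable
      (by fun_prop) _ _) (Continuous.intervalIntegrable (by fun_prop) _ _) fun r hr => ?_
    rw [← sub_mul, norm_mul, Real.norm_eq_abs, Real.norm_eq_abs]
    refine mul_le_mul_of_nonneg_right ?_ (abs_nonneg _)
    have hd : dist (ξ n i) r < δ := by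
      have h1 := hξ n i
      rw [Real.dist_eq]
      refine lt_of_le_of_lt ?_ (hsucc i)
      rw [abs_le]
      constructor <;> linarith [h1.1, h1.2, hr.1, hr.2]
    have := hunif _ (hmem i hi _ (hξ n i)) _ (hmem i hi _ hr) hd
    rw [Real.dist_eq] at this
    exact this.le
  calc _ ≤ ∑ i ∈ Finset.range (n + 1), ε / K * ∫ r in s i..s (i + 1), |g r| :=
        (Finset.abs_sum_le_sum_abs _ _).trans (Finset.sum_le_sum hterm)
    _ = ε / K * (K - 1) := by
        rw [← Finset.mul_sum, hsplit _ hg.abs, hK]; ring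
    _ < ε := by
        rw [div_mul_eq_mul_div, div_lt_iff₀ hK0]
        nlinarith

/-- Summation by parts. -/
lemma sum_mul_sub_succ (G w : ℕ → ℝ) (n : ℕ) :
    ∑ i ∈ Finset.range n, G i * (w (i + 1) - w i) =
      G n * w n - G 0 * w 0 - ∑ i ∈ Finset.range n, w (i + 1) * (G (i + 1) - G i) := by
  induction n with
  | zero => simp
  | succ n ih => rw [Finset.sum_range_succ, Finset.sum_range_succ, ih]; ring

/-- The integrating factor `exp (-a (t - r))`. -/
noncomputable def decay (a t r : ℝ) : ℝ := Real.exp (-(a * (t - r)))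

lemma continuous_decay (a t : ℝ) : Continuous (decay a t) := by
  unfold decay; fun_prop

lemma hasDerivAt_decay (a t r : ℝ) : HasDerivAt (decay a t) (a * decay a t r) r := by
  have h1 : HasDerivAt (fun r => -(a * (t - r))) a r := by
    exact (((hasDerivAt_id r).const_sub t).const_mul a).neg.congr_deriv (by simp)
  exact h1.exp.congr_deriv (mul_comm _ _)

lemma integral_decay_sq {a : ℝ} (ha : a ≠ 0) (t : ℝ) :
    ∫ r in (0 : ℝ)..t, decay a t r ^ 2 = (1 - Real.exp (-(2 * a * t))) / (2 * a) := by
  have h : ∀ r ∈ Set.uIcc 0 t, HasDerivAt (fun r => decay a t r ^ 2 / (2 * a)) (decay a t r ^ 2) r := by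
    intro r _
    refine (((hasDerivAt_decay a t r).pow 2).div_const (2 * a)).congr_deriv ?_
    simp only [Nat.cast_ofNat, Nat.add_one_sub_one, pow_one]
    field_simp
  rw [intervalIntegral.integral_eq_sub_of_hasDerivAt h
    (((continuous_decay a t).pow 2).intervalIntegrable _ _), ← sub_div]
  congr 1
  simp only [decay, ← Real.exp_nat_mul]
  norm_num
  ring_nf

/-- Variation of constants for `u + ∫ a u = w`. -/
lemma eq_sub_integral_decay {a t : ℝ} (ht : 0 ≤ t) {u w : ℝ → ℝ} (hw : Continuous w)
    (hint : ∀ s, 0 ≤ s → IntervalIntegrable (fun r => a * u r) volume 0 s)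
    (heq : ∀ s, 0 ≤ s → u s + ∫ r in (0 : ℝ)..s, a * u r = w s) :
    u t = w t - ∫ r in (0 : ℝ)..t, w r * (a * decay a t r) := by
  set U : ℝ → ℝ := fun s => ∫ r in (0 : ℝ)..s, a * u r with hU
  have hUc : ContinuousOn U (Set.Ici 0) := by
    intro s hs
    have hI : IntegrableOn (fun r => a * u r) (Set.uIcc 0 (s + 1)) := by
      have := hint (s + 1) (by linarith [Set.mem_Ici.1 hs])
      rwa [intervalIntegrable_iff', ] at this
    have h1 := intervalIntegral.continuousOn_primitive_interval hI
    have hs' := Set.mem_Ici.1 hs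
    rw [Set.uIcc_of_le (by linarith)] at h1
    have h2 := h1 s ⟨hs', by linarith⟩
    refine h2.mono_of_mem_nhdsWithin ?_
    rw [mem_nhdsWithin]
    exact ⟨Set.Iio (s + 1), isOpen_Iio, by simp, fun r hr => ⟨hr.2, le_of_lt hr.1⟩⟩
  have huc : ContinuousOn u (Set.Ici 0) := by
    refine (hw.continuousOn.sub hUc).congr fun s hs => ?_
    have := heq s hs
    simp only [hU, Pi.sub_apply]
    linarith
  have hderiv : ∀ s ∈ Set.Ioo 0 t, HasDerivWithinAt (fun r => decay a t r * U r)
      (w s * (a * decay a t s)) (Set.Ioi s) s := by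
    intro s hs
    have hcs : ContinuousOn (fun r => a * u r) (Set.Ioi 0) :=
      continuousOn_const.mul (huc.mono Set.Ioi_subset_Ici_self)
    have hUd : HasDerivAt U (a * u s) s :=
      intervalIntegral.integral_hasDerivAt_right (hint s hs.1.le)
        (hcs.stronglyMeasurableAtFilter isOpen_Ioi s hs.1)
        (hcs.continuousAt (Ioi_mem_nhds hs.1))
    have h := (hasDerivAt_decay a t s).mul hUd
    refine (h.congr_deriv ?_).hasDerivWithinAt
    rw [← heq s hs.1.le]
    ring
  have hFTC := intervalIntegral.integral_eq_sub_of_hasDeriv_right_of_le ht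
    ((continuous_decay a t).continuousOn.mul (hUc.mono Set.Icc_subset_Ici_self)) hderiv
    ((hw.mul (continuous_const.mul (continuous_decay a t))).intervalIntegrable _ _)
  have e0 : U 0 = 0 := by simp [hU]
  have et : decay a t t = 1 := by simp [decay]
  simp only [Pi.mul_apply, e0, et] at hFTC
  rw [hFTC]
  have := heq t ht
  simp only [hU]
  linarith

/-- The solution of `u + ∫ a u = w` is the limit of the sums approximating `∫ exp (-a (t - r)) dw`. -/
lemma tendsto_sum_decay_mul_sub {a t : ℝ} (ht : 0 ≤ t) {u w : ℝ → ℝ} (hw : Continuous w)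
    (hw0 : w 0 = 0) (hint : ∀ s, 0 ≤ s → IntervalIntegrable (fun r => a * u r) volume 0 s)
    (heq : ∀ s, 0 ≤ s → u s + ∫ r in (0 : ℝ)..s, a * u r = w s) :
    Filter.Tendsto (fun n : ℕ => ∑ i ∈ Finset.range (n + 1), decay a t (i * t / (n + 1)) *
      (w ((i + 1 : ℕ) * t / (n + 1)) - w (i * t / (n + 1)))) Filter.atTop (nhds (u t)) := by
  have hR := (tendsto_riemann_sum hw (continuous_const.mul (continuous_decay a t)) ht
    (fun n i : ℕ => (i + 1 : ℕ) * t / (n + 1)) (g := fun r => a * decay a t r)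
    (fun n i : ℕ => ⟨by push_cast; gcongr; linarith, le_rfl⟩)).const_sub (w t)
  rw [← eq_sub_integral_decay ht hw hint heq] at hR
  refine hR.congr fun n => ?_
  have hn0 : (0 : ℝ) < (n : ℝ) + 1 := by positivity
  have h := sum_mul_sub_succ (fun i : ℕ => decay a t (i * t / (n + 1))) (fun i : ℕ => w (i * t / (n + 1)))
    (n + 1)
  have et : decay a t ((n + 1 : ℕ) * t / (n + 1)) = 1 := by
    have : ((n + 1 : ℕ) : ℝ) * t / (n + 1) = t := by push_cast; field_simp
    rw [this]; simp [decay]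
  have ew : w ((n + 1 : ℕ) * t / (n + 1)) = w t := by
    congr 1; push_cast; field_simp
  simp only [et, ew] at h
  rw [h]
  have e0 : w ((0 : ℕ) * t / (n + 1)) = 0 := by simp [hw0]
  rw [e0, one_mul, mul_zero, sub_zero]
  congr 1
  refine Finset.sum_congr rfl fun i _ => ?_
  congr 1
  exact intervalIntegral.integral_eq_sub_of_hasDerivAt (fun r _ => hasDerivAt_decay a t r)
    ((continuous_const.mul (continuous_decay a t)).intervalIntegrable _ _)

end Deterministic

section Wiener

variable {Ω : Type*} [MeasurableSpace Ω] {P : Measure Ω}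

/-- A finite combination of uncorrelated centred jointly Gaussian variables. -/
lemma hasLaw_sum_of_uncorrelated {T : Type*} {X : T → Ω → ℝ} (hX : IsGaussianProcess X P)
    (h0 : ∀ i, ∫ ω, X i ω ∂P = 0) (v : T → ℝ) (hv : ∀ i, cov[X i, X i; P] = v i)
    (hcov : ∀ i j, i ≠ j → cov[X i, X j; P] = 0) (I : Finset T) (c : T → ℝ) :
    HasLaw (fun ω => ∑ i ∈ I, c i * X i ω) (gaussianReal 0 (∑ i ∈ I, c i ^ 2 * v i).toNNReal) P := by
  have := hX.isProbabilityMeasure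
  have hL2 : ∀ i, MemLp (fun ω => c i * X i ω) 2 P := fun i =>
    (hX.hasGaussianLaw_eval i).memLp_two.const_mul (c i)
  have hG : HasGaussianLaw (fun ω => ∑ i ∈ I, c i * X i ω) P := by
    simpa using (hX.smul c).hasGaussianLaw_fun_sum (I := I)
  refine ⟨hG.aemeasurable, ?_⟩
  rw [hG.map_eq_gaussianReal]
  congr 1
  · rw [integral_finsetSum _ fun i _ => (hL2 i).integrable (by norm_num)]
    refine Finset.sum_eq_zero fun i _ => ?_
    rw [integral_const_mul, h0, mul_zero]
  · congr 1
    rw [← covariance_self hG.aemeasurable, covariance_fun_sum_fun_sum' (fun i _ => hL2 i)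
      (fun i _ => hL2 i)]
    refine Finset.sum_congr rfl fun i hi => ?_
    rw [Finset.sum_eq_single i]
    · rw [covariance_const_mul_left, covariance_const_mul_right, hv]; ring
    · intro j _ hj
      rw [covariance_const_mul_left, covariance_const_mul_right, hcov i j hj.symm]; ring
    · exact fun h => absurd hi h

variable {V K : Type*} [NormedAddCommGroup V] [InnerProductSpace ℝ V] {W : ℝ≥0 → V → Ω → ℝ}

/-- Weighted sums of the increments of a cylindrical Wiener process along orthogonal directions. -/
lemma IsCylindricalWiener.hasLaw_sum_increments (hW : IsCylindricalWiener W P) {φ : K → V}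
    (hφ : ∀ k l, k ≠ l → ⟪φ k, φ l⟫ = 0) {τ : ℕ → ℝ≥0} (hτ : Monotone τ) (I : Finset (ℕ × K))
    (c : ℕ × K → ℝ) :
    HasLaw (fun ω => ∑ p ∈ I, c p * (W (τ (p.1 + 1)) (φ p.2) ω - W (τ p.1) (φ p.2) ω))
      (gaussianReal 0 (∑ p ∈ I, c p ^ 2 *
        ((τ (p.1 + 1) - τ p.1 : ℝ) * ⟪φ p.2, φ p.2⟫)).toNNReal) P := by
  classical
  have := hW.gaussian.isProbabilityMeasure
  have hL2 : ∀ s v, MemLp (W s v) 2 P := fun s v =>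
    (hW.gaussian.hasGaussianLaw_eval (s, v)).memLp_two
  have hcov : ∀ i j k l, cov[fun ω => W (τ (i + 1)) (φ k) ω - W (τ i) (φ k) ω,
      fun ω => W (τ (j + 1)) (φ l) ω - W (τ j) (φ l) ω; P] =
      if i = j then (τ (i + 1) - τ i : ℝ) * ⟪φ k, φ l⟫ else 0 := by
    intro i j k l
    rw [covariance_fun_sub_fun_sub (hL2 _ _) (hL2 _ _) (hL2 _ _) (hL2 _ _), hW.covariance,
      hW.covariance, hW.covariance, hW.covariance]
    rcases lt_trichotomy i j with h | h | h
    · rw [if_neg h.ne, min_eq_left (hτ (by omega)), min_eq_left (hτ (by omega)),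
        min_eq_left (hτ (by omega)), min_eq_left (hτ (by omega))]
      ring
    · subst h
      rw [if_pos rfl, min_eq_left le_rfl, min_eq_right (hτ (by omega)),
        min_eq_left (hτ (by omega)), min_eq_left le_rfl]
      ring
    · rw [if_neg h.ne', min_eq_right (hτ (by omega)), min_eq_right (hτ (by omega)),
        min_eq_right (hτ (by omega)), min_eq_right (hτ (by omega))]
      ring
  refine hasLaw_sum_of_uncorrelated
    (X := fun (p : ℕ × K) ω => W (τ (p.1 + 1)) (φ p.2) ω - W (τ p.1) (φ p.2) ω) ?_ ?_ _
    (fun p => ?_) (fun p r hpr => ?_) I c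
  · refine hW.gaussian.of_isGaussianProcess fun p =>
      ⟨{(τ (p.1 + 1), φ p.2), (τ p.1, φ p.2)},
        ContinuousLinearMap.proj ⟨(τ (p.1 + 1), φ p.2), by simp⟩ -
          ContinuousLinearMap.proj ⟨(τ p.1, φ p.2), by simp⟩, fun ω => ?_⟩
    simp
  · intro p
    rw [integral_sub ((hL2 _ _).integrable (by norm_num)) ((hL2 _ _).integrable (by norm_num)),
      hW.centred, hW.centred, sub_zero]
  · rw [hcov, if_pos rfl]
  · rw [hcov]
    split_ifs with h
    · rw [hφ _ _ fun h' => hpr (Prod.ext h h'), mul_zero]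
    · rfl

end Wiener

/-! ### The Fourier coefficients of the solution -/

section Coefficients

/-- The basis vectors are eigenvectors. The case `k = 0` is included: there both sides vanish. -/
lemma isFracLaplacian_modeVec (α : ℝ) (k : ℤ × ℤ) :
    IsFracLaplacian α (modeVec k) (freqNorm k ^ (2 * α) • modeVec k) := by
  intro l hl
  rw [← inner_modeVec hl, ← inner_modeVec hl]
  refine (real_inner_smul_left (modeVec k) (modeVec l) _).trans ?_
  rcases eq_or_ne k l with rfl | h
  · rfl
  · rcases eq_or_ne k 0 with rfl | hk
    · simp [modeVec]
    · rw [inner_modeVec hl, fourierCoeffReal_modeVec hk hl, if_neg h, mul_zero, mul_zero]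

lemma one_le_freqNorm {k : ℤ × ℤ} (hk : k ≠ 0) : 1 ≤ freqNorm k := by
  have h : 0 < k.1 ^ 2 + k.2 ^ 2 := by
    rcases eq_or_ne k.1 0 with h1 | h1
    · have : k.2 ≠ 0 := fun h2 => hk (Prod.ext h1 h2)
      positivity
    · positivity
  rw [freqNorm, Real.one_le_sqrt]
  exact_mod_cast h

/-- As `S` is symmetric with `S ∘ S = C`, the vectors `S e_k` inherit orthogonality from the
diagonal operator `C`. -/
lemma inner_sqrt_modeVec_of_ne {α δ : ℝ} {C S : L2Mean0 →L[ℝ] L2Mean0} (hC : NoiseAssumption α δ C)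
    (hS : IsPositiveSqrt S C) {k l : ℤ × ℤ} (h : k ≠ l) :
    ⟪S (modeVec k), S (modeVec l)⟫ = 0 := by
  rcases eq_or_ne k 0 with rfl | hk
  · simp [modeVec]
  rcases eq_or_ne l 0 with rfl | hl
  · simp [modeVec]
  obtain ⟨σ, c₁, c₂, -, -, hσ, -⟩ := hC.diagonal
  have hsymm := hS.positive.isSymmetric (S (modeVec k)) (modeVec l)
  have hSS : S (S (modeVec k)) = C (modeVec k) := by rw [← hS.sq_eq]; rfl
  change ⟪S (S (modeVec k)), modeVec l⟫ = ⟪S (modeVec k), S (modeVec l)⟫ at hsymm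
  rw [← hsymm, hSS, inner_modeVec hl, hσ _ _ hl, fourierCoeffReal_modeVec hk hl, if_neg h, mul_zero]

lemma exists_inner_sqrt_modeVec_bounds {α δ : ℝ} {C S : L2Mean0 →L[ℝ] L2Mean0}
    (hC : NoiseAssumption α δ C) (hS : IsPositiveSqrt S C) :
    ∃ c₁ c₂ : ℝ, 0 < c₁ ∧ 0 < c₂ ∧ ∀ k : ℤ × ℤ, k ≠ 0 →
      c₁ * freqNorm k ^ (-(2 * δ)) ≤ ⟪S (modeVec k), S (modeVec k)⟫ ∧
        ⟪S (modeVec k), S (modeVec k)⟫ ≤ c₂ * freqNorm k ^ (-(2 * δ)) := by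
  obtain ⟨σ, c₁, c₂, hc₁, hc₂, hσ, hb⟩ := hC.diagonal
  refine ⟨c₁ ^ 2, c₂ ^ 2, by positivity, by positivity, fun k hk => ?_⟩
  have hsymm := hS.positive.isSymmetric (S (modeVec k)) (modeVec k)
  have hSS : S (S (modeVec k)) = C (modeVec k) := by rw [← hS.sq_eq]; rfl
  change ⟪S (S (modeVec k)), modeVec k⟫ = ⟪S (modeVec k), S (modeVec k)⟫ at hsymm
  rw [← hsymm, hSS, inner_modeVec hk, hσ _ _ hk, fourierCoeffReal_modeVec hk hk, if_pos rfl, mul_one,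
    ← sq_abs (σ k)]
  have hn := freqNorm_pos hk
  have e : ∀ c : ℝ, c ^ 2 * freqNorm k ^ (-(2 * δ)) = (c / freqNorm k ^ δ) ^ 2 := by
    intro c
    rw [div_pow, Real.rpow_neg hn.le, div_eq_mul_inv, two_mul, Real.rpow_add hn, sq (freqNorm k ^ δ)]
  rw [e, e]
  exact ⟨pow_le_pow_left₀ (by positivity) (hb k hk).1 2,
    pow_le_pow_left₀ (abs_nonneg _) (hb k hk).2 2⟩

variable {Ω : Type*} [MeasurableSpace Ω] {P : Measure Ω} {ν α δ : ℝ}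
  {C S : L2Mean0 →L[ℝ] L2Mean0} {W : ℝ≥0 → L2Mean0 → Ω → ℝ} {z : ℝ≥0 → Ω → L2Mean0}

/-- The relaxation rate `ν |k| ^ (2 α)` of the mode `k`. -/
noncomputable def relaxRate (ν α : ℝ) (k : ℤ × ℤ) : ℝ := ν * freqNorm k ^ (2 * α)

/-- The variance of the `k`-th Fourier coefficient of the solution at time `t`. -/
noncomputable def modeVariance (ν α : ℝ) (S : L2Mean0 →L[ℝ] L2Mean0) (t : ℝ≥0) (k : ℤ × ℤ) : ℝ :=
  ⟪S (modeVec k), S (modeVec k)⟫ * ∫ r in (0 : ℝ)..t, decay (relaxRate ν α k) t r ^ 2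

lemma sum_product_sq_mul {ι κ : Type*} (I : Finset ι) (F : Finset κ) (a : κ → ℝ) (d : κ → ι → ℝ)
    (x : ι → ℝ) (g : κ → ℝ) :
    ∑ p ∈ I ×ˢ F, (a p.2 * d p.2 p.1) ^ 2 * (x p.1 * g p.2) =
      ∑ k ∈ F, a k ^ 2 * (g k * ∑ i ∈ I, d k i ^ 2 * x i) := by
  rw [Finset.sum_product_right]
  refine Finset.sum_congr rfl fun k _ => ?_
  rw [Finset.mul_sum, Finset.mul_sum]
  exact Finset.sum_congr rfl fun i _ => by ring

/-- The `k`-th coefficient of the solution as a limit of weighted Wiener increments. -/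
lemma IsLinearSolution.ae_tendsto_sum (hW : IsCylindricalWiener W P)
    (hz : IsLinearSolution ν α S W P z) (t : ℝ≥0) (k : ℤ × ℤ) :
    ∀ᵐ ω ∂P, Filter.Tendsto (fun n : ℕ => ∑ i ∈ Finset.range (n + 1),
      decay (relaxRate ν α k) t (i * t / (n + 1)) *
        (W ((i + 1 : ℕ) * t / (n + 1) : ℝ).toNNReal (S (modeVec k)) ω -
          W (i * t / (n + 1) : ℝ).toNNReal (S (modeVec k)) ω)) Filter.atTop
      (nhds ⟪z t ω, modeVec k⟫) := by
  filter_upwards [hz.initial, hz.weak _ _ (isFracLaplacian_modeVec α k),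
    hW.continuous_paths (S (modeVec k))] with ω h0 hweak hcont
  have hinner : ∀ s : ℝ, ν * ⟪z s.toNNReal ω, freqNorm k ^ (2 * α) • modeVec k⟫ =
      relaxRate ν α k * ⟪z s.toNNReal ω, modeVec k⟫ := fun s => by
    rw [relaxRate, mul_assoc]
    exact congrArg (ν * ·) (real_inner_smul_right (z s.toNNReal ω) (modeVec k) _)
  have hw0 : W 0 (S (modeVec k)) ω = 0 := by
    have := (hweak 0).2
    simpa [h0] using this.symm
  have h := tendsto_sum_decay_mul_sub (a := relaxRate ν α k) (t := t) t.coe_nonneg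
    (u := fun s => ⟪z s.toNNReal ω, modeVec k⟫)
    (w := fun s => W s.toNNReal (S (modeVec k)) ω) (hcont.comp continuous_real_toNNReal)
    (by simpa using hw0) (fun s hs => ?_) (fun s hs => ?_)
  · simpa using h
  · have := (hweak s.toNNReal).1.const_mul ν
    rw [Real.coe_toNNReal s hs] at this
    simpa only [hinner] using this
  · have := (hweak s.toNNReal).2
    rw [Real.coe_toNNReal s hs, ← intervalIntegral.integral_const_mul] at this
    simpa only [hinner] using this

/-- The Fourier coefficients of the solution are independent centred Gaussian variables. -/
lemma IsLinearSolution.hasLaw_sum_inner (hC : NoiseAssumption α δ C) (hS : IsPositiveSqrt S C)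
    (hW : IsCylindricalWiener W P) (hz : IsLinearSolution ν α S W P z) (t : ℝ≥0)
    (F : Finset (ℤ × ℤ)) (a : ℤ × ℤ → ℝ) :
    HasLaw (fun ω => ∑ k ∈ F, a k * ⟪z t ω, modeVec k⟫)
      (gaussianReal 0 (∑ k ∈ F, a k ^ 2 * modeVariance ν α S t k).toNNReal) P := by
  have := hW.gaussian.isProbabilityMeasure
  set τ : ℕ → ℕ → ℝ≥0 := fun n i => (i * t / (n + 1) : ℝ).toNNReal with hτ
  have hτmono : ∀ n, Monotone (τ n) := fun n i j hij => by
    refine Real.toNNReal_mono ?_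
    gcongr
  have hτc : ∀ n i : ℕ, (τ n i : ℝ) = i * t / (n + 1) := fun n i =>
    Real.coe_toNNReal _ (by positivity)
  have hlaw := fun n : ℕ => hW.hasLaw_sum_increments (φ := fun k => S (modeVec k))
    (fun k l h => inner_sqrt_modeVec_of_ne hC hS h) (hτmono n) (Finset.range (n + 1) ×ˢ F)
    (fun p => a p.2 * decay (relaxRate ν α p.2) t (p.1 * t / (n + 1)))
  refine hasLaw_gaussianReal_of_tendsto hlaw ?_ ?_
  · have hall : ∀ᵐ ω ∂P, ∀ k : ℤ × ℤ, Filter.Tendsto (fun n : ℕ => ∑ i ∈ Finset.range (n + 1),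
      decay (relaxRate ν α k) t (i * t / (n + 1)) *
        (W ((i + 1 : ℕ) * t / (n + 1) : ℝ).toNNReal (S (modeVec k)) ω -
          W (i * t / (n + 1) : ℝ).toNNReal (S (modeVec k)) ω)) Filter.atTop
      (nhds ⟪z t ω, modeVec k⟫) := ae_all_iff.2 fun k => hz.ae_tendsto_sum hW t k
    filter_upwards [hall] with ω hω
    refine (tendsto_finsetSum F fun k _ => (hω k).const_mul (a k)).congr fun n => ?_
    rw [Finset.sum_product_right]
    refine Finset.sum_congr rfl fun k _ => ?_
    rw [Finset.mul_sum]
    refine Finset.sum_congr rfl fun i _ => ?_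
    simp only [hτ]
    ring
  · have hk : ∀ k : ℤ × ℤ, Filter.Tendsto (fun n : ℕ => ∑ i ∈ Finset.range (n + 1),
        decay (relaxRate ν α k) t (i * t / (n + 1)) ^ 2 *
          ((i + 1 : ℕ) * t / (n + 1) - i * t / (n + 1))) Filter.atTop
        (nhds (∫ r in (0 : ℝ)..t, decay (relaxRate ν α k) t r ^ 2)) := by
      intro k
      have := tendsto_riemann_sum ((continuous_decay (relaxRate ν α k) t).pow 2)
        (continuous_const (y := (1 : ℝ))) t.coe_nonneg (fun n i : ℕ => i * t / (n + 1))
        (fun n i : ℕ => ⟨le_rfl, by push_cast; gcongr; linarith⟩)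
      simpa using this
    have hsum : Filter.Tendsto (fun n : ℕ => ∑ p ∈ Finset.range (n + 1) ×ˢ F,
        (a p.2 * decay (relaxRate ν α p.2) t (p.1 * t / (n + 1))) ^ 2 *
          ((τ n (p.1 + 1) - τ n p.1 : ℝ) * ⟪S (modeVec p.2), S (modeVec p.2)⟫)) Filter.atTop
        (nhds (∑ k ∈ F, a k ^ 2 * modeVariance ν α S t k)) := by
      have h := tendsto_finsetSum F fun k _ =>
        ((hk k).const_mul ⟪S (modeVec k), S (modeVec k)⟫).const_mul (a k ^ 2)
      refine h.congr fun n => ?_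
      simp only [hτc]
      exact (sum_product_sq_mul _ F a (fun k (i : ℕ) => decay (relaxRate ν α k) t (i * t / (n + 1)))
        (fun i : ℕ => (i + 1 : ℕ) * t / (n + 1) - i * t / (n + 1)) _).symm
    exact (continuous_real_toNNReal.tendsto _).comp hsum

lemma exists_modeVariance_bounds (hν : 0 < ν) (hα : 1 ≤ α) (hC : NoiseAssumption α δ C)
    (hS : IsPositiveSqrt S C) {t : ℝ≥0} (ht : 0 < t) :
    ∃ c c' : ℝ, 0 < c ∧ ∀ k : ℤ × ℤ, k ≠ 0 →
      c * freqNorm k ^ (-(2 + 2 * (α + δ - 1))) ≤ modeVariance ν α S t k ∧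
      modeVariance ν α S t k ≤ c' * freqNorm k ^ (-(2 + 2 * (α + δ - 1))) := by
  obtain ⟨c₁, c₂, hc₁, hc₂, hb⟩ := exists_inner_sqrt_modeVec_bounds hC hS
  have ht' : (0 : ℝ) < t := ht
  have hexp : Real.exp (-(2 * ν * t)) < 1 := by
    rw [Real.exp_lt_one_iff]
    have : 0 < 2 * ν * t := by positivity
    linarith
  refine ⟨c₁ * ((1 - Real.exp (-(2 * ν * t))) / (2 * ν)), c₂ * (1 / (2 * ν)),
    mul_pos hc₁ (div_pos (by linarith) (by positivity)), fun k hk => ?_⟩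
  have hn := freqNorm_pos hk
  have hl : 1 ≤ freqNorm k ^ (2 * α) := Real.one_le_rpow (one_le_freqNorm hk) (by linarith)
  have ha : ν ≤ relaxRate ν α k := le_mul_of_one_le_right hν.le hl
  have hpow : freqNorm k ^ (-(2 + 2 * (α + δ - 1))) =
      freqNorm k ^ (-(2 * δ)) * (freqNorm k ^ (2 * α))⁻¹ := by
    rw [← Real.rpow_neg hn.le, ← Real.rpow_add hn]
    congr 1; ring
  have hint : ∫ r in (0 : ℝ)..t, decay (relaxRate ν α k) t r ^ 2 =
      (1 - Real.exp (-(2 * relaxRate ν α k * t))) / (2 * ν) * (freqNorm k ^ (2 * α))⁻¹ := by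
    rw [integral_decay_sq (by linarith)]
    conv_lhs => rw [show 2 * relaxRate ν α k = 2 * ν * freqNorm k ^ (2 * α) by
      rw [relaxRate]; ring]
    rw [← div_div, div_eq_mul_inv _ (freqNorm k ^ (2 * α)),
      show 2 * relaxRate ν α k = 2 * ν * freqNorm k ^ (2 * α) by rw [relaxRate]; ring]
  have hli : 0 < (freqNorm k ^ (2 * α))⁻¹ := by positivity
  have hdl : 0 ≤ freqNorm k ^ (-(2 * δ)) := by positivity
  rw [modeVariance, hint, hpow]
  constructor
  · calc _ = c₁ * freqNorm k ^ (-(2 * δ)) *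
        ((1 - Real.exp (-(2 * ν * t))) / (2 * ν) * (freqNorm k ^ (2 * α))⁻¹) := by ring
      _ ≤ _ := by
        have h1 : 0 ≤ (1 - Real.exp (-(2 * ν * t))) / (2 * ν) :=
          div_nonneg (by linarith) (by positivity)
        have h2 : 1 - Real.exp (-(2 * ν * t)) ≤ 1 - Real.exp (-(2 * relaxRate ν α k * t)) := by
          gcongr
        refine mul_le_mul (hb k hk).1 ?_ (mul_nonneg h1 hli.le) ((by positivity : (0 : ℝ) ≤ _).trans (hb k hk).1)
        gcongr
  · calc _ ≤ c₂ * freqNorm k ^ (-(2 * δ)) * (1 / (2 * ν) * (freqNorm k ^ (2 * α))⁻¹) := by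
          have h0 : 0 ≤ (1 - Real.exp (-(2 * relaxRate ν α k * t))) := by
            rw [sub_nonneg, Real.exp_le_one_iff]
            have : 0 ≤ 2 * relaxRate ν α k * t := by
              have : 0 < relaxRate ν α k := hν.trans_le ha
              positivity
            linarith
          have h1 : 1 - Real.exp (-(2 * relaxRate ν α k * t)) ≤ 1 := by
            linarith [Real.exp_pos (-(2 * relaxRate ν α k * t))]
          gcongr
          exact (hb k hk).2
      _ = _ := by ring

/-- The field `z_t` is a Gaussian Fourier series with regularity index `H = α + δ - 1`. -/
lemma IsLinearSolution.exists_isGaussianFourier (hν : 0 < ν) (hα : 1 ≤ α)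
    (hC : NoiseAssumption α δ C) (hS : IsPositiveSqrt S C) (hW : IsCylindricalWiener W P)
    (hz : IsLinearSolution ν α S W P z) {t : ℝ≥0} (ht : 0 < t) :
    ∃ (Z : ℤ × ℤ → Ω → ℝ) (q : ℤ × ℤ → ℝ) (c c' : ℝ),
      IsGaussianFourier P (α + δ - 1) Z q c c' ∧
        ∀ᵐ ω ∂P, ∀ k : ℤ × ℤ, k ≠ 0 → fourierCoeffReal (z t ω) k = Z k ω := by
  obtain ⟨c, c', hc, hb⟩ := exists_modeVariance_bounds hν hα hC hS ht
  have hlaw := fun F a => hz.hasLaw_sum_inner hC hS hW t F a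
  have hm : ∀ k, AEMeasurable (fun ω => ⟪z t ω, modeVec k⟫) P := fun k => by
    simpa using (hlaw {k} 1).aemeasurable
  -- the coefficients are only almost everywhere measurable, so pass to measurable versions
  set Z : ℤ × ℤ → Ω → ℝ := fun k => if k = 0 then 0 else (hm k).mk with hZ
  have hae : ∀ᵐ ω ∂P, ∀ k, ⟪z t ω, modeVec k⟫ = Z k ω := by
    rw [ae_all_iff]
    intro k
    rcases eq_or_ne k 0 with rfl | hk
    · simp [hZ, modeVec]
    · simp only [hZ, if_neg hk]
      exact (hm k).ae_eq_mk
  refine ⟨Z, modeVariance ν α S t, c, c', ?_, ?_⟩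
  · refine
      { H_pos := by linarith [hC.lt_delta]
        H_lt_one := by linarith [hC.delta_lt]
        c_pos := hc
        measurable := fun k => ?_
        coeff_zero := by simp [hZ]
        var_zero := by simp [modeVariance, modeVec]
        law := fun F a => (hlaw F a).congr ?_
        le_var := fun k hk => (hb k hk).1
        var_le := fun k hk => (hb k hk).2 }
    · rcases eq_or_ne k 0 with rfl | hk
      · simp only [hZ, if_true]; exact measurable_const
      · simpa only [hZ, if_neg hk] using (hm k).measurable_mk
    · filter_upwards [hae] with ω hω
      simp [hω]
  · filter_upwards [hae] with ω hω k hk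
    rw [← hω, inner_modeVec hk]

end Coefficients

/-! ### Uniqueness of the continuous version and the dimension of its level sets -/

lemma IsContinuousVersion.eqOn_torus {u : L2Mean0} {v w : Plane → ℝ} (hv : IsContinuousVersion u v)
    (hw : IsContinuousVersion u w) : Set.EqOn v w torus := by
  have hae : v =ᵐ[(volume : Measure Plane).restrict torus] w := hv.ae_eq.trans hw.ae_eq.symm
  set O : Set Plane := {x | ∀ i, x i ∈ Set.Ioo (-Real.pi) Real.pi} with hO
  have hOo : IsOpen O := by
    simp only [hO, Set.ofPred_forall]
    exact isOpen_iInter_of_finite fun i => isOpen_Ioo.preimage (by fun_prop)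
  have hOT : O ⊆ torus := fun x hx i => Set.Ioo_subset_Icc_self (hx i)
  have h1 : Set.EqOn v w O := Measure.eqOn_open_of_ae_eq
    (ae_restrict_of_ae_restrict_of_subset hOT hae) hOo hv.continuous.continuousOn
    hw.continuous.continuousOn
  have hcl : torus ⊆ closure O := by
    intro x hx
    -- approximate a boundary point along the ray from the centre
    have hlim : Filter.Tendsto (fun n : ℕ => (1 - 1 / ((n : ℝ) + 1)) • x) Filter.atTop (nhds x) := by
      have := (tendsto_one_div_add_atTop_nhds_zero_nat (𝕜 := ℝ)).const_sub 1
      simpa using this.smul_const x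
    refine mem_closure_of_tendsto hlim (Filter.Eventually.of_forall fun n i => ?_)
    have hn : (0 : ℝ) < 1 / ((n : ℝ) + 1) := by positivity
    have hn1 : 1 / ((n : ℝ) + 1) ≤ 1 := by
      rw [div_le_one (by positivity)]
      linarith [(Nat.cast_nonneg n : (0 : ℝ) ≤ n)]
    have hpi := Real.pi_pos
    have h := hx i
    simp only [PiLp.smul_apply, smul_eq_mul]
    constructor <;> nlinarith [h.1, h.2]
  exact (h1.closure hv.continuous hw.continuous).mono hcl

lemma IsContinuousVersion.levelSet_eq {u : L2Mean0} {v w : Plane → ℝ}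
    (hv : IsContinuousVersion u v) (hw : IsContinuousVersion u w) (y : ℝ) :
    levelSet y v = levelSet y w := by
  ext x
  exact and_congr_right fun hx => by rw [hv.eqOn_torus hw hx]

theorem theorem2p1 {Ω : Type*} [MeasurableSpace Ω] (P : Measure Ω) [IsProbabilityMeasure P]
    (ν α δ : ℝ) (hν : 0 < ν) (hα : 1 ≤ α)
    (C S : L2Mean0 →L[ℝ] L2Mean0) (hC : NoiseAssumption α δ C) (hS : IsPositiveSqrt S C)
    (W : ℝ≥0 → L2Mean0 → Ω → ℝ) (hW : IsCylindricalWiener W P)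
    (z : ℝ≥0 → Ω → L2Mean0) (hz : IsLinearSolution ν α S W P z)
    (t : ℝ≥0) (ht : 0 < t) :
    (∀ᵐ ω ∂P, ∃ v : Plane → ℝ, IsContinuousVersion (z t ω) v) ∧
    ∀ ζ : Ω → Plane → ℝ, (∀ᵐ ω ∂P, IsContinuousVersion (z t ω) (ζ ω)) → ∀ y : ℝ,
      (∀ᵐ ω ∂P, dimP (levelSet y (ζ ω)) ≤ ENNReal.ofReal (3 - α - δ)) ∧
      ∃ E : Set Ω, MeasurableSet E ∧ 0 < P E ∧ ∀ ω ∈ E,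
        dimP (levelSet y (ζ ω)) = ENNReal.ofReal (3 - α - δ) ∧
        dimH (levelSet y (ζ ω)) = ENNReal.ofReal (3 - α - δ) := by
  obtain ⟨Z, q, c, c', hZ, hcoef⟩ := hz.exists_isGaussianFourier hν hα hC hS hW ht
  have hH := hZ.H_pos
  have hver : ∀ᵐ ω ∂P, IsContinuousVersion (z t ω) (trigField fun k => Z k ω) := by
    filter_upwards [hcoef, hZ.ae_exists_hasShellBound (β := (α + δ - 1) / 2) (by linarith)]
      with ω hω ⟨K, hK⟩
    exact hK.isContinuousVersion (by linarith) (by rw [hZ.coeff_zero]; rfl) hω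
  refine ⟨hver.mono fun ω hω => ⟨_, hω⟩, fun ζ hζ y => ?_⟩
  have hup : ∀ᵐ ω ∂P, dimP (levelSet y (ζ ω)) ≤ ENNReal.ofReal (3 - α - δ) := by
    filter_upwards [hver, hζ, hZ.ae_dimP_levelSet_le y] with ω h1 h2 h3
    rw [h2.levelSet_eq h1]
    convert h3 using 2; ring
  refine ⟨hup, ?_⟩
  obtain ⟨E, hE, hPE, hlow⟩ := hZ.exists_le_dimH_levelSet y
  obtain ⟨G, hGP, hGm, hGsub⟩ := (hver.and (hζ.and hup)).exists_measurable_mem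
  refine ⟨E ∩ G, hE.inter hGm, ?_, fun ω hω => ?_⟩
  · rwa [measure_inter_conull (mem_ae_iff.1 hGP)]
  · obtain ⟨h1, h2, h3⟩ := hGsub ω hω.2
    have h4 : ENNReal.ofReal (3 - α - δ) ≤ dimH (levelSet y (ζ ω)) := by
      have := hlow ω hω.1 h1.continuous
      rw [h2.levelSet_eq h1]
      convert this using 2; ring
    exact ⟨le_antisymm h3 (h4.trans (dimH_le_dimP _)),
      le_antisymm ((dimH_le_dimP _).trans h3) h4⟩
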